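/- Let $m\ge 2$ be an integer and let $a_1,\dots,a_m\in(0,\infty)$ be such that $a_j/a_k\notin\mathbb{Q}$ for $j\ne k$. Let $$E(a_1,\dots,a_m)=\Big\{(z_1,\dots,z_m)\in\mathbb{C}^m \;\Big|\; \frac{|z_1|^2}{a_1}+\cdots+\frac{|z_m|^2}{a_m}\le 1\Big\},\qquad \lambda=\sum_{k=1}^m\frac{x_k\,dy_k-y_k\,dx_k}{2}\quad(z_k=x_k+iy_k),$$ and let $M=\partial E(a_1,\dots,a_m)$, with the contact form given by the restriction of $\lambda$ and the contact distribution $\xi=\ker\lambda|_{TM}$. For $j\in\{1,\dots,m\}$ the curve $$\gamma_j:[0,\pi a_j]\to M,\qquad \gamma_j(t)=\big(0,\dots,0,\sqrt{a_j}\,e^{2it/a_j},0,\dots,0\big)$$ ($j$-th coordinate nonzero) is a simple periodic Reeb orbit on $M$. For every integer $n\ge 1$, the Conley–Zehnder index of its $n$-th iterate $\gamma_j^n:[0,n\pi a_j]\to M$ (given by the same formula) is $$\mu_{CZ}(\gamma_j^n)=m-1+2\sum_{k=1}^m\Big\lfloor n\,\frac{a_j}{a_k}\Big\rfloor .$$ Here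 $\mu_{CZ}$ is defined as follows. Let $J_0=\begin{bmatrix}0&\mathrm{id}\\-\mathrm{id}&0\end{bmatrix}$. (a) Let $\Phi:[a,b]\to Sp(2d)$ be a smooth path. A number $t\in[a,b]$ is a crossing if $\det(\Phi_t-\mathrm{id})=0$; its crossing form is the quadratic form $\Gamma(\Phi,t)(\zeta,\eta)=\zeta^T J_0(\partial_t\Phi_t)\Phi_t^{-1}\eta$ on $\ker(\Phi_t-\mathrm{id})$. If all crossings in $[a,b]$ are isolated with non-degenerate crossing form, then $$\mu_{CZ}(\Phi)=\tfrac12\operatorname{sign}\Gamma(\Phi,a)+\sum_{t\in(a,b)\text{ crossing}}\operatorname{sign}\Gamma(\Phi,t)+\tfrac12\operatorname{sign}\Gamma(\Phi,b),$$ where the end-point terms are $0$ at non-crossings. The index of a continuous path $\Psi:[a,b]\to Sp(2d)$ is $\mu_{CZ}(\Phi)$ for any such $\Phi$ homotopic to $\Psi$ in $Sp(2d)$ with fixed end-points. (b) Let $\gamma:[0,c]\to M$ be a $c$-periodic Reeb orbit, $\sigma_t$ the Reeb flow, $u:\mathbb{D}\to M$ a continuous map of the closed unit disk with $u(e^{2\pi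 i t/c})=\gamma(t)$ (a capping disk), and $T_z:\mathbb{R}^{2m-2}\to\xi_{u(z)}$, $z\in\mathbb{D}$, a continuous family of linear isomorphisms with $d\lambda(T_z\zeta,T_z\eta)=\zeta^TJ_0\eta$ (a capping trivialization). Then $\mu_{CZ}(\gamma)$ is the index of the path $t\mapsto T_{e^{2\pi it/c}}^{-1}\circ d\sigma_t(\gamma(0))\circ T_1$, $t\in[0,c]$. The claim is that a capping disk and a capping trivialization of $\gamma_j^n$ exist, and that for every choice of them the path in (b) has an index as in (a), which is uniquely determined and is equal to $m-1+2\sum_{k=1}^m\lfloor na_j/a_k\rfloor$. -/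

import Mathlib

open Set
open scoped ContDiff Matrix

noncomputable section

/-! ### The Conley-Zehnder (Robbin-Salamon) index of a path of symplectic matrices -/

namespace SympPath

variable {ι : Type*} [Fintype ι] [DecidableEq ι]

/-- The matrix `[[0, 1], [-1, 0]]`. (Mathlib's `Matrix.J` is `[[0, -1], [1, 0]]`; the two define the
same group `Matrix.symplecticGroup`.) -/
def J₀ (ι : Type*) [Fintype ι] [DecidableEq ι] : Matrix (ι ⊕ ι) (ι ⊕ ι) ℝ :=
  Matrix.fromBlocks 0 1 (-1) 0

/-- The (entrywise) derivative of a path of matrices defined on `[a, b]`; one-sided at the ends. -/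
def velocity (Φ : ℝ → Matrix (ι ⊕ ι) (ι ⊕ ι) ℝ) (a b t : ℝ) : Matrix (ι ⊕ ι) (ι ⊕ ι) ℝ :=
  Matrix.of fun i j => derivWithin (fun s => Φ s i j) (Icc a b) t

/-- The matrix `S_t = J₀ (∂_t Φ_t) Φ_t⁻¹`. -/
def generator (Φ : ℝ → Matrix (ι ⊕ ι) (ι ⊕ ι) ℝ) (a b t : ℝ) : Matrix (ι ⊕ ι) (ι ⊕ ι) ℝ :=
  J₀ ι * velocity Φ a b t * (Φ t)⁻¹

/-- `t` is a crossing if `det (Φ_t - id) = 0`. -/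
def IsCrossing (Φ : ℝ → Matrix (ι ⊕ ι) (ι ⊕ ι) ℝ) (t : ℝ) : Prop :=
  (Φ t - 1).det = 0

/-- The subspace `ker (Φ_t - id)`. -/
def fixedSpace (Φ : ℝ → Matrix (ι ⊕ ι) (ι ⊕ ι) ℝ) (t : ℝ) : Submodule ℝ (ι ⊕ ι → ℝ) :=
  LinearMap.ker (Matrix.toLin' (Φ t - 1))

/-- The crossing form `Γ(Φ, t) (ζ, η) = ζᵀ S_t η` on `ker (Φ_t - id)`, as a bilinear form. -/
def crossingForm (Φ : ℝ → Matrix (ι ⊕ ι) (ι ⊕ ι) ℝ) (a b t : ℝ) :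
    LinearMap.BilinForm ℝ (fixedSpace Φ t) :=
  LinearMap.BilinForm.restrict (Matrix.toBilin' (generator Φ a b t)) (fixedSpace Φ t)

/-- The signature of the crossing form: the number of positive minus the number of negative
squares. It is `0` if `t` is not a crossing, since then `ker (Φ_t - id) = 0`. -/
def crossingSign (Φ : ℝ → Matrix (ι ⊕ ι) (ι ⊕ ι) ℝ) (a b t : ℝ) : ℤ :=
  (sigPos (crossingForm Φ a b t).toQuadraticMap : ℤ) -
    (sigNeg (crossingForm Φ a b t).toQuadraticMap : ℤ)

/-- Smooth paths `[a, b] → Sp` all of whose crossings (including those at the ends) are isolated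
and non-degenerate. As the set of crossings in `[a, b]` is compact, they are isolated if and only
if there are finitely many of them. -/
structure IsRegular (Φ : ℝ → Matrix (ι ⊕ ι) (ι ⊕ ι) ℝ) (a b : ℝ) : Prop where
  symplectic : ∀ t ∈ Icc a b, Φ t ∈ Matrix.symplecticGroup ι ℝ
  smooth : ∀ i j, ContDiffOn ℝ ∞ (fun t => Φ t i j) (Icc a b)
  isolated : {t ∈ Icc a b | IsCrossing Φ t}.Finite
  nondegenerate : ∀ t ∈ Icc a b, IsCrossing Φ t → (crossingForm Φ a b t).Nondegenerate

/-- The crossing sum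
`½ sign Γ(Φ, a) + ∑ sign Γ(Φ, t) + ½ sign Γ(Φ, b)`, over the crossings `t ∈ (a, b)`. -/
def crossingSum (Φ : ℝ → Matrix (ι ⊕ ι) (ι ⊕ ι) ℝ) (a b : ℝ) : ℝ :=
  (crossingSign Φ a b a : ℝ) / 2 +
    ∑ᶠ t ∈ {t ∈ Ioo a b | IsCrossing Φ t}, (crossingSign Φ a b t : ℝ) +
    (crossingSign Φ a b b : ℝ) / 2

/-- `Ψ` and `Φ` are paths `[a, b] → Sp` that are homotopic in `Sp` with fixed end-points. -/
def HomotopicRelEnds (Ψ Φ : ℝ → Matrix (ι ⊕ ι) (ι ⊕ ι) ℝ) (a b : ℝ) : Prop :=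
  ∃ H : ℝ × ℝ → Matrix (ι ⊕ ι) (ι ⊕ ι) ℝ,
    ContinuousOn H (Icc 0 1 ×ˢ Icc a b) ∧
    (∀ s ∈ Icc (0 : ℝ) 1, ∀ t ∈ Icc a b, H (s, t) ∈ Matrix.symplecticGroup ι ℝ) ∧
    (∀ t ∈ Icc a b, H (0, t) = Ψ t ∧ H (1, t) = Φ t) ∧
    (∀ s ∈ Icc (0 : ℝ) 1, H (s, a) = Ψ a ∧ H (s, b) = Ψ b)

/-- The continuous path `Ψ : [a, b] → Sp` has Conley-Zehnder index `μ`: this is the value of the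
crossing sum on a regular path that is homotopic to `Ψ` with fixed end-points. -/
def HasIndex (Ψ : ℝ → Matrix (ι ⊕ ι) (ι ⊕ ι) ℝ) (a b μ : ℝ) : Prop :=
  ∃ Φ, IsRegular Φ a b ∧ HomotopicRelEnds Ψ Φ a b ∧ crossingSum Φ a b = μ

end SympPath

/-! ### Reeb orbits on a submanifold of a vector space

`M` is an (embedded) odd-dimensional submanifold of a real vector space `E`, and `α` is a 1-form on
`E` whose restriction to `M` is a contact form. The tangent space `T_p M` is `tangentConeAt ℝ M p`.
-/

namespace Contact

variable {E : Type*} [NormedAddCommGroup E] [NormedSpace ℝ E]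

/-- The contact distribution `ξ_p = ker α_p ∩ T_p M`. -/
def distribution (M : Set E) (α : E → E [⋀^Fin 1]→L[ℝ] ℝ) (p : E) : Set E :=
  {v ∈ tangentConeAt ℝ M p | α p ![v] = 0}

/-- `v` is the value at `p` of the Reeb vector field of `α|_M`:
`v ∈ T_p M`, `α(v) = 1`, and `dα(v, w) = 0` for all `w ∈ T_p M`. -/
def IsReebVector (M : Set E) (α : E → E [⋀^Fin 1]→L[ℝ] ℝ) (p v : E) : Prop :=
  v ∈ tangentConeAt ℝ M p ∧ α p ![v] = 1 ∧
    ∀ w ∈ tangentConeAt ℝ M p, extDeriv α p ![v, w] = 0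

/-- `γ` is an integral curve of the Reeb vector field on `M`. -/
def IsReebTrajectory (M : Set E) (α : E → E [⋀^Fin 1]→L[ℝ] ℝ) (γ : ℝ → E) : Prop :=
  ∀ t, γ t ∈ M ∧ ∃ v, IsReebVector M α (γ t) v ∧ HasDerivAt γ v t

/-- `σ` is the Reeb flow on `M`. (The values of `σ t` outside `M` are irrelevant.) -/
def IsReebFlow (M : Set E) (α : E → E [⋀^Fin 1]→L[ℝ] ℝ) (σ : ℝ → E → E) : Prop :=
  ∀ p ∈ M, σ 0 p = p ∧ IsReebTrajectory M α fun t => σ t p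

/-- `γ`, restricted to `[0, c]`, is a `c`-periodic Reeb orbit on `M`. For an orbit `γ` of period `c`,
the `n`-th iterate is given by the same map `γ` with period `n * c`. -/
def IsPeriodicReebOrbit (M : Set E) (α : E → E [⋀^Fin 1]→L[ℝ] ℝ) (γ : ℝ → E) (c : ℝ) : Prop :=
  0 < c ∧ IsReebTrajectory M α γ ∧ Function.Periodic γ c

/-- A `c`-periodic Reeb orbit is simple if it is injective on `(0, c)`. -/
def IsSimpleReebOrbit (M : Set E) (α : E → E [⋀^Fin 1]→L[ℝ] ℝ) (γ : ℝ → E) (c : ℝ) : Prop :=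
  IsPeriodicReebOrbit M α γ c ∧ InjOn γ (Ioo 0 c)

/-- The boundary point `exp (2 π i t / c)` of the unit disk in `ℂ`. -/
def boundaryPoint (c t : ℝ) : ℂ :=
  Complex.exp (2 * Real.pi * Complex.I * (t / c : ℝ))

/-- `u` is a capping disk in `M` of the `c`-periodic orbit `γ`. -/
def IsCappingDisk (M : Set E) (γ : ℝ → E) (c : ℝ) (u : ℂ → E) : Prop :=
  ContinuousOn u (Metric.closedBall 0 1) ∧ MapsTo u (Metric.closedBall 0 1) M ∧
    ∀ t, u (boundaryPoint c t) = γ t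

/-- `T` is a symplectic trivialization of the bundle `u^* ξ` over the closed unit disk:
`T_z : ℝ^{2d} → ξ_{u(z)}` is onto, depends continuously on `z`, and satisfies
`dα (T_z ζ, T_z η) = ζᵀ J₀ η` (which makes it injective). -/
def IsDiskTrivialization {ι : Type*} [Fintype ι] [DecidableEq ι] (M : Set E)
    (α : E → E [⋀^Fin 1]→L[ℝ] ℝ) (u : ℂ → E) (T : ℂ → (ι ⊕ ι → ℝ) →L[ℝ] E) : Prop :=
  ContinuousOn T (Metric.closedBall 0 1) ∧
    ∀ z ∈ Metric.closedBall (0 : ℂ) 1, range (T z) = distribution M α (u z) ∧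
      ∀ ζ η, extDeriv α (u z) ![T z ζ, T z η] = ζ ⬝ᵥ (SympPath.J₀ ι *ᵥ η)

/-- The path of matrices `Ψ` on `[0, c]` is `t ↦ T_t⁻¹ ∘ dσ_t(p) ∘ T_0`, where `T_t` stands for
`T (exp (2 π i t / c))`. The differential `dσ_t(p) : T_p M → T_{σ_t(p)} M` of the map
`σ_t : M → M` is the restriction of `fderivWithin ℝ (σ t) M p` to `T_p M`. -/
def IsLinearizedFlow {ι : Type*} [Fintype ι] [DecidableEq ι] (M : Set E) (σ : ℝ → E → E) (p : E)
    (c : ℝ) (T : ℂ → (ι ⊕ ι → ℝ) →L[ℝ] E) (Ψ : ℝ → Matrix (ι ⊕ ι) (ι ⊕ ι) ℝ) : Prop :=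
  ∀ t ∈ Icc 0 c, ∀ ζ : ι ⊕ ι → ℝ,
    T (boundaryPoint c t) (Ψ t *ᵥ ζ) = fderivWithin ℝ (σ t) M p (T (boundaryPoint c 0) ζ)

/-- The assertion `μ_CZ(γ) = μ` for a `c`-periodic Reeb orbit `γ` on a contact manifold `M` of
dimension `2 d + 1`. There are a Reeb flow, a capping disk and a capping trivialization; and for
*every* choice of them, the path `t ↦ T_t⁻¹ ∘ dσ_t(γ(0)) ∘ T_0` of matrices
exists, has a Conley-Zehnder index, and its only Conley-Zehnder index is `μ`. -/
def ReebOrbitHasIndex (d : ℕ) (M : Set E) (α : E → E [⋀^Fin 1]→L[ℝ] ℝ) (γ : ℝ → E)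
    (c μ : ℝ) : Prop :=
  IsPeriodicReebOrbit M α γ c ∧
  (∃ σ, IsReebFlow M α σ) ∧
  (∃ (u : ℂ → E) (T : ℂ → (Fin d ⊕ Fin d → ℝ) →L[ℝ] E),
    IsCappingDisk M γ c u ∧ IsDiskTrivialization M α u T) ∧
  ∀ (σ : ℝ → E → E) (u : ℂ → E) (T : ℂ → (Fin d ⊕ Fin d → ℝ) →L[ℝ] E),
    IsReebFlow M α σ → IsCappingDisk M γ c u → IsDiskTrivialization M α u T →
      ∃ Ψ, IsLinearizedFlow M σ (γ 0) c T Ψ ∧ ∀ r, SympPath.HasIndex Ψ 0 c r ↔ r = μ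

end Contact

/-! ### Ellipsoids -/

namespace Ellipsoid

variable {m : ℕ}

/-- The ellipsoid `E(a_1, …, a_m)` in `ℂ^m`. -/
def ellipsoid (a : Fin m → ℝ) : Set (Fin m → ℂ) :=
  {z | ∑ k, ‖z k‖ ^ 2 / a k ≤ 1}

/-- The coordinate form `dx_k` on `ℂ^m`, where `z_k = x_k + i y_k`. -/
def dx (k : Fin m) : (Fin m → ℂ) →L[ℝ] ℝ :=
  Complex.reCLM.comp (ContinuousLinearMap.proj k)

/-- The coordinate form `dy_k` on `ℂ^m`, where `z_k = x_k + i y_k`. -/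
def dy (k : Fin m) : (Fin m → ℂ) →L[ℝ] ℝ :=
  Complex.imCLM.comp (ContinuousLinearMap.proj k)

/-- The standard Liouville form `λ = ∑ (x_k dy_k - y_k dx_k) / 2` on `ℂ^m`. -/
def liouvilleForm (m : ℕ) (z : Fin m → ℂ) : (Fin m → ℂ) [⋀^Fin 1]→L[ℝ] ℝ :=
  ContinuousAlternatingMap.ofSubsingleton ℝ (Fin m → ℂ) ℝ 0
    (∑ k, (2⁻¹ : ℝ) • ((z k).re • dy k - (z k).im • dx k))

/-- The orbit `γ_j : t ↦ (0, …, 0, √a_j exp (2 i t / a_j), 0, …, 0)`, with the `j`-th coordinate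
nonzero. -/
def orbit (a : Fin m → ℝ) (j : Fin m) (t : ℝ) : Fin m → ℂ :=
  Pi.single j ((Real.sqrt (a j) : ℂ) * Complex.exp (2 * Complex.I * (t / a j : ℝ)))

end Ellipsoid

end

/-!
The index is computed through *lifts*. Graphs of symplectic matrices are Lagrangian, and around each
`R` without eigenvalue `1` those transverse to the graph of `R` form an affine chart, in which `Φ`
becomes the symmetric matrix `chartForm Ω R Φ`, with kernel `ker (Φ - 1)`. The signatures of two
charts differ by a locally constant function (`eventually_sgn_sub_sgn_eq`), so they glue, over a
simply connected parameter space, to an integer function that is unique up to a constant: the lift of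
a map into the symplectic group (`IsLift`, `exists_isLift_univ`). At a nondegenerate crossing the
signature jumps by the signature of the crossing form, before and after the crossing alike
(`eventually_jump_left`, `eventually_jump_right`), so the crossing sum of a regular path is half the
increment of its lift (`SympPath.IsRegular.exists_isLift`). A lift over a square is constant along
sides on which the nullity of `Φ - 1` is constant, so the increment is a homotopy invariant
(`lift_increment_eq`). As every continuous path is homotopic to a regular one
(`SympPath.exists_isRegular_homotopic`), each has exactly one index, half the increment of any of its
lifts (`SympPath.hasIndex_iff`).

The Reeb flow of the ellipsoid is the unitary flow `z_k ↦ exp (2 i t / a_k) z_k`, and it is the only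
one. Given a capping disk `u` and a trivialization `T` over it, the radial vector and the Reeb vector
complete `T` to a frame of the trivial bundle `ℂ^m`. In this frame the linearized flow is the path of
`T` plus an identity block. Contracting the disk to its centre turns it into the flow in a constant
frame, and during the contraction the matrices at the two ends are merely conjugated, so that the
increment of the lift does not change (`Ellipsoid.increment_eq_crossingCount`). The crossing forms of
the flow of `ℂ^m` are positive definite, whence its increment is twice
`∑_k (⌊n a_j / a_k⌋ + ⌈n a_j / a_k⌉)`, where ceiling and floor differ by one for `k ≠ j` and agree
for `k = j`.
-/

set_option linter.unusedSectionVars false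

noncomputable section

/-! ### Signatures of real symmetric matrices -/

namespace MatrixSignature

open Filter Topology

section General

variable {M V : Type*} [AddCommGroup M] [Module ℝ M] [AddCommGroup V] [Module ℝ V]

/-- A linear map on which `Q` pulls back to a positive definite form is injective, so its source is
no larger than a maximal positive subspace. -/
lemma finrank_le_sigPos [FiniteDimensional ℝ V] (Q : QuadraticForm ℝ V) (L : M →ₗ[ℝ] V)
    (h : ∀ x, x ≠ 0 → 0 < Q (L x)) : Module.finrank ℝ M ≤ sigPos Q := by
  have hinj : Function.Injective L := by
    rw [injective_iff_map_eq_zero]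
    intro x hx
    by_contra hne
    have := h x hne
    simp [hx] at this
  rw [← LinearMap.finrank_range_of_inj hinj]
  apply le_sigPos_of_posDef
  rintro ⟨_, x, rfl⟩ hx
  have : x ≠ 0 := by rintro rfl; simp at hx
  exact h x this

/-- A linear parametrization of a maximal positive subspace. -/
lemma exists_linearMap_sigPos [FiniteDimensional ℝ V] (Q : QuadraticForm ℝ V) :
    ∃ L : (Fin (sigPos Q) → ℝ) →ₗ[ℝ] V, ∀ x, x ≠ 0 → 0 < Q (L x) := by
  obtain ⟨W, h1, h2⟩ := exists_finrank_eq_sigPos_and_posDef Q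
  let e : (Fin (sigPos Q) → ℝ) ≃ₗ[ℝ] W := LinearEquiv.ofFinrankEq _ _ (by simp [h1])
  refine ⟨W.subtype ∘ₗ e.toLinearMap, fun x hx => ?_⟩
  exact h2 (e x) (by simpa using hx)

end General

variable {n : Type*} [Fintype n] [DecidableEq n]

/-- The quadratic form `x ↦ xᵀ A x`. -/
def quadForm (A : Matrix n n ℝ) : QuadraticForm ℝ (n → ℝ) :=
  (Matrix.toBilin' A).toQuadraticMap

lemma quadForm_apply (A : Matrix n n ℝ) (x : n → ℝ) : quadForm A x = x ⬝ᵥ A *ᵥ x := by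
  simp [quadForm, LinearMap.BilinMap.toQuadraticMap_apply, Matrix.toBilin'_apply']

/-- The number of positive minus the number of negative squares of `x ↦ xᵀ A x`. -/
def sgn (A : Matrix n n ℝ) : ℤ := (sigPos (quadForm A) : ℤ) - (sigNeg (quadForm A) : ℤ)

lemma quadForm_neg (A : Matrix n n ℝ) : quadForm (-A) = -quadForm A := by
  ext x; simp [quadForm_apply, Matrix.neg_mulVec]

/-- The dimension of the kernel of a matrix. -/
def nullity (A : Matrix n n ℝ) : ℕ := Module.finrank ℝ (LinearMap.ker (Matrix.toLin' A))

lemma radical_quadForm {A : Matrix n n ℝ} (hA : Aᵀ = A) :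
    (quadForm A).radical = LinearMap.ker (Matrix.toLin' A) := by
  ext x
  have key : ∀ y, (quadForm A) (x + y) = quadForm A x + quadForm A y + 2 * (y ⬝ᵥ A *ᵥ x) := by
    intro y
    simp only [quadForm_apply, Matrix.mulVec_add, add_dotProduct, dotProduct_add]
    have : x ⬝ᵥ A *ᵥ y = y ⬝ᵥ A *ᵥ x := by
      rw [Matrix.dotProduct_mulVec, ← Matrix.mulVec_transpose, hA, dotProduct_comm]
    rw [this]; ring
  rw [QuadraticMap.mem_radical_iff', LinearMap.mem_ker, Matrix.toLin'_apply]
  constructor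
  · rintro ⟨h1, h2⟩
    have h3 := h2 (A *ᵥ x)
    rw [key, h1] at h3
    have : A *ᵥ x ⬝ᵥ A *ᵥ x = 0 := by linarith
    exact dotProduct_self_eq_zero.1 this
  · intro h
    have h0 : quadForm A x = 0 := by simp [quadForm_apply, h]
    refine ⟨h0, fun y => ?_⟩
    rw [key, h0, h]; simp

lemma sigPos_add_sigNeg_add_nullity {A : Matrix n n ℝ} (hA : Aᵀ = A) :
    sigPos (quadForm A) + sigNeg (quadForm A) + nullity A = Fintype.card n := by
  have := QuadraticForm.sigPos_add_sigNeg_add_radical (Q := quadForm A)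
  rw [radical_quadForm hA] at this
  simpa [nullity] using this

lemma continuous_quadForm :
    Continuous fun p : Matrix n n ℝ × (n → ℝ) => quadForm p.1 p.2 := by
  simp only [quadForm_apply, dotProduct, Matrix.mulVec]
  fun_prop

variable {ι : Type*} {l : Filter ι}

lemma eventually_sigPos_le {A : ι → Matrix n n ℝ} {A₀ : Matrix n n ℝ}
    (hA : Tendsto A l (𝓝 A₀)) : ∀ᶠ i in l, sigPos (quadForm A₀) ≤ sigPos (quadForm (A i)) := by
  obtain ⟨L, hpos⟩ := exists_linearMap_sigPos (quadForm A₀)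
  have hLc : Continuous L := L.continuous_of_finiteDimensional
  have h1 : ∀ᶠ B in 𝓝 A₀, ∀ x ∈ Metric.sphere (0 : Fin (sigPos (quadForm A₀)) → ℝ) 1,
      0 < quadForm B (L x) := by
    apply (isCompact_sphere _ _).eventually_forall_of_forall_eventually
    intro x hx1
    have h0 : 0 < quadForm A₀ (L x) := hpos x (by rintro rfl; simp at hx1)
    exact ((continuous_quadForm.comp (continuous_fst.prodMk (hLc.comp continuous_snd))).tendsto
      (A₀, x)).eventually (lt_mem_nhds h0)
  filter_upwards [hA.eventually h1] with i hi
  refine le_trans (le_of_eq ?_) (finrank_le_sigPos (quadForm (A i)) L fun x hx => ?_)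
  · simp
  have hn : 0 < ‖x‖ := norm_pos_iff.2 hx
  have := hi (‖x‖⁻¹ • x) (by simp [norm_smul, hn.ne'])
  rw [map_smul, QuadraticMap.map_smul] at this
  exact pos_of_mul_pos_right (by simpa using this) (by positivity)

lemma eventually_sigNeg_le {A : ι → Matrix n n ℝ} {A₀ : Matrix n n ℝ}
    (hA : Tendsto A l (𝓝 A₀)) : ∀ᶠ i in l, sigNeg (quadForm A₀) ≤ sigNeg (quadForm (A i)) := by
  have := eventually_sigPos_le hA.neg
  simpa only [quadForm_neg, sigPos_neg] using this

/-- The signature is locally constant as long as the nullity does not change. -/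
lemma eventually_sgn_eq {A : ι → Matrix n n ℝ} {A₀ : Matrix n n ℝ} (hA : Tendsto A l (𝓝 A₀))
    (hsymm : ∀ᶠ i in l, (A i)ᵀ = A i) (h₀ : A₀ᵀ = A₀)
    (hnull : ∀ᶠ i in l, nullity (A i) = nullity A₀) : ∀ᶠ i in l, sgn (A i) = sgn A₀ := by
  filter_upwards [eventually_sigPos_le hA, eventually_sigNeg_le hA, hsymm, hnull]
    with i h1 h2 h3 h4
  have h5 := sigPos_add_sigNeg_add_nullity h3
  have h6 := sigPos_add_sigNeg_add_nullity h₀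
  unfold sgn
  omega

lemma sigPos_le_of_comp {m : Type*} [Fintype m] [DecidableEq m] {A : Matrix n n ℝ}
    {B : Matrix m m ℝ} (D : (m → ℝ) →ₗ[ℝ] (n → ℝ)) (h : ∀ x, quadForm A (D x) = quadForm B x) :
    sigPos (quadForm B) ≤ sigPos (quadForm A) := by
  obtain ⟨L, hpos⟩ := exists_linearMap_sigPos (quadForm B)
  refine le_trans (le_of_eq ?_) (finrank_le_sigPos (quadForm A) (D ∘ₗ L) fun x hx => ?_)
  · simp
  simp only [LinearMap.comp_apply, h]
  exact hpos x hx

/-- The rescaled forms `A(u + r^{-1/2} k)`, `k ∈ ker A₀`, converge to `A₀(u) + B(k)`. -/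
lemma eventually_sigPos_add_le {A : ι → Matrix n n ℝ} {A₀ B : Matrix n n ℝ} {r : ι → ℝ}
    (hA : Tendsto A l (𝓝 A₀)) (hsymm : ∀ᶠ i in l, (A i)ᵀ = A i) (h₀ : A₀ᵀ = A₀)
    (hr : ∀ᶠ i in l, 0 < r i) (hr0 : Tendsto r l (𝓝 0)) {K : Submodule ℝ (n → ℝ)}
    (hK : ∀ x, x ∈ K ↔ A₀ *ᵥ x = 0)
    (hlim : ∀ x ∈ K, Tendsto (fun i => (r i)⁻¹ • (A i *ᵥ x)) l (𝓝 (B *ᵥ x)))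
    (g : QuadraticForm ℝ K) (hg : ∀ x : K, g x = (x : n → ℝ) ⬝ᵥ B *ᵥ x) :
    ∀ᶠ i in l, sigPos (quadForm A₀) + sigPos g ≤ sigPos (quadForm (A i)) := by
  obtain ⟨p, hp⟩ := LinearMap.exists_leftInverse_of_injective K.subtype (Submodule.ker_subtype K)
  set P : Matrix n n ℝ := LinearMap.toMatrix' (K.subtype ∘ₗ p) with hPdef
  have hPmul : ∀ x, P *ᵥ x = p x := fun x => by
    rw [hPdef, LinearMap.toMatrix'_mulVec]; rfl
  have hPK : ∀ x, P *ᵥ x ∈ K := fun x => by rw [hPmul]; exact (p x).2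
  have hPid : ∀ x ∈ K, P *ᵥ x = x := fun x hx => by
    rw [hPmul]
    have := LinearMap.congr_fun hp ⟨x, hx⟩
    simpa using congrArg Subtype.val this
  have hA0P : A₀ * P = 0 := by
    apply Matrix.toLin'.injective
    refine LinearMap.ext fun x => ?_
    simp [(hK _).1 (hPK _)]
  have hPA0 : Pᵀ * A₀ = 0 := by
    rw [← h₀, ← Matrix.transpose_mul, hA0P, Matrix.transpose_zero]
  -- the columns of `r⁻¹ A P` converge
  have hAP : Tendsto (fun i => (r i)⁻¹ • (A i * P)) l (𝓝 (B * P)) := by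
    refine tendsto_pi_nhds.2 fun a => tendsto_pi_nhds.2 fun b => ?_
    have := (tendsto_pi_nhds.1 (hlim (P *ᵥ Pi.single b 1) (hPK _))) a
    simp only [Matrix.mulVec_single_one] at this
    exact this
  have hsqrt : Tendsto (fun i => √(r i)) l (𝓝 0) := by
    have := (Real.continuous_sqrt.tendsto 0).comp hr0
    simpa [Function.comp_def] using this
  have hAP' : Tendsto (fun i => (√(r i))⁻¹ • (A i * P)) l (𝓝 0) := by
    have h1 := hsqrt.smul hAP
    rw [zero_smul] at h1
    refine h1.congr' ?_
    filter_upwards [hr] with i hi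
    rw [smul_smul]
    congr 1
    have := Real.sqrt_pos.2 hi
    have h2 := Real.sq_sqrt hi.le
    nth_rewrite 2 [← h2]
    field_simp
  have hPA' : Tendsto (fun i => (√(r i))⁻¹ • (Pᵀ * A i)) l (𝓝 0) := by
    have h1 : Tendsto (fun i => ((√(r i))⁻¹ • (A i * P))ᵀ) l (𝓝 0) := by
      have := (continuous_id.matrix_transpose).continuousAt.tendsto.comp hAP'
      simpa [Function.comp_def] using this
    refine h1.congr' ?_
    filter_upwards [hsymm] with i hi
    rw [Matrix.transpose_smul, Matrix.transpose_mul, hi]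
  let D : ι → Matrix n n ℝ := fun i => (1 - P) + (√(r i))⁻¹ • P
  have hlimQ : Tendsto (fun i => (D i)ᵀ * A i * D i) l (𝓝 (A₀ + Pᵀ * B * P)) := by
    have h1 : Tendsto (fun i => (1 - P)ᵀ * A i * (1 - P)
        + (1 - P)ᵀ * ((√(r i))⁻¹ • (A i * P)) + ((√(r i))⁻¹ • (Pᵀ * A i)) * (1 - P)
        + Pᵀ * ((r i)⁻¹ • (A i * P))) l
        (𝓝 ((1 - P)ᵀ * A₀ * (1 - P) + (1 - P)ᵀ * 0 + 0 * (1 - P) + Pᵀ * (B * P))) := by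
      refine Tendsto.add (Tendsto.add (Tendsto.add ?_ ?_) ?_) ?_
      · exact (tendsto_const_nhds.mul hA).mul tendsto_const_nhds
      · exact tendsto_const_nhds.mul hAP'
      · exact hPA'.mul tendsto_const_nhds
      · exact tendsto_const_nhds.mul hAP
    have h2 : (1 - P)ᵀ * A₀ * (1 - P) + (1 - P)ᵀ * 0 + 0 * (1 - P) + Pᵀ * (B * P)
        = A₀ + Pᵀ * B * P := by
      rw [Matrix.transpose_sub, Matrix.transpose_one, sub_mul, hPA0, one_mul, sub_zero, mul_sub,
        hA0P, mul_one, sub_zero, mul_zero, zero_mul, add_zero, add_zero, mul_assoc]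
    rw [h2] at h1
    refine h1.congr' ?_
    filter_upwards [hr] with i hi
    have hs : (r i)⁻¹ = (√(r i))⁻¹ * (√(r i))⁻¹ := by
      rw [← mul_inv, Real.mul_self_sqrt hi.le]
    simp only [D, hs, Matrix.transpose_add, Matrix.transpose_smul]
    simp only [add_mul, mul_add, smul_mul_assoc, mul_smul_comm, smul_smul, smul_add, mul_assoc]
    abel
  have hmain := eventually_sigPos_le hlimQ
  obtain ⟨L₁, hpos⟩ := exists_linearMap_sigPos (quadForm A₀)
  obtain ⟨L₂, hpos'⟩ := exists_linearMap_sigPos g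
  have hQ : sigPos (quadForm A₀) + sigPos g ≤ sigPos (quadForm (A₀ + Pᵀ * B * P)) := by
    let L : ((Fin (sigPos (quadForm A₀)) → ℝ) × (Fin (sigPos g) → ℝ)) →ₗ[ℝ] (n → ℝ) :=
      (Matrix.toLin' (1 - P) ∘ₗ L₁).coprod (K.subtype ∘ₗ L₂)
    have hL : ∀ x, quadForm (A₀ + Pᵀ * B * P) (L x) = quadForm A₀ (L₁ x.1) + g (L₂ x.2) := by
      rintro ⟨x, y⟩
      set v := L₁ x with hv
      set k := L₂ y with hk
      have e0 : L (x, y) = (v - P *ᵥ v) + k := by simp [L, hv, hk]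
      have e1 : P *ᵥ L (x, y) = k := by
        rw [e0, Matrix.mulVec_add, Matrix.mulVec_sub, hPid _ (hPK _), sub_self, zero_add,
          hPid _ k.2]
      have e2 : A₀ *ᵥ L (x, y) = A₀ *ᵥ v := by
        rw [e0, Matrix.mulVec_add, Matrix.mulVec_sub, (hK _).1 (hPK _), (hK _).1 k.2, sub_zero,
          add_zero]
      have e3 : L (x, y) ⬝ᵥ A₀ *ᵥ v = v ⬝ᵥ A₀ *ᵥ v := by
        rw [Matrix.dotProduct_mulVec, ← Matrix.mulVec_transpose, h₀, e2,
          Matrix.dotProduct_mulVec v, ← Matrix.mulVec_transpose, h₀]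
      rw [quadForm_apply, quadForm_apply, hg, Matrix.add_mulVec, dotProduct_add, e2, e3,
        ← Matrix.mulVec_mulVec, e1, ← Matrix.mulVec_mulVec, Matrix.dotProduct_mulVec (L (x, y)),
        Matrix.vecMul_transpose, e1]
    refine le_trans (le_of_eq ?_) (finrank_le_sigPos _ L ?_)
    · simp
    rintro ⟨v, k⟩ hne
    rw [hL]
    simp only
    have h1 : v ≠ 0 ∨ k ≠ 0 := by
      by_contra! hc; exact hne (by rw [hc.1, hc.2]; rfl)
    have h2 : 0 ≤ quadForm A₀ (L₁ v) := by
      by_cases hv : v = 0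
      · simp [hv]
      · exact (hpos v hv).le
    have h3 : 0 ≤ g (L₂ k) := by
      by_cases hv : k = 0
      · simp [hv]
      · exact (hpos' k hv).le
    rcases h1 with h | h
    · exact add_pos_of_pos_of_nonneg (hpos v h) h3
    · exact add_pos_of_nonneg_of_pos h2 (hpos' k h)
  filter_upwards [hmain] with i hi
  refine (hQ.trans hi).trans (sigPos_le_of_comp (Matrix.toLin' (D i)) fun x => ?_)
  rw [quadForm_apply, quadForm_apply, Matrix.toLin'_apply, ← Matrix.mulVec_mulVec,
    ← Matrix.mulVec_mulVec, Matrix.dotProduct_mulVec x, Matrix.vecMul_transpose]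

/-- **Signature jump.** If `A i → A₀` and `A i ≈ r B` on `ker A₀`, where the form of `B` on `ker A₀`
is nondegenerate, then `A i` is eventually nondegenerate and its signature is that of `A₀` plus that
of the form of `B` on `ker A₀`. -/
lemma eventually_sgn_eq_add {A : ι → Matrix n n ℝ} {A₀ B : Matrix n n ℝ} {r : ι → ℝ}
    (hA : Tendsto A l (𝓝 A₀)) (hsymm : ∀ᶠ i in l, (A i)ᵀ = A i) (h₀ : A₀ᵀ = A₀)
    (hr : ∀ᶠ i in l, 0 < r i) (hr0 : Tendsto r l (𝓝 0)) {K : Submodule ℝ (n → ℝ)}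
    (hK : ∀ x, x ∈ K ↔ A₀ *ᵥ x = 0)
    (hlim : ∀ x ∈ K, Tendsto (fun i => (r i)⁻¹ • (A i *ᵥ x)) l (𝓝 (B *ᵥ x)))
    (g : QuadraticForm ℝ K) (hg : ∀ x : K, g x = (x : n → ℝ) ⬝ᵥ B *ᵥ x)
    (hnd : sigPos g + sigNeg g = Module.finrank ℝ K) :
    ∀ᶠ i in l, sgn (A i) = sgn A₀ + ((sigPos g : ℤ) - (sigNeg g : ℤ)) ∧ nullity (A i) = 0 := by
  have h1 := eventually_sigPos_add_le hA hsymm h₀ hr hr0 hK hlim g hg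
  have h2 := eventually_sigPos_add_le (A := fun i => -(A i)) (A₀ := -A₀) (B := -B) (r := r)
    hA.neg (hsymm.mono fun i hi => by rw [Matrix.transpose_neg, hi])
    (by rw [Matrix.transpose_neg, h₀]) hr hr0 (K := K) (by simpa [Matrix.neg_mulVec] using hK)
    (fun x hx => by simpa [Matrix.neg_mulVec] using (hlim x hx).neg) (-g)
    (fun x => by simp [Matrix.neg_mulVec, hg])
  have hKeq : K = LinearMap.ker (Matrix.toLin' A₀) := by
    ext x; rw [hK]; simp
  have h3 := sigPos_add_sigNeg_add_nullity h₀
  have h4 : nullity A₀ = Module.finrank ℝ K := by rw [hKeq]; rfl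
  filter_upwards [h1, h2, hsymm] with i h1 h2 h5
  have h6 := sigPos_add_sigNeg_add_nullity h5
  rw [quadForm_neg, quadForm_neg, sigPos_neg, sigPos_neg, sigPos_neg] at h2
  unfold sgn
  omega

end MatrixSignature

/-! ### Cayley charts on the symplectic group -/

namespace MaslovChart

open Filter Topology MatrixSignature

variable {n : Type*} [Fintype n] [DecidableEq n]

/-- `Ω` is the matrix of a linear symplectic form that is compatible with the standard inner
product. -/
structure IsCompatible (Ω : Matrix n n ℝ) : Prop where
  transpose : Ωᵀ = -Ω
  sq : Ω * Ω = -1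

/-- `Φ` preserves the bilinear form with matrix `Ω`. -/
def IsSymp (Ω Φ : Matrix n n ℝ) : Prop := Φᵀ * Ω * Φ = Ω

/-- The rotations `exp (-τ Ω)`. They move every symplectic matrix in a positive direction. -/
def rot (Ω : Matrix n n ℝ) (τ : ℝ) : Matrix n n ℝ := Real.cos τ • (1 : Matrix n n ℝ) - Real.sin τ • Ω

variable {Ω : Matrix n n ℝ}

lemma IsSymp.mul {Φ Ψ : Matrix n n ℝ} (h : IsSymp Ω Φ) (h' : IsSymp Ω Ψ) : IsSymp Ω (Φ * Ψ) := by
  unfold IsSymp at *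
  calc (Φ * Ψ)ᵀ * Ω * (Φ * Ψ) = Ψᵀ * (Φᵀ * Ω * Φ) * Ψ := by
        rw [Matrix.transpose_mul]; simp only [mul_assoc]
    _ = Ω := by rw [h, h']

lemma isSymp_one : IsSymp Ω (1 : Matrix n n ℝ) := by simp [IsSymp]

lemma IsSymp.left_inv (hΩ : IsCompatible Ω) {Φ : Matrix n n ℝ} (h : IsSymp Ω Φ) :
    -(Ω * Φᵀ * Ω) * Φ = 1 := by
  unfold IsSymp at h
  have h1 : Ω * (Φᵀ * Ω * Φ) = -1 := by rw [h, hΩ.sq]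
  calc -(Ω * Φᵀ * Ω) * Φ = -(Ω * (Φᵀ * Ω * Φ)) := by simp only [neg_mul, mul_assoc]
    _ = 1 := by rw [h1, neg_neg]

lemma IsSymp.isUnit (hΩ : IsCompatible Ω) {Φ : Matrix n n ℝ} (h : IsSymp Ω Φ) : IsUnit Φ.det :=
  Matrix.isUnit_det_of_left_inverse (h.left_inv hΩ)

lemma IsSymp.inv (hΩ : IsCompatible Ω) {Φ : Matrix n n ℝ} (h : IsSymp Ω Φ) : IsSymp Ω Φ⁻¹ := by
  have hu := h.isUnit hΩ
  unfold IsSymp at *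
  nth_rewrite 1 [← h]
  rw [Matrix.transpose_nonsing_inv]
  have h1 : (Φᵀ)⁻¹ * Φᵀ = 1 := Matrix.nonsing_inv_mul _ (by rwa [Matrix.det_transpose])
  calc (Φᵀ)⁻¹ * (Φᵀ * Ω * Φ) * Φ⁻¹ = ((Φᵀ)⁻¹ * Φᵀ) * Ω * (Φ * Φ⁻¹) := by simp only [mul_assoc]
    _ = Ω := by rw [h1, Matrix.mul_nonsing_inv _ hu, one_mul, mul_one]

lemma IsSymp.dotProduct {Φ : Matrix n n ℝ} (h : IsSymp Ω Φ) (x y : n → ℝ) :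
    (Φ *ᵥ x) ⬝ᵥ Ω *ᵥ (Φ *ᵥ y) = x ⬝ᵥ Ω *ᵥ y := by
  unfold IsSymp at h
  conv_rhs => rw [← h]
  rw [← Matrix.mulVec_mulVec, ← Matrix.mulVec_mulVec, Matrix.dotProduct_mulVec x,
    Matrix.vecMul_transpose]

lemma IsCompatible.isUnit (hΩ : IsCompatible Ω) : IsUnit Ω.det :=
  Matrix.isUnit_det_of_left_inverse (B := -Ω) (by rw [neg_mul, hΩ.sq, neg_neg])

lemma IsCompatible.mulVec_mulVec (hΩ : IsCompatible Ω) (x : n → ℝ) : Ω *ᵥ (Ω *ᵥ x) = -x := by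
  rw [Matrix.mulVec_mulVec, hΩ.sq, Matrix.neg_mulVec, Matrix.one_mulVec]

section Rot

variable (Ω) in
lemma rot_zero : rot Ω 0 = 1 := by simp [rot]

lemma rot_add (hΩ : IsCompatible Ω) (s t : ℝ) : rot Ω (s + t) = rot Ω s * rot Ω t := by
  have := hΩ.sq
  simp only [rot, Real.cos_add, Real.sin_add, sub_mul, mul_sub, smul_mul_assoc, mul_smul_comm,
    one_mul, mul_one, this]
  module

lemma rot_transpose (hΩ : IsCompatible Ω) (s : ℝ) : (rot Ω s)ᵀ = rot Ω (-s) := by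
  simp [rot, hΩ.transpose]

lemma rot_comm (s : ℝ) : rot Ω s * Ω = Ω * rot Ω s := by
  simp [rot, sub_mul, mul_sub]

lemma isSymp_rot (hΩ : IsCompatible Ω) (s : ℝ) : IsSymp Ω (rot Ω s) := by
  unfold IsSymp
  rw [rot_transpose hΩ, mul_assoc, ← rot_comm, ← mul_assoc, ← rot_add hΩ]
  simp [rot_zero]

lemma rot_neg_mul (hΩ : IsCompatible Ω) (s : ℝ) : rot Ω (-s) * rot Ω s = 1 := by
  rw [← rot_add hΩ, neg_add_cancel, rot_zero]

lemma det_rot_sub_one (hΩ : IsCompatible Ω) {s : ℝ} (hs : 0 < s) (hs' : s < 2 * Real.pi) :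
    (rot Ω s - 1).det ≠ 0 := by
  have h1 : (rot Ω (-s) - 1) * (rot Ω s - 1) = (2 - 2 * Real.cos s) • (1 : Matrix n n ℝ) := by
    rw [sub_mul, mul_sub, mul_sub, rot_neg_mul hΩ]
    simp only [rot, Real.cos_neg, Real.sin_neg, one_mul, mul_one]
    module
  have hc : Real.cos s ≠ 1 := by
    intro h
    rw [Real.cos_eq_one_iff_of_lt_of_lt (by linarith) hs'] at h
    exact hs.ne' h
  have h2 : (2 - 2 * Real.cos s) ≠ 0 := by
    intro h; apply hc; linarith
  refine (Matrix.isUnit_det_of_left_inverse (B := (2 - 2 * Real.cos s)⁻¹ • (rot Ω (-s) - 1)) ?_).ne_zero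
  rw [smul_mul_assoc, h1, smul_smul, inv_mul_cancel₀ h2, one_smul]

variable (Ω) in
lemma continuous_rot : Continuous (rot Ω) := by
  unfold rot; fun_prop

variable (Ω) in
lemma contDiff_rot_apply (i j : n) : ContDiff ℝ ∞ fun s => rot Ω s i j := by
  simp only [rot, Matrix.sub_apply, Matrix.smul_apply, smul_eq_mul]
  exact (Real.contDiff_cos.mul contDiff_const).sub (Real.contDiff_sin.mul contDiff_const)

lemma hasDerivAt_rot_apply (hΩ : IsCompatible Ω) (s : ℝ) (i j : n) :
    HasDerivAt (fun s => rot Ω s i j) ((-Ω * rot Ω s) i j) s := by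
  have h1 : -Ω * rot Ω s = (-Real.sin s) • (1 : Matrix n n ℝ) - Real.cos s • Ω := by
    simp only [rot, mul_sub, mul_smul_comm, mul_one, neg_mul, hΩ.sq]
    module
  rw [h1]
  simp only [rot, Matrix.sub_apply, Matrix.smul_apply, smul_eq_mul]
  exact ((Real.hasDerivAt_cos s).mul_const _).sub ((Real.hasDerivAt_sin s).mul_const _)

/-- Small rotations avoid the eigenvectors of a symplectic matrix: if `Φ v = v` and
`Φ w = rot τ w`, then `vᵀ w = tan (τ / 2) vᵀ Ω w`, which is impossible for `w` near `v` and small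
`τ`. -/
lemma eventually_det_sub_rot_ne_zero (hΩ : IsCompatible Ω) {Φ : Matrix n n ℝ} (hΦ : IsSymp Ω Φ) :
    ∀ᶠ τ in 𝓝[>] (0 : ℝ), (Φ - rot Ω τ).det ≠ 0 := by
  have h1 : ∀ᶠ τ in 𝓝 (0 : ℝ), ∀ w ∈ Metric.sphere (0 : n → ℝ) 1,
      0 < τ → Φ *ᵥ w ≠ rot Ω τ *ᵥ w := by
    apply (isCompact_sphere _ _).eventually_forall_of_forall_eventually
    intro v hv
    have hv0 : v ≠ 0 := by rintro rfl; simp at hv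
    by_cases hfix : Φ *ᵥ v = v
    · have hpos : 0 < v ⬝ᵥ v := by
        have := dotProduct_self_eq_zero.not.2 hv0
        exact lt_of_le_of_ne (Finset.sum_nonneg fun i _ => mul_self_nonneg _) (Ne.symm this)
      let F : ℝ × (n → ℝ) → ℝ := fun p =>
        Real.cos (p.1 / 2) * (v ⬝ᵥ p.2) - Real.sin (p.1 / 2) * (v ⬝ᵥ Ω *ᵥ p.2)
      have hF : Continuous F := by
        simp only [F, dotProduct, Matrix.mulVec]
        fun_prop
      have hF0 : 0 < F (0, v) := by simpa [F] using hpos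
      have e1 : ∀ᶠ p in 𝓝 ((0 : ℝ), v), 0 < F p :=
        (hF.tendsto (0, v)).eventually (lt_mem_nhds hF0)
      have e2 : ∀ᶠ p in 𝓝 ((0 : ℝ), v), p.1 < 1 :=
        (continuous_fst.tendsto ((0 : ℝ), v)).eventually (gt_mem_nhds one_pos)
      filter_upwards [e1, e2] with p hp1 hp2 hp0 heq
      obtain ⟨τ, w⟩ := p
      have h3 := hΦ.dotProduct v w
      rw [hfix, heq] at h3
      have h4 : v ⬝ᵥ Ω *ᵥ (rot Ω τ *ᵥ w)
          = Real.cos τ * (v ⬝ᵥ Ω *ᵥ w) + Real.sin τ * (v ⬝ᵥ w) := by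
        rw [Matrix.mulVec_mulVec, rot, mul_sub, mul_smul_comm, mul_smul_comm, hΩ.sq, mul_one,
          Matrix.sub_mulVec, dotProduct_sub, Matrix.smul_mulVec, Matrix.smul_mulVec,
          Matrix.neg_mulVec, Matrix.one_mulVec]
        simp
      rw [h4] at h3
      have hs : 0 < Real.sin (τ / 2) :=
        Real.sin_pos_of_pos_of_lt_pi (by simp only at hp0; linarith)
          (by simp only at hp2; linarith [Real.pi_gt_three])
      have hc1 : Real.cos τ = 1 - 2 * Real.sin (τ / 2) ^ 2 := by
        have := Real.cos_two_mul (τ / 2)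
        have h5 := Real.sin_sq_add_cos_sq (τ / 2)
        rw [show 2 * (τ / 2) = τ by ring] at this
        linarith
      have hs1 : Real.sin τ = 2 * Real.sin (τ / 2) * Real.cos (τ / 2) := by
        rw [← Real.sin_two_mul]; congr 1; ring
      rw [hc1, hs1] at h3
      have : 2 * Real.sin (τ / 2) * F (τ, w) = 0 := by
        simp only [F]; linear_combination h3
      have h7 : 0 < 2 * Real.sin (τ / 2) * F (τ, w) := by positivity
      exact h7.ne' this
    · have hcont : Continuous fun p : ℝ × (n → ℝ) => Φ *ᵥ p.2 - rot Ω p.1 *ᵥ p.2 := by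
        have := continuous_rot Ω
        exact (Continuous.matrix_mulVec continuous_const continuous_snd).sub
          (Continuous.matrix_mulVec (this.comp continuous_fst) continuous_snd)
      have h2 : Φ *ᵥ v - rot Ω 0 *ᵥ v ≠ 0 := by
        rw [rot_zero, Matrix.one_mulVec]; exact sub_ne_zero.2 hfix
      filter_upwards [(hcont.tendsto (0, v)).eventually (isOpen_ne.mem_nhds h2)] with p hp _ heq
      exact hp (by rw [heq, sub_self])
  filter_upwards [h1.filter_mono nhdsWithin_le_nhds, self_mem_nhdsWithin] with τ hτ hpos hdet
  obtain ⟨w, hw, hw0⟩ := Matrix.exists_mulVec_eq_zero_iff.2 hdet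
  have hn : 0 < ‖w‖ := norm_pos_iff.2 hw
  refine hτ (‖w‖⁻¹ • w) (by simp [norm_smul, hn.ne']) hpos ?_
  rw [Matrix.sub_mulVec, sub_eq_zero] at hw0
  rw [Matrix.mulVec_smul, Matrix.mulVec_smul, hw0]

lemma eventually_det_rot_mul_sub_one_ne_zero (hΩ : IsCompatible Ω) {Φ : Matrix n n ℝ}
    (hΦ : IsSymp Ω Φ) : ∀ᶠ τ in 𝓝[>] (0 : ℝ), (rot Ω τ * Φ - 1).det ≠ 0 := by
  filter_upwards [eventually_det_sub_rot_ne_zero hΩ (hΦ.inv hΩ)] with τ hτ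
  have hu := hΦ.isUnit hΩ
  have : rot Ω τ * Φ - 1 = -(Φ⁻¹ - rot Ω τ) * Φ := by
    rw [neg_sub, sub_mul, Matrix.nonsing_inv_mul _ hu]
  rw [this, Matrix.det_mul, Matrix.det_neg]
  exact mul_ne_zero (mul_ne_zero (by simp) hτ) hu.ne_zero

end Rot

/-- The graph of a symplectic matrix `Φ` is a Lagrangian subspace. If it is transverse to the graph
of `R`, it is the graph of a linear map from the diagonal to the graph of `R`, and hence it is given
by this symmetric matrix. -/
def chartForm (Ω R Φ : Matrix n n ℝ) : Matrix n n ℝ := Ω * (R - 1) * (Φ - R)⁻¹ * (1 - Φ)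

/-- `R` is the centre of a chart: its graph is transverse to the diagonal. -/
structure IsCenter (Ω R : Matrix n n ℝ) : Prop where
  symp : IsSymp Ω R
  det_ne_zero : (R - 1).det ≠ 0

variable {R Φ : Matrix n n ℝ}

lemma chartForm_transpose (hΩ : IsCompatible Ω) (hR : IsSymp Ω R) (hΦ : IsSymp Ω Φ)
    (hdet : (Φ - R).det ≠ 0) : (chartForm Ω R Φ)ᵀ = chartForm Ω R Φ := by
  have hu : IsUnit (Φ - R).det := isUnit_iff_ne_zero.2 hdet
  set Y := (Φ - R)⁻¹ * (1 - Φ) with hY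
  have hXY : (Φ - R) * Y = 1 - Φ := by
    rw [hY, ← mul_assoc, Matrix.mul_nonsing_inv _ hu, one_mul]
  have h1 : Φ * (1 + Y) = 1 + R * Y := by
    have : Φ * (1 + Y) = Φ + (Φ - R) * Y + R * Y := by noncomm_ring
    rw [this, hXY]; abel
  have h2 : (1 + R * Y)ᵀ * Ω * (1 + R * Y) = (1 + Y)ᵀ * Ω * (1 + Y) := by
    rw [← h1, Matrix.transpose_mul]
    calc (1 + Y)ᵀ * Φᵀ * Ω * (Φ * (1 + Y)) = (1 + Y)ᵀ * (Φᵀ * Ω * Φ) * (1 + Y) := by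
          simp only [mul_assoc]
      _ = _ := by rw [hΦ]
  have h3 : Yᵀ * Rᵀ * Ω * (R * Y) = Yᵀ * Ω * Y := by
    calc Yᵀ * Rᵀ * Ω * (R * Y) = Yᵀ * (Rᵀ * Ω * R) * Y := by simp only [mul_assoc]
      _ = _ := by rw [hR]
  have h4 : chartForm Ω R Φ = Ω * (R - 1) * Y := by
    simp only [chartForm, hY, mul_assoc]
  clear_value Y
  rw [h4, Matrix.transpose_mul, Matrix.transpose_mul, hΩ.transpose, Matrix.transpose_sub,
    Matrix.transpose_one]
  rw [Matrix.transpose_add, Matrix.transpose_add, Matrix.transpose_mul, Matrix.transpose_one] at h2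
  have h5 : (1 + Yᵀ * Rᵀ) * Ω * (1 + R * Y)
      = Ω + Ω * (R * Y) + Yᵀ * Rᵀ * Ω + Yᵀ * Rᵀ * Ω * (R * Y) := by noncomm_ring
  have h6 : (1 + Yᵀ) * Ω * (1 + Y) = Ω + Ω * Y + Yᵀ * Ω + Yᵀ * Ω * Y := by noncomm_ring
  rw [h5, h6, h3, add_left_inj] at h2
  have h7 : Yᵀ * ((Rᵀ - 1) * -Ω) = -(Yᵀ * Rᵀ * Ω) + Yᵀ * Ω := by noncomm_ring
  have h8 : Ω * (R - 1) * Y = Ω * (R * Y) - Ω * Y := by noncomm_ring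
  rw [h7, h8]
  have h9 : Ω * (R * Y) + Yᵀ * Rᵀ * Ω = Ω * Y + Yᵀ * Ω := by
    rw [add_assoc Ω, add_assoc Ω] at h2
    exact add_left_cancel h2
  rw [← sub_eq_zero] at h9 ⊢
  rw [← neg_eq_zero, ← h9]
  abel

lemma chartForm_mulVec_eq_zero (hΩ : IsCompatible Ω) (hR : IsCenter Ω R)
    (hdet : (Φ - R).det ≠ 0) (x : n → ℝ) : chartForm Ω R Φ *ᵥ x = 0 ↔ (Φ - 1) *ᵥ x = 0 := by
  have h1 : (Ω * (R - 1) * (Φ - R)⁻¹).det ≠ 0 := by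
    rw [Matrix.det_mul, Matrix.det_mul]
    refine mul_ne_zero (mul_ne_zero hΩ.isUnit.ne_zero hR.det_ne_zero) ?_
    rw [Matrix.det_nonsing_inv]
    simpa using hdet
  have h2 := Matrix.mulVec_injective_of_isUnit ((Matrix.isUnit_iff_isUnit_det _).2
    (isUnit_iff_ne_zero.2 h1))
  rw [chartForm, ← Matrix.mulVec_mulVec]
  constructor
  · intro h
    have h3 := h2 (h.trans (Matrix.mulVec_zero _).symm)
    rw [← neg_sub 1 Φ, Matrix.neg_mulVec, h3, neg_zero]
  · intro h
    rw [← neg_sub Φ 1, Matrix.neg_mulVec, h, neg_zero, Matrix.mulVec_zero]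

lemma nullity_chartForm (hΩ : IsCompatible Ω) (hR : IsCenter Ω R) (hdet : (Φ - R).det ≠ 0) :
    nullity (chartForm Ω R Φ) = nullity (Φ - 1) := by
  have : LinearMap.ker (Matrix.toLin' (chartForm Ω R Φ)) = LinearMap.ker (Matrix.toLin' (Φ - 1)) := by
    ext x
    simp only [LinearMap.mem_ker, Matrix.toLin'_apply]
    exact chartForm_mulVec_eq_zero hΩ hR hdet x
  unfold nullity
  rw [this]

lemma nullity_eq_zero_iff {A : Matrix n n ℝ} : nullity A = 0 ↔ A.det ≠ 0 := by
  rw [nullity, Submodule.finrank_eq_zero, ne_eq, ← Matrix.exists_mulVec_eq_zero_iff,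
    Submodule.eq_bot_iff]
  simp only [LinearMap.mem_ker, Matrix.toLin'_apply]
  constructor
  · rintro h ⟨v, hv, h0⟩; exact hv (h v h0)
  · intro h x hx
    by_contra hne
    exact h ⟨x, hne, hx⟩

variable {ι : Type*} {l : Filter ι}

lemma tendsto_matrix_inv {A : ι → Matrix n n ℝ} {A₀ : Matrix n n ℝ} (hA : Tendsto A l (𝓝 A₀))
    (h : A₀.det ≠ 0) : Tendsto (fun i => (A i)⁻¹) l (𝓝 A₀⁻¹) := by
  have h1 : ContinuousAt Ring.inverse A₀.det := by
    have : Ring.inverse = fun x : ℝ => x⁻¹ := by ext x; exact Ring.inverse_eq_inv x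
    rw [this]; exact continuousAt_inv₀ h
  simp only [Matrix.inv_def]
  have h2 : Tendsto (fun i => (A i).det) l (𝓝 A₀.det) :=
    (continuous_id.matrix_det.tendsto A₀).comp hA
  have h3 : Tendsto (fun i => (A i).adjugate) l (𝓝 A₀.adjugate) :=
    (continuous_id.matrix_adjugate.tendsto A₀).comp hA
  exact (h1.tendsto.comp h2).smul h3

lemma tendsto_chartForm {A : ι → Matrix n n ℝ} (hA : Tendsto A l (𝓝 Φ))
    (hdet : (Φ - R).det ≠ 0) : Tendsto (fun i => chartForm Ω R (A i)) l (𝓝 (chartForm Ω R Φ)) := by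
  unfold chartForm
  exact (tendsto_const_nhds.mul (tendsto_matrix_inv (hA.sub_const R) hdet)).mul
    (hA.const_sub 1)

lemma eventually_det_sub_ne_zero {A : ι → Matrix n n ℝ} (hA : Tendsto A l (𝓝 Φ))
    (hdet : (Φ - R).det ≠ 0) : ∀ᶠ i in l, (A i - R).det ≠ 0 := by
  have h2 : Tendsto (fun i => (A i - R).det) l (𝓝 (Φ - R).det) :=
    (continuous_id.matrix_det.tendsto _).comp (hA.sub_const R)
  exact h2.eventually (isOpen_ne.mem_nhds hdet)

/-- Every symplectic matrix lies in the domain of some chart. -/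
lemma exists_isCenter (hΩ : IsCompatible Ω) (hΦ : IsSymp Ω Φ) :
    ∃ R, IsCenter Ω R ∧ (Φ - R).det ≠ 0 := by
  obtain ⟨τ, h1, h2⟩ := ((eventually_det_sub_rot_ne_zero hΩ hΦ).and
    (Ioo_mem_nhdsGT Real.pi_pos)).exists
  exact ⟨rot Ω τ, ⟨isSymp_rot hΩ τ, det_rot_sub_one hΩ h2.1 (by linarith [h2.2, Real.pi_pos])⟩, h1⟩

/-- In a chart the signature is locally constant where the nullity of `Φ - 1` is. -/
lemma eventually_sgn_chartForm_eq (hΩ : IsCompatible Ω) (hR : IsCenter Ω R) (hΦ : IsSymp Ω Φ)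
    (hdet : (Φ - R).det ≠ 0) {A : ι → Matrix n n ℝ} (hA : Tendsto A l (𝓝 Φ))
    (hsymp : ∀ᶠ i in l, IsSymp Ω (A i)) (hnull : ∀ᶠ i in l, nullity (A i - 1) = nullity (Φ - 1)) :
    ∀ᶠ i in l, sgn (chartForm Ω R (A i)) = sgn (chartForm Ω R Φ) := by
  have hd := eventually_det_sub_ne_zero hA hdet
  apply eventually_sgn_eq (tendsto_chartForm hA hdet)
  · filter_upwards [hd, hsymp] with i h1 h2 using chartForm_transpose hΩ hR.symp h2 h1
  · exact chartForm_transpose hΩ hR.symp hΦ hdet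
  · filter_upwards [hd, hnull] with i h1 h2
    rw [nullity_chartForm hΩ hR h1, nullity_chartForm hΩ hR hdet, h2]

lemma eventually_sgn_chartForm_eq_of_det_ne_zero (hΩ : IsCompatible Ω) (hR : IsCenter Ω R)
    (hΦ : IsSymp Ω Φ) (hdet : (Φ - R).det ≠ 0) (h1 : (Φ - 1).det ≠ 0) {A : ι → Matrix n n ℝ}
    (hA : Tendsto A l (𝓝 Φ)) (hsymp : ∀ᶠ i in l, IsSymp Ω (A i)) :
    ∀ᶠ i in l, sgn (chartForm Ω R (A i)) = sgn (chartForm Ω R Φ) := by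
  apply eventually_sgn_chartForm_eq hΩ hR hΦ hdet hA hsymp
  filter_upwards [eventually_det_sub_ne_zero hA h1] with i hi
  rw [nullity_eq_zero_iff.2 hi, nullity_eq_zero_iff.2 h1]

/-- On `ker (Φ - 1)` the matrix of the form in a chart varies to first order by `Ω D`, where `D` is
the derivative of the path. -/
lemma dotProduct_chart_deriv (hΦ : IsSymp Ω Φ)
    (hdet : (Φ - R).det ≠ 0) {x : n → ℝ} (hx : (Φ - 1) *ᵥ x = 0) (D : Matrix n n ℝ) (y : n → ℝ) :
    x ⬝ᵥ (-(Ω * (R - 1) * (Φ - R)⁻¹ * D)) *ᵥ y = x ⬝ᵥ (Ω * D) *ᵥ y := by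
  have hu : IsUnit (Φ - R).det := isUnit_iff_ne_zero.2 hdet
  have hx' : Φ *ᵥ x = x := by
    rwa [Matrix.sub_mulVec, Matrix.one_mulVec, sub_eq_zero] at hx
  have h1 : x ᵥ* (Ω * Φ) = x ᵥ* Ω := by
    have h2 : (Φ *ᵥ x) ᵥ* (Ω * Φ) = x ᵥ* Ω := by
      rw [← Matrix.vecMul_transpose, Matrix.vecMul_vecMul, ← mul_assoc, hΦ]
    rwa [hx'] at h2
  have h3 : x ᵥ* (Ω * (R - 1)) = x ᵥ* (-Ω * (Φ - R)) := by
    rw [mul_sub, neg_mul, mul_sub, neg_sub, Matrix.vecMul_sub, Matrix.vecMul_sub, h1, mul_one]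
  have h4 : x ᵥ* (Ω * (R - 1) * (Φ - R)⁻¹) = x ᵥ* (-Ω) := by
    rw [← Matrix.vecMul_vecMul, h3, Matrix.vecMul_vecMul, mul_assoc,
      Matrix.mul_nonsing_inv _ hu, mul_one]
  rw [Matrix.neg_mulVec, dotProduct_neg, Matrix.dotProduct_mulVec, ← Matrix.vecMul_vecMul, h4,
    Matrix.dotProduct_mulVec, ← Matrix.vecMul_vecMul, Matrix.vecMul_neg, Matrix.neg_vecMul,
    neg_dotProduct, neg_neg]

lemma tendsto_chartForm_div {A : ι → Matrix n n ℝ} {r : ι → ℝ} {D : Matrix n n ℝ}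
    (hA : Tendsto A l (𝓝 Φ)) (hdet : (Φ - R).det ≠ 0)
    (hD : Tendsto (fun i => (r i)⁻¹ • (A i - Φ)) l (𝓝 D)) {x : n → ℝ} (hx : (Φ - 1) *ᵥ x = 0) :
    Tendsto (fun i => (r i)⁻¹ • (chartForm Ω R (A i) *ᵥ x)) l
      (𝓝 ((-(Ω * (R - 1) * (Φ - R)⁻¹ * D)) *ᵥ x)) := by
  have h1 : Tendsto (fun i => -(Ω * (R - 1) * (A i - R)⁻¹ * ((r i)⁻¹ • (A i - Φ)))) l
      (𝓝 (-(Ω * (R - 1) * (Φ - R)⁻¹ * D))) :=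
    ((tendsto_const_nhds.mul (tendsto_matrix_inv (hA.sub_const R) hdet)).mul hD).neg
  have h2 : Continuous fun M : Matrix n n ℝ => M *ᵥ x :=
    Continuous.matrix_mulVec continuous_id continuous_const
  refine ((h2.tendsto _).comp h1).congr fun i => ?_
  simp only [Function.comp_apply]
  have h3 : (1 - A i) *ᵥ x = -((A i - Φ) *ᵥ x) := by
    rw [Matrix.sub_mulVec, Matrix.one_mulVec] at hx
    rw [Matrix.sub_mulVec, Matrix.one_mulVec, Matrix.sub_mulVec, sub_eq_zero.1 hx, neg_sub]
  rw [chartForm, ← Matrix.mulVec_mulVec, h3, Matrix.neg_mulVec, mul_smul_comm, Matrix.smul_mulVec,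
    ← Matrix.mulVec_mulVec, Matrix.mulVec_neg, smul_neg]

/-- The signature in a chart jumps at a nondegenerate crossing. -/
lemma eventually_sgn_chartForm_jump (hΩ : IsCompatible Ω) (hR : IsCenter Ω R) (hΦ : IsSymp Ω Φ)
    (hdet : (Φ - R).det ≠ 0) {A : ι → Matrix n n ℝ} {r : ι → ℝ} {D : Matrix n n ℝ}
    (hA : Tendsto A l (𝓝 Φ)) (hsymp : ∀ᶠ i in l, IsSymp Ω (A i))
    (hr : ∀ᶠ i in l, 0 < r i) (hr0 : Tendsto r l (𝓝 0))
    (hD : Tendsto (fun i => (r i)⁻¹ • (A i - Φ)) l (𝓝 D))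
    (g : QuadraticForm ℝ (LinearMap.ker (Matrix.toLin' (Φ - 1))))
    (hg : ∀ x, g x = (x : n → ℝ) ⬝ᵥ (Ω * D) *ᵥ x)
    (hnd : sigPos g + sigNeg g = nullity (Φ - 1)) :
    ∀ᶠ i in l, sgn (chartForm Ω R (A i)) = sgn (chartForm Ω R Φ) +
      ((sigPos g : ℤ) - (sigNeg g : ℤ)) ∧ (A i - 1).det ≠ 0 := by
  have hd := eventually_det_sub_ne_zero hA hdet
  have h1 := eventually_sgn_eq_add (tendsto_chartForm (Ω := Ω) hA hdet)
    (by filter_upwards [hd, hsymp] with i h1 h2 using chartForm_transpose hΩ hR.symp h2 h1)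
    (chartForm_transpose hΩ hR.symp hΦ hdet) hr hr0
    (K := LinearMap.ker (Matrix.toLin' (Φ - 1)))
    (fun x => by
      rw [LinearMap.mem_ker, Matrix.toLin'_apply, chartForm_mulVec_eq_zero hΩ hR hdet])
    (fun x hx => tendsto_chartForm_div hA hdet hD (by rwa [LinearMap.mem_ker, Matrix.toLin'_apply] at hx)) g
    (fun x => by
      rw [hg, dotProduct_chart_deriv hΦ hdet]
      have := x.2
      rwa [LinearMap.mem_ker, Matrix.toLin'_apply] at this) hnd
  filter_upwards [h1, hd] with i h2 h3
  refine ⟨h2.1, ?_⟩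
  rw [← nullity_eq_zero_iff, ← nullity_chartForm hΩ hR h3, h2.2]

end MaslovChart

/-! ### Lifts of the signature along maps into the symplectic group -/

namespace MaslovChart

open Filter Topology MatrixSignature

/-- Integer functions that are defined up to locally constant functions on an open cover of a simply
connected space can be glued. They are the sections of a covering space with fibre `ℤ`. -/
theorem exists_glue {B ι : Type*} [TopologicalSpace B] [SimplyConnectedSpace B]
    [LocallyPathConnectedSpace B] (U : ι → Set B) (hU : ∀ i, IsOpen (U i)) (hcov : ∀ x, ∃ i, x ∈ U i)
    (s : ι → B → ℤ)
    (hs : ∀ i j x, x ∈ U i → x ∈ U j → ∀ᶠ y in 𝓝 x, s i y - s j y = s i x - s j x) :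
    ∃ f : B → ℤ, ∀ i x, x ∈ U i → ∀ᶠ y in 𝓝 x, f y - s i y = f x - s i x := by
  choose idx hidx using hcov
  let Z : FiberBundleCore ι B ℤ :=
    { baseSet := U
      isOpen_baseSet := hU
      indexAt := idx
      mem_baseSet_at := hidx
      coordChange := fun i j x v => v + (s i x - s j x)
      coordChange_self := by intro i x _ v; simp
      continuousOn_coordChange := by
        rintro i j ⟨x, v⟩ ⟨⟨hi, hj⟩, -⟩
        apply ContinuousAt.continuousWithinAt
        refine ContinuousAt.add continuousAt_snd ?_
        have h1 : ContinuousAt (fun y => s i y - s j y) x :=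
          tendsto_const_nhds.congr' (by filter_upwards [hs i j x hi hj] with y hy using hy.symm)
        exact ContinuousAt.comp (f := Prod.fst) (x := (x, v)) h1 continuousAt_fst
      coordChange_comp := by intro i j k x _ v; ring }
  have cov : IsCoveringMap (Bundle.TotalSpace.proj : Bundle.TotalSpace ℤ Z.Fiber → B) :=
    haveI : DiscreteTopology ℤ := inferInstance
    FiberBundle.isCoveringMap (F := ℤ) (E := Z.Fiber)
  obtain ⟨x₀⟩ : Nonempty B := inferInstance
  obtain ⟨F, ⟨-, hF⟩, -⟩ := cov.existsUnique_continuousMap_lifts (ContinuousMap.id B) x₀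
    (⟨x₀, (0 : ℤ)⟩ : Bundle.TotalSpace ℤ Z.Fiber) rfl
  have hF' : ∀ x, (F x).proj = x := fun x => congrFun hF x
  let v : B → ℤ := fun x => (F x).snd
  refine ⟨fun x => v x + s (idx x) x, fun i x hx => ?_⟩
  have h1 : ContinuousAt (fun y => (Z.localTriv i (F y)).2) x := by
    have h2 : ContinuousAt (Z.localTriv i) (F x) := by
      apply (Z.localTriv i).continuousAt
      rw [Z.mem_localTriv_source, hF']
      exact hx
    exact continuousAt_snd.comp (h2.comp F.continuous.continuousAt)
  have h3 : ∀ y, (Z.localTriv i (F y)).2 = v y + s (idx y) y - s i y := by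
    intro y
    have : (Z.localTriv i (F y)).2 = v y + (s (idx (F y).proj) (F y).proj - s i (F y).proj) := rfl
    rw [this, hF']; ring
  have h4 : ∀ᶠ y in 𝓝 x, (Z.localTriv i (F y)).2 = (Z.localTriv i (F x)).2 :=
    h1.eventually (show ∀ᶠ z in 𝓝 _, z = (Z.localTriv i (F x)).2 by
      rw [nhds_discrete]; exact rfl)
  filter_upwards [h4] with y hy
  rwa [h3, h3] at hy

lemma eq_of_eventually_eq {X : Type*} [TopologicalSpace X] {S : Set X} (hS : IsPreconnected S)
    {f : X → ℤ} (h : ∀ x ∈ S, ∀ᶠ y in 𝓝[S] x, f y = f x) {x y : X} (hx : x ∈ S) (hy : y ∈ S) :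
    f x = f y := by
  refine hS.constant (f := f) (fun z hz => ?_) hx hy
  exact tendsto_const_nhds.congr' (by filter_upwards [h z hz] with w hw using hw.symm)

lemma eventually_nhdsWithin_of_sides {S : Set ℝ} {t₀ : ℝ} {P : ℝ → Prop} (h₀ : P t₀)
    (h₁ : ∀ᶠ t in 𝓝[S ∩ Ioi t₀] t₀, P t) (h₂ : ∀ᶠ t in 𝓝[S ∩ Iio t₀] t₀, P t) :
    ∀ᶠ t in 𝓝[S] t₀, P t := by
  rw [eventually_nhdsWithin_iff] at *
  filter_upwards [h₁, h₂] with t h1 h2 ht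
  rcases lt_trichotomy t t₀ with h | h | h
  · exact h2 ⟨ht, h⟩
  · rwa [h]
  · exact h1 ⟨ht, h⟩

variable {n : Type*} [Fintype n] [DecidableEq n] {Ω R : Matrix n n ℝ}

section Jump

variable {A : ℝ → Matrix n n ℝ} {D : Matrix n n ℝ} {S : Set ℝ} {t₀ : ℝ}

lemma tendsto_of_entries (hA : ∀ i j, HasDerivWithinAt (fun t => A t i j) (D i j) S t₀) :
    Tendsto A (𝓝[S] t₀) (𝓝 (A t₀)) :=
  tendsto_pi_nhds.2 fun i => tendsto_pi_nhds.2 fun j => (hA i j).continuousWithinAt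

lemma tendsto_slope_of_entries (hA : ∀ i j, HasDerivWithinAt (fun t => A t i j) (D i j) S t₀) :
    Tendsto (fun t => (t - t₀)⁻¹ • (A t - A t₀)) (𝓝[S \ {t₀}] t₀) (𝓝 D) :=
  tendsto_pi_nhds.2 fun i => tendsto_pi_nhds.2 fun j => by
    have := hasDerivWithinAt_iff_tendsto_slope.1 (hA i j)
    exact this

lemma eventually_jump_right (hΩ : IsCompatible Ω) (hR : IsCenter Ω R) (ht₀ : t₀ ∈ S)
    (hsymp : ∀ t ∈ S, IsSymp Ω (A t)) (hdet : (A t₀ - R).det ≠ 0)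
    (hA : ∀ i j, HasDerivWithinAt (fun t => A t i j) (D i j) S t₀)
    (g : QuadraticForm ℝ (LinearMap.ker (Matrix.toLin' (A t₀ - 1))))
    (hg : ∀ x, g x = (x : n → ℝ) ⬝ᵥ (Ω * D) *ᵥ x)
    (hnd : sigPos g + sigNeg g = nullity (A t₀ - 1)) :
    ∀ᶠ t in 𝓝[S ∩ Ioi t₀] t₀,
    sgn (chartForm Ω R (A t)) = sgn (chartForm Ω R (A t₀)) + ((sigPos g : ℤ) - (sigNeg g : ℤ)) ∧
      (A t - 1).det ≠ 0 := by
  have hsub : 𝓝[S ∩ Ioi t₀] t₀ ≤ 𝓝[S] t₀ := nhdsWithin_mono _ inter_subset_left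
  have hmem : ∀ᶠ t in 𝓝[S ∩ Ioi t₀] t₀, t ∈ S ∩ Ioi t₀ := self_mem_nhdsWithin
  refine eventually_sgn_chartForm_jump (r := fun t => t - t₀) hΩ hR (hsymp t₀ ht₀) hdet
    ((tendsto_of_entries hA).mono_left hsub) ?_ ?_ ?_ ?_ g hg hnd
  · filter_upwards [hmem] with t ht using hsymp t ht.1
  · filter_upwards [hmem] with t ht using sub_pos.2 ht.2
  · have : Tendsto (fun t : ℝ => t - t₀) (𝓝 t₀) (𝓝 (t₀ - t₀)) := by
      exact (continuous_id.sub continuous_const).tendsto t₀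
    rw [sub_self] at this
    exact this.mono_left nhdsWithin_le_nhds
  · exact (tendsto_slope_of_entries hA).mono_left
      (nhdsWithin_mono _ fun t ht => ⟨ht.1, ne_of_gt ht.2⟩)

lemma eventually_jump_left (hΩ : IsCompatible Ω) (hR : IsCenter Ω R) (ht₀ : t₀ ∈ S)
    (hsymp : ∀ t ∈ S, IsSymp Ω (A t)) (hdet : (A t₀ - R).det ≠ 0)
    (hA : ∀ i j, HasDerivWithinAt (fun t => A t i j) (D i j) S t₀)
    (g : QuadraticForm ℝ (LinearMap.ker (Matrix.toLin' (A t₀ - 1))))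
    (hg : ∀ x, g x = (x : n → ℝ) ⬝ᵥ (Ω * D) *ᵥ x)
    (hnd : sigPos g + sigNeg g = nullity (A t₀ - 1)) :
    ∀ᶠ t in 𝓝[S ∩ Iio t₀] t₀,
    sgn (chartForm Ω R (A t)) = sgn (chartForm Ω R (A t₀)) - ((sigPos g : ℤ) - (sigNeg g : ℤ)) ∧
      (A t - 1).det ≠ 0 := by
  have hsub : 𝓝[S ∩ Iio t₀] t₀ ≤ 𝓝[S] t₀ := nhdsWithin_mono _ inter_subset_left
  have hmem : ∀ᶠ t in 𝓝[S ∩ Iio t₀] t₀, t ∈ S ∩ Iio t₀ := self_mem_nhdsWithin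
  have key := eventually_sgn_chartForm_jump (r := fun t => t₀ - t) (D := -D) hΩ hR (hsymp t₀ ht₀) hdet
    ((tendsto_of_entries hA).mono_left hsub) ?_ ?_ ?_ ?_ (-g)
    (fun x => by simp [hg, Matrix.neg_mulVec])
    (by rw [sigPos_neg, sigNeg_neg, add_comm, hnd])
  · filter_upwards [key] with t ht
    rw [sigPos_neg, sigNeg_neg] at ht
    exact ⟨by rw [ht.1]; ring, ht.2⟩
  · filter_upwards [hmem] with t ht using hsymp t ht.1
  · filter_upwards [hmem] with t ht using sub_pos.2 ht.2
  · have : Tendsto (fun t : ℝ => t₀ - t) (𝓝 t₀) (𝓝 (t₀ - t₀)) := by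
      exact (continuous_const.sub continuous_id).tendsto t₀
    rw [sub_self] at this
    exact this.mono_left nhdsWithin_le_nhds
  · refine ((tendsto_slope_of_entries hA).neg.mono_left
      (nhdsWithin_mono _ fun t ht => ⟨ht.1, ne_of_lt ht.2⟩)).congr fun t => ?_
    rw [← neg_smul, ← inv_neg, neg_sub]

end Jump

lemma sig_of_pos {K : Submodule ℝ (n → ℝ)} (g : QuadraticForm ℝ K) (hpos : ∀ x, x ≠ 0 → 0 < g x) :
    sigPos g = Module.finrank ℝ K ∧ sigNeg g = 0 := by
  have h1 := finrank_le_sigPos g LinearMap.id hpos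
  have h2 := QuadraticForm.sigPos_add_sigNeg_add_radical (Q := g)
  omega

/-- In two charts, the signature changes by the same amount along a path of rotations. -/
lemma sgn_sub_sgn_rot_mul (hΩ : IsCompatible Ω) {R' Φ : Matrix n n ℝ} (hR : IsCenter Ω R)
    (hR' : IsCenter Ω R') (hΦ : IsSymp Ω Φ) {ε : ℝ} (hε : 0 ≤ ε)
    (hd : ∀ s ∈ Icc 0 ε, (rot Ω s * Φ - R).det ≠ 0 ∧ (rot Ω s * Φ - R').det ≠ 0) :
    sgn (chartForm Ω R Φ) - sgn (chartForm Ω R' Φ) =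
      sgn (chartForm Ω R (rot Ω ε * Φ)) - sgn (chartForm Ω R' (rot Ω ε * Φ)) := by
  have key := eq_of_eventually_eq (S := Icc 0 ε) isPreconnected_Icc
    (f := fun s => sgn (chartForm Ω R (rot Ω s * Φ)) - sgn (chartForm Ω R' (rot Ω s * Φ))) ?_
    (left_mem_Icc.2 hε) (right_mem_Icc.2 hε)
  · simpa [rot_zero] using key
  intro s hs
  have hsymp : ∀ t ∈ Icc 0 ε, IsSymp Ω (rot Ω t * Φ) := fun t _ => (isSymp_rot hΩ t).mul hΦ
  have hder : ∀ i j, HasDerivWithinAt (fun t => (rot Ω t * Φ) i j) ((-Ω * rot Ω s * Φ) i j)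
      (Icc 0 ε) s := by
    intro i j
    simp only [Matrix.mul_apply (N := Φ)]
    exact (HasDerivAt.fun_sum fun k _ =>
      (hasDerivAt_rot_apply hΩ s i k).mul_const _).hasDerivWithinAt
  let K := LinearMap.ker (Matrix.toLin' (rot Ω s * Φ - 1))
  let g : QuadraticForm ℝ K := (quadForm 1).restrict K
  have hg0 : ∀ x : K, g x = (x : n → ℝ) ⬝ᵥ x := fun x => by
    have := quadForm_apply (1 : Matrix n n ℝ) x
    rw [Matrix.one_mulVec] at this
    exact this
  have hg : ∀ x : K, g x = (x : n → ℝ) ⬝ᵥ (Ω * (-Ω * rot Ω s * Φ)) *ᵥ x := fun x => by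
    have h1 : Ω * (-Ω * rot Ω s * Φ) = rot Ω s * Φ := by
      rw [← mul_assoc, ← mul_assoc, mul_neg, hΩ.sq, neg_neg, one_mul]
    have h2 : (rot Ω s * Φ) *ᵥ (x : n → ℝ) = x := by
      have := x.2
      rwa [LinearMap.mem_ker, Matrix.toLin'_apply, Matrix.sub_mulVec, Matrix.one_mulVec,
        sub_eq_zero] at this
    rw [hg0, h1, h2]
  have hnd : sigPos g + sigNeg g = nullity (rot Ω s * Φ - 1) := by
    obtain ⟨h1, h2⟩ := sig_of_pos g fun x hx => by
      rw [hg0]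
      have hx' : (x : n → ℝ) ≠ 0 := by simpa using hx
      exact lt_of_le_of_ne (Finset.sum_nonneg fun i _ => mul_self_nonneg _)
        (Ne.symm (dotProduct_self_eq_zero.not.2 hx'))
    rw [h1, h2, add_zero]; rfl
  refine eventually_nhdsWithin_of_sides rfl ?_ ?_
  · filter_upwards [eventually_jump_right hΩ hR hs hsymp (hd s hs).1 hder g hg hnd,
      eventually_jump_right hΩ hR' hs hsymp (hd s hs).2 hder g hg hnd] with t h1 h2
    rw [h1.1, h2.1]; ring
  · filter_upwards [eventually_jump_left hΩ hR hs hsymp (hd s hs).1 hder g hg hnd,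
      eventually_jump_left hΩ hR' hs hsymp (hd s hs).2 hder g hg hnd] with t h1 h2
    rw [h1.1, h2.1]; ring

/-- **Change of charts.** The difference of the signatures in two charts is locally constant, also at
matrices with eigenvalue `1`: a small rotation moves `Φ` to a matrix without the eigenvalue `1`, and
along the way both signatures change by the same amount. -/
lemma eventually_sgn_sub_sgn_eq (hΩ : IsCompatible Ω) {R' Φ : Matrix n n ℝ} (hR : IsCenter Ω R)
    (hR' : IsCenter Ω R') (hΦ : IsSymp Ω Φ) (hd : (Φ - R).det ≠ 0) (hd' : (Φ - R').det ≠ 0) :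
    ∀ᶠ Φ' in 𝓝[{Φ' | IsSymp Ω Φ'}] Φ,
      sgn (chartForm Ω R Φ') - sgn (chartForm Ω R' Φ') =
        sgn (chartForm Ω R Φ) - sgn (chartForm Ω R' Φ) := by
  have hcont : Continuous fun p : Matrix n n ℝ × ℝ => rot Ω p.2 * p.1 :=
    ((continuous_rot Ω).comp continuous_snd).mul continuous_fst
  have hdc : ∀ (Q : Matrix n n ℝ) (s : ℝ) (Φ : Matrix n n ℝ), (rot Ω s * Φ - Q).det ≠ 0 →
      ∀ᶠ p in 𝓝 (Φ, s), (rot Ω p.2 * p.1 - Q).det ≠ 0 := fun Q s Φ h =>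
    eventually_det_sub_ne_zero (hcont.tendsto (Φ, s)) h
  have h1 : ∀ᶠ s in 𝓝 (0 : ℝ), (rot Ω s * Φ - R).det ≠ 0 ∧ (rot Ω s * Φ - R').det ≠ 0 := by
    have h2 : Tendsto (fun s => (Φ, s)) (𝓝 (0 : ℝ)) (𝓝 (Φ, 0)) :=
      (continuous_const.prodMk continuous_id).tendsto 0
    exact (h2.eventually (hdc R 0 Φ (by simpa [rot_zero] using hd))).and
      (h2.eventually (hdc R' 0 Φ (by simpa [rot_zero] using hd')))
  obtain ⟨η, hη, hη'⟩ := Metric.eventually_nhds_iff.1 h1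
  obtain ⟨ε, hε1, hε⟩ := ((eventually_det_rot_mul_sub_one_ne_zero hΩ hΦ).and
    (Ioo_mem_nhdsGT hη)).exists
  have h3 : ∀ s ∈ Icc 0 ε, (rot Ω s * Φ - R).det ≠ 0 ∧ (rot Ω s * Φ - R').det ≠ 0 := by
    intro s hs
    apply hη'
    rw [Real.dist_0_eq_abs, abs_of_nonneg hs.1]
    exact hs.2.trans_lt hε.2
  have h4 : ∀ᶠ Φ' in 𝓝 Φ, ∀ s ∈ Icc 0 ε,
      (rot Ω s * Φ' - R).det ≠ 0 ∧ (rot Ω s * Φ' - R').det ≠ 0 := by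
    apply isCompact_Icc.eventually_forall_of_forall_eventually
    intro s hs
    exact (hdc R s Φ (h3 s hs).1).and (hdc R' s Φ (h3 s hs).2)
  have hε0 : ε ∈ Icc 0 ε := right_mem_Icc.2 hε.1.le
  have hlim : Tendsto (fun Φ' => rot Ω ε * Φ') (𝓝[{Φ' | IsSymp Ω Φ'}] Φ) (𝓝 (rot Ω ε * Φ)) :=
    ((continuous_const.mul continuous_id).tendsto Φ).mono_left nhdsWithin_le_nhds
  have hsymp : ∀ᶠ Φ' in 𝓝[{Φ' | IsSymp Ω Φ'}] Φ, IsSymp Ω (rot Ω ε * Φ') := by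
    filter_upwards [self_mem_nhdsWithin] with Φ' h using (isSymp_rot hΩ ε).mul h
  have hS := (isSymp_rot hΩ ε).mul hΦ
  filter_upwards [h4.filter_mono nhdsWithin_le_nhds, self_mem_nhdsWithin,
    eventually_sgn_chartForm_eq_of_det_ne_zero hΩ hR hS (h3 ε hε0).1 hε1 hlim hsymp,
    eventually_sgn_chartForm_eq_of_det_ne_zero hΩ hR' hS (h3 ε hε0).2 hε1 hlim hsymp]
    with Φ' h5 h6 h7 h8
  rw [sgn_sub_sgn_rot_mul hΩ hR hR' h6 hε.1.le h5, sgn_sub_sgn_rot_mul hΩ hR hR' hΦ hε.1.le h3,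
    h7, h8]

variable {X : Type*} [TopologicalSpace X]

/-- `f` is a lift of `Ψ : S → Sp`: in every chart, `f` differs from the signature by a locally constant
function. For paths, half the increment of a lift is the Maslov index. -/
def IsLift (Ω : Matrix n n ℝ) (Ψ : X → Matrix n n ℝ) (S : Set X) (f : X → ℤ) : Prop :=
  ∀ x ∈ S, ∀ R, IsCenter Ω R → (Ψ x - R).det ≠ 0 → ∀ᶠ y in 𝓝[S] x,
    f y - sgn (chartForm Ω R (Ψ y)) = f x - sgn (chartForm Ω R (Ψ x))

variable {Ψ : X → Matrix n n ℝ} {S : Set X}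

/-- It is enough to check the condition on a lift in one chart around each point. -/
lemma isLift_of_exists (hΩ : IsCompatible Ω) (hc : ContinuousOn Ψ S) (hΨ : ∀ x ∈ S, IsSymp Ω (Ψ x))
    {f : X → ℤ} (h : ∀ x ∈ S, ∃ R, IsCenter Ω R ∧ (Ψ x - R).det ≠ 0 ∧ ∀ᶠ y in 𝓝[S] x,
      f y - sgn (chartForm Ω R (Ψ y)) = f x - sgn (chartForm Ω R (Ψ x))) : IsLift Ω Ψ S f := by
  intro x hx R' hR' hd'
  obtain ⟨R, hR, hd, hf⟩ := h x hx
  have h1 : Tendsto Ψ (𝓝[S] x) (𝓝[{Φ' | IsSymp Ω Φ'}] (Ψ x)) :=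
    tendsto_nhdsWithin_iff.2 ⟨hc x hx, by
      filter_upwards [self_mem_nhdsWithin] with y hy using hΨ y hy⟩
  filter_upwards [hf, h1.eventually (eventually_sgn_sub_sgn_eq hΩ hR hR' (hΨ x hx) hd hd')]
    with y h2 h3
  linarith

lemma IsLift.congr {f : X → ℤ} (h : IsLift Ω Ψ S f) {Ψ' : X → Matrix n n ℝ}
    (he : ∀ x ∈ S, Ψ' x = Ψ x) : IsLift Ω Ψ' S f := by
  intro x hx R hR hd
  rw [he x hx] at hd ⊢
  filter_upwards [h x hx R hR hd, self_mem_nhdsWithin] with y hy hyS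
  rw [he y hyS, hy]

lemma IsLift.comp {Y : Type*} [TopologicalSpace Y] {f : X → ℤ} (h : IsLift Ω Ψ S f) {φ : Y → X}
    {S' : Set Y} (hφ : ContinuousOn φ S') (hm : MapsTo φ S' S) :
    IsLift Ω (Ψ ∘ φ) S' (f ∘ φ) := by
  intro y hy R hR hd
  exact ((hφ y hy).tendsto_nhdsWithin hm).eventually (h (φ y) (hm hy) R hR hd)

lemma IsLift.sub_eq_sub (hΩ : IsCompatible Ω) (hΨ : ∀ x ∈ S, IsSymp Ω (Ψ x)) {f f' : X → ℤ}
    (h : IsLift Ω Ψ S f) (h' : IsLift Ω Ψ S f') (hS : IsPreconnected S) {x y : X} (hx : x ∈ S)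
    (hy : y ∈ S) : f y - f x = f' y - f' x := by
  have := eq_of_eventually_eq hS (f := fun z => f z - f' z) ?_ hx hy
  · linarith
  intro z hz
  obtain ⟨R, hR, hd⟩ := exists_isCenter hΩ (hΨ z hz)
  filter_upwards [h z hz R hR hd, h' z hz R hR hd] with w h1 h2
  linarith

/-- A lift of a path along which the nullity of `Ψ - 1` is constant is itself constant. -/
lemma IsLift.eq_of_nullity (hΩ : IsCompatible Ω) (hc : ContinuousOn Ψ S)
    (hΨ : ∀ x ∈ S, IsSymp Ω (Ψ x)) {f : X → ℤ} (h : IsLift Ω Ψ S f) (hS : IsPreconnected S)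
    (hnull : ∀ x ∈ S, ∀ y ∈ S, nullity (Ψ x - 1) = nullity (Ψ y - 1)) {x y : X} (hx : x ∈ S)
    (hy : y ∈ S) : f x = f y := by
  refine eq_of_eventually_eq hS ?_ hx hy
  intro z hz
  obtain ⟨R, hR, hd⟩ := exists_isCenter hΩ (hΨ z hz)
  have hmem : ∀ᶠ w in 𝓝[S] z, w ∈ S := self_mem_nhdsWithin
  filter_upwards [h z hz R hR hd, eventually_sgn_chartForm_eq hΩ hR (hΨ z hz) hd (hc z hz)
    (by filter_upwards [hmem] with w hw using hΨ w hw)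
    (by filter_upwards [hmem] with w hw using hnull w hw z hz)] with w h1 h2
  linarith

/-- Maps from a simply connected space to the symplectic group have lifts. -/
lemma exists_isLift_univ [SimplyConnectedSpace X] [LocallyPathConnectedSpace X]
    (hΩ : IsCompatible Ω) (hc : Continuous Ψ) (hΨ : ∀ x, IsSymp Ω (Ψ x)) :
    ∃ f, IsLift Ω Ψ univ f := by
  obtain ⟨f, hf⟩ := exists_glue (ι := {R // IsCenter Ω R}) (fun R => {x | (Ψ x - R).det ≠ 0})
    (fun R => isOpen_ne.preimage (hc.sub continuous_const).matrix_det)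
    (fun x => by
      obtain ⟨R, hR, hd⟩ := exists_isCenter hΩ (hΨ x)
      exact ⟨⟨R, hR⟩, hd⟩)
    (fun R x => sgn (chartForm Ω R (Ψ x))) (fun R R' x hd hd' => by
      have h1 : Tendsto Ψ (𝓝 x) (𝓝[{Φ' | IsSymp Ω Φ'}] (Ψ x)) :=
        tendsto_nhdsWithin_iff.2 ⟨hc.tendsto x, Eventually.of_forall hΨ⟩
      exact h1.eventually (eventually_sgn_sub_sgn_eq hΩ R.2 R'.2 (hΨ x) hd hd'))
  refine ⟨f, fun x _ R hR hd => ?_⟩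
  rw [nhdsWithin_univ]
  exact hf ⟨R, hR⟩ x hd

/-- **Homotopy invariance.** If the nullity of `H - 1` is constant along the two sides `t = a` and
`t = b` of a homotopy in the symplectic group, then lifts of the two paths have the same increment. -/
theorem lift_increment_eq (hΩ : IsCompatible Ω) {a b : ℝ} (hab : a ≤ b)
    {H : ℝ × ℝ → Matrix n n ℝ} (hH : ContinuousOn H (Icc 0 1 ×ˢ Icc a b))
    (hsymp : ∀ s ∈ Icc (0 : ℝ) 1, ∀ t ∈ Icc a b, IsSymp Ω (H (s, t)))
    (hna : ∀ s ∈ Icc (0 : ℝ) 1, nullity (H (s, a) - 1) = nullity (H (0, a) - 1))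
    (hnb : ∀ s ∈ Icc (0 : ℝ) 1, nullity (H (s, b) - 1) = nullity (H (0, b) - 1))
    {f₀ f₁ : ℝ → ℤ} (h₀ : IsLift Ω (fun t => H (0, t)) (Icc a b) f₀)
    (h₁ : IsLift Ω (fun t => H (1, t)) (Icc a b) f₁) : f₀ b - f₀ a = f₁ b - f₁ a := by
  let ρ : ℝ × ℝ → ℝ × ℝ := fun p =>
    ((projIcc 0 1 zero_le_one p.1 : ℝ), (projIcc a b hab p.2 : ℝ))
  have hρ : Continuous ρ :=
    (continuous_subtype_val.comp (continuous_projIcc.comp continuous_fst)).prodMk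
      (continuous_subtype_val.comp (continuous_projIcc.comp continuous_snd))
  have hρm : ∀ p, ρ p ∈ Icc (0 : ℝ) 1 ×ˢ Icc a b := fun p =>
    ⟨(projIcc 0 1 zero_le_one p.1).2, (projIcc a b hab p.2).2⟩
  have hρe : ∀ s ∈ Icc (0 : ℝ) 1, ∀ t ∈ Icc a b, ρ (s, t) = (s, t) := by
    intro s hs t ht
    simp [ρ, projIcc_of_mem _ hs, projIcc_of_mem _ ht]
  obtain ⟨f, hf⟩ := exists_isLift_univ (Ψ := H ∘ ρ) hΩ (hH.comp_continuous hρ hρm)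
    (fun p => hsymp _ (hρm p).1 _ (hρm p).2)
  have h01 : (0 : ℝ) ∈ Icc (0 : ℝ) 1 := ⟨le_rfl, zero_le_one⟩
  have h11 : (1 : ℝ) ∈ Icc (0 : ℝ) 1 := ⟨zero_le_one, le_rfl⟩
  have haI : a ∈ Icc a b := ⟨le_rfl, hab⟩
  have hbI : b ∈ Icc a b := ⟨hab, le_rfl⟩
  have hrow : ∀ s ∈ Icc (0 : ℝ) 1, IsLift Ω (fun t => H (s, t)) (Icc a b) (fun t => f (s, t)) := by
    intro s hs
    refine (hf.comp (φ := fun t => (s, t)) (S' := Icc a b) (by fun_prop)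
      (fun _ _ => mem_univ _)).congr fun t ht => ?_
    simp [hρe s hs t ht]
  have hcol : ∀ t ∈ Icc a b, (∀ s ∈ Icc (0 : ℝ) 1, nullity (H (s, t) - 1) = nullity (H (0, t) - 1)) →
      f (0, t) = f (1, t) := by
    intro t ht hnull
    have h2 : IsLift Ω (fun s => H (s, t)) (Icc 0 1) (fun s => f (s, t)) := by
      refine (hf.comp (φ := fun s => (s, t)) (S' := Icc (0 : ℝ) 1) (by fun_prop)
        (fun _ _ => mem_univ _)).congr fun s hs => ?_
      simp [hρe s hs t ht]
    refine h2.eq_of_nullity hΩ ?_ (fun s hs => hsymp s hs t ht) isPreconnected_Icc ?_ h01 h11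
    · exact hH.comp (by fun_prop) fun s hs => ⟨hs, ht⟩
    · intro s hs s' hs'
      rw [hnull s hs, hnull s' hs']
  rw [h₀.sub_eq_sub hΩ (hsymp 0 h01) (hrow 0 h01) isPreconnected_Icc haI hbI,
    h₁.sub_eq_sub hΩ (hsymp 1 h11) (hrow 1 h11) isPreconnected_Icc haI hbI,
    hcol a haI hna, hcol b hbI hnb]

end MaslovChart

/-! ### The crossing sum of a regular path -/

namespace SympPath

open Filter Topology MatrixSignature MaslovChart

variable {ι : Type*} [Fintype ι] [DecidableEq ι]

lemma isCompatible_J₀ : IsCompatible (J₀ ι) where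
  transpose := by
    simp [J₀, Matrix.fromBlocks_transpose, Matrix.fromBlocks_neg]
  sq := by
    simp [J₀, Matrix.fromBlocks_multiply, ← Matrix.fromBlocks_one, Matrix.fromBlocks_neg]

lemma mem_symplecticGroup_iff {A : Matrix (ι ⊕ ι) (ι ⊕ ι) ℝ} :
    A ∈ Matrix.symplecticGroup ι ℝ ↔ IsSymp (J₀ ι) A := by
  have : Matrix.J ι ℝ = -J₀ ι := by
    simp [J₀, Matrix.J, Matrix.fromBlocks_neg]
  rw [SymplecticGroup.mem_iff', IsSymp, this]
  simp

variable {Φ : ℝ → Matrix (ι ⊕ ι) (ι ⊕ ι) ℝ} {a b t₀ : ℝ}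

lemma IsRegular.isSymp (h : IsRegular Φ a b) {t : ℝ} (ht : t ∈ Icc a b) : IsSymp (J₀ ι) (Φ t) :=
  mem_symplecticGroup_iff.1 (h.symplectic t ht)

lemma IsRegular.hasDerivWithinAt (h : IsRegular Φ a b) (ht : t₀ ∈ Icc a b) (i j : ι ⊕ ι) :
    HasDerivWithinAt (fun t => Φ t i j) (velocity Φ a b t₀ i j) (Icc a b) t₀ :=
  ((h.smooth i j).differentiableOn (by simp) t₀ ht).hasDerivWithinAt

lemma mem_fixedSpace {x : ι ⊕ ι → ℝ} : x ∈ fixedSpace Φ t₀ ↔ (Φ t₀ - 1) *ᵥ x = 0 := by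
  unfold fixedSpace
  rw [LinearMap.mem_ker, Matrix.toLin'_apply]

lemma crossingForm_apply (hΦ : IsSymp (J₀ ι) (Φ t₀)) (x y : fixedSpace Φ t₀) :
    crossingForm Φ a b t₀ x y =
      (x : ι ⊕ ι → ℝ) ⬝ᵥ (J₀ ι * velocity Φ a b t₀) *ᵥ (y : ι ⊕ ι → ℝ) := by
  have hy : Φ t₀ *ᵥ (y : ι ⊕ ι → ℝ) = y := by
    have := mem_fixedSpace.1 y.2
    rwa [Matrix.sub_mulVec, Matrix.one_mulVec, sub_eq_zero] at this
  have hy' : (Φ t₀)⁻¹ *ᵥ (y : ι ⊕ ι → ℝ) = y := by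
    nth_rewrite 1 [← hy]
    rw [Matrix.mulVec_mulVec, Matrix.nonsing_inv_mul _ (hΦ.isUnit isCompatible_J₀),
      Matrix.one_mulVec]
  have : crossingForm Φ a b t₀ x y =
      (x : ι ⊕ ι → ℝ) ⬝ᵥ (generator Φ a b t₀) *ᵥ (y : ι ⊕ ι → ℝ) :=
    Matrix.toBilin'_apply' _ _ _
  rw [this, generator, ← Matrix.mulVec_mulVec, hy']

/-- The crossing form is symmetric, being a limit of symmetric forms in a chart. -/
lemma IsRegular.crossingForm_symm (h : IsRegular Φ a b) (hab : a < b) (ht : t₀ ∈ Icc a b)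
    (x y : fixedSpace Φ t₀) : crossingForm Φ a b t₀ x y = crossingForm Φ a b t₀ y x := by
  have hΦ := h.isSymp ht
  obtain ⟨R, hR, hd⟩ := exists_isCenter isCompatible_J₀ hΦ
  have hA := h.hasDerivWithinAt ht
  have hsub : 𝓝[Icc a b \ {t₀}] t₀ ≤ 𝓝[Icc a b] t₀ := nhdsWithin_mono _ sdiff_subset
  have hne : (𝓝[Icc a b \ {t₀}] t₀).NeBot := by
    have h1 : AccPt t₀ (𝓟 (Icc a b)) := by
      have := (isPreconnected_Icc (a := a) (b := b)).preperfect_of_nontrivial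
        ⟨a, left_mem_Icc.2 hab.le, b, right_mem_Icc.2 hab.le, hab.ne⟩
      exact this t₀ ht
    rwa [accPt_principal_iff_nhdsWithin] at h1
  have hfix : ∀ x : fixedSpace Φ t₀, (Φ t₀ - 1) *ᵥ (x : ι ⊕ ι → ℝ) = 0 := fun x =>
    mem_fixedSpace.1 x.2
  have hlim : ∀ x y : fixedSpace Φ t₀, Tendsto
      (fun t => (x : ι ⊕ ι → ℝ) ⬝ᵥ ((t - t₀)⁻¹ • (chartForm (J₀ ι) R (Φ t) *ᵥ (y : ι ⊕ ι → ℝ))))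
      (𝓝[Icc a b \ {t₀}] t₀) (𝓝 (crossingForm Φ a b t₀ x y)) := by
    intro x y
    have h1 := tendsto_chartForm_div (Ω := J₀ ι) ((tendsto_of_entries hA).mono_left hsub) hd
      (tendsto_slope_of_entries hA) (hfix y)
    have h2 : Continuous fun v : ι ⊕ ι → ℝ => (x : ι ⊕ ι → ℝ) ⬝ᵥ v := by
      simp only [dotProduct]; fun_prop
    have h3 := (h2.tendsto _).comp h1
    rwa [dotProduct_chart_deriv hΦ hd (hfix x), ← crossingForm_apply hΦ] at h3
  refine tendsto_nhds_unique (hlim x y) ((hlim y x).congr' ?_)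
  filter_upwards [self_mem_nhdsWithin, (eventually_det_sub_ne_zero (tendsto_of_entries hA)
    hd).filter_mono hsub] with t ht' hd'
  rw [dotProduct_smul, dotProduct_smul]
  congr 1
  rw [Matrix.dotProduct_mulVec, ← Matrix.mulVec_transpose,
    chartForm_transpose isCompatible_J₀ hR.symp (h.isSymp ht'.1) hd', dotProduct_comm]

lemma IsRegular.sig_add (h : IsRegular Φ a b) (hab : a < b) (ht : t₀ ∈ Icc a b) :
    sigPos (crossingForm Φ a b t₀).toQuadraticMap + sigNeg (crossingForm Φ a b t₀).toQuadraticMap =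
      nullity (Φ t₀ - 1) := by
  have h1 := QuadraticForm.sigPos_add_sigNeg_add_radical
    (Q := (crossingForm Φ a b t₀).toQuadraticMap)
  have h2 : (crossingForm Φ a b t₀).toQuadraticMap.radical = ⊥ := by
    by_cases hc : IsCrossing Φ t₀
    · rw [Submodule.eq_bot_iff]
      intro x hx
      have h3 := QuadraticMap.radical_le_ker_polarBilin hx
      rw [LinearMap.mem_ker] at h3
      refine (h.nondegenerate t₀ ht hc).1 x fun y => ?_
      have h4 := LinearMap.congr_fun h3 y
      simp only [QuadraticMap.polarBilin_apply_apply, LinearMap.BilinMap.polar_toQuadraticMap,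
        LinearMap.zero_apply] at h4
      have := h.crossingForm_symm hab ht x y
      linarith
    · have : Module.finrank ℝ (fixedSpace Φ t₀) = 0 := nullity_eq_zero_iff.2 hc
      have := Submodule.finrank_le (crossingForm Φ a b t₀).toQuadraticMap.radical
      rw [← Submodule.finrank_eq_zero (R := ℝ)]
      omega
  rw [h2, finrank_bot, add_zero] at h1
  exact h1

lemma crossingSign_eq_zero (h : (Φ t₀ - 1).det ≠ 0) : crossingSign Φ a b t₀ = 0 := by
  have h0 : Module.finrank ℝ (fixedSpace Φ t₀) = 0 := nullity_eq_zero_iff.2 h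
  have h1 := QuadraticForm.sigPos_add_sigNeg_add_radical
    (Q := (crossingForm Φ a b t₀).toQuadraticMap)
  unfold crossingSign
  omega

/-- The crossing sum of a regular path is half the increment of a lift: of twice the sum of the
signs of the crossings before `t`, plus the sign of the crossing at `t`. -/
theorem IsRegular.exists_isLift (h : IsRegular Φ a b) (hab : a < b) :
    ∃ f, IsLift (J₀ ι) Φ (Icc a b) f ∧ crossingSum Φ a b = ((f b - f a : ℤ) : ℝ) / 2 := by
  classical
  set C : Finset ℝ := h.isolated.toFinset with hC
  have hCmem : ∀ t, t ∈ C ↔ t ∈ Icc a b ∧ IsCrossing Φ t := fun t => by simp [hC]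
  let c : ℝ → ℤ := crossingSign Φ a b
  let f : ℝ → ℤ := fun t => 2 * ∑ s ∈ C with s < t, c s + c t
  have hc : ContinuousOn Φ (Icc a b) := fun t ht => tendsto_of_entries (h.hasDerivWithinAt ht)
  refine ⟨f, isLift_of_exists isCompatible_J₀ hc (fun t ht => h.isSymp ht) fun t₀ ht => ?_, ?_⟩
  · have hΦ := h.isSymp ht
    obtain ⟨R, hR, hd⟩ := exists_isCenter isCompatible_J₀ hΦ
    refine ⟨R, hR, hd, ?_⟩
    have hg : ∀ x, (crossingForm Φ a b t₀).toQuadraticMap x =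
      (x : ι ⊕ ι → ℝ) ⬝ᵥ (J₀ ι * velocity Φ a b t₀) *ᵥ (x : ι ⊕ ι → ℝ) := fun x => by
      rw [LinearMap.BilinMap.toQuadraticMap_apply, crossingForm_apply hΦ]
    have hclose : ∀ᶠ t in 𝓝 t₀, ∀ s ∈ C, s ≠ t₀ → (s < t ↔ s < t₀) := by
      rw [eventually_all_finset]
      intro s _
      rcases lt_trichotomy s t₀ with hs | hs | hs
      · filter_upwards [lt_mem_nhds hs] with t h1 _
        exact ⟨fun _ => hs, fun _ => h1⟩
      · exact Eventually.of_forall fun t h1 => absurd hs h1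
      · filter_upwards [gt_mem_nhds hs] with t h1 _
        exact ⟨fun h2 => absurd h2 h1.not_gt, fun h2 => absurd h2 hs.not_gt⟩
    have hright : ∀ᶠ t in 𝓝[Icc a b ∩ Ioi t₀] t₀, sgn (chartForm (J₀ ι) R (Φ t)) =
        sgn (chartForm (J₀ ι) R (Φ t₀)) + c t₀ ∧ (Φ t - 1).det ≠ 0 :=
      eventually_jump_right isCompatible_J₀ hR ht (fun t ht => h.isSymp ht) hd
        (h.hasDerivWithinAt ht) _ hg (h.sig_add hab ht)
    have hleft : ∀ᶠ t in 𝓝[Icc a b ∩ Iio t₀] t₀, sgn (chartForm (J₀ ι) R (Φ t)) =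
        sgn (chartForm (J₀ ι) R (Φ t₀)) - c t₀ ∧ (Φ t - 1).det ≠ 0 :=
      eventually_jump_left isCompatible_J₀ hR ht (fun t ht => h.isSymp ht) hd
        (h.hasDerivWithinAt ht) _ hg (h.sig_add hab ht)
    refine eventually_nhdsWithin_of_sides rfl ?_ ?_
    · filter_upwards [hright, self_mem_nhdsWithin,
        hclose.filter_mono nhdsWithin_le_nhds] with t h1 h2 h3
      rw [h1.1]
      have h4 : c t = 0 := crossingSign_eq_zero h1.2
      have h5 : ∑ s ∈ C with s < t, c s = ∑ s ∈ C with s < t₀, c s + c t₀ := by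
        by_cases h6 : t₀ ∈ C
        · have : C.filter (· < t) = insert t₀ (C.filter (· < t₀)) := by
            ext s
            simp only [Finset.mem_filter, Finset.mem_insert]
            constructor
            · rintro ⟨hs, hst⟩
              by_cases hs0 : s = t₀
              · exact Or.inl hs0
              · exact Or.inr ⟨hs, (h3 s hs hs0).1 hst⟩
            · rintro (rfl | ⟨hs, hst⟩)
              · exact ⟨h6, h2.2⟩
              · exact ⟨hs, hst.trans h2.2⟩
          rw [this, Finset.sum_insert (by simp), add_comm]
        · have h7 : c t₀ = 0 := crossingSign_eq_zero fun hdet => h6 ((hCmem t₀).2 ⟨ht, hdet⟩)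
          rw [h7, add_zero]
          congr 1
          ext s
          simp only [Finset.mem_filter]
          refine and_congr_right fun hs => h3 s hs ?_
          rintro rfl; exact h6 hs
      simp only [f, h4, h5]
      ring
    · filter_upwards [hleft, self_mem_nhdsWithin,
        hclose.filter_mono nhdsWithin_le_nhds] with t h1 h2 h3
      rw [h1.1]
      have h4 : c t = 0 := crossingSign_eq_zero h1.2
      have h5 : ∑ s ∈ C with s < t, c s = ∑ s ∈ C with s < t₀, c s := by
        congr 1
        ext s
        simp only [Finset.mem_filter]
        refine and_congr_right fun hs => ?_
        by_cases hs0 : s = t₀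
        · subst hs0
          exact ⟨fun h8 => absurd h8 (not_lt.2 (le_of_lt h2.2)), fun h8 => absurd h8 (lt_irrefl _)⟩
        · exact h3 s hs hs0
      simp only [f, h4, h5]
      ring
  · have hfin : ∑ᶠ t ∈ {t ∈ Ioo a b | IsCrossing Φ t}, (crossingSign Φ a b t : ℝ) =
        ∑ s ∈ C with a < s ∧ s < b, (c s : ℝ) := by
      rw [finsum_mem_eq_sum_of_inter_support_eq]
      ext t
      simp only [mem_inter_iff, mem_ofPred_eq, Finset.coe_filter, hCmem]
      constructor
      · rintro ⟨⟨h1, h2⟩, h3⟩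
        exact ⟨⟨⟨Ioo_subset_Icc_self h1, h2⟩, h1⟩, h3⟩
      · rintro ⟨⟨⟨h1, h2⟩, h3⟩, h4⟩
        exact ⟨⟨h3, h2⟩, h4⟩
    have h1 : ∑ s ∈ C with s < a, c s = 0 := by
      rw [Finset.filter_false_of_mem, Finset.sum_empty]
      intro s hs
      exact not_lt.2 ((hCmem s).1 hs).1.1
    have h2 : ∑ s ∈ C with s < b, c s = c a + ∑ s ∈ C with a < s ∧ s < b, c s := by
      by_cases h6 : a ∈ C
      · have : C.filter (· < b) = insert a (C.filter fun s => a < s ∧ s < b) := by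
          ext s
          simp only [Finset.mem_filter, Finset.mem_insert]
          constructor
          · rintro ⟨hs, hst⟩
            rcases ((hCmem s).1 hs).1.1.eq_or_lt with h7 | h7
            · exact Or.inl h7.symm
            · exact Or.inr ⟨hs, h7, hst⟩
          · rintro (rfl | ⟨hs, hst⟩)
            · exact ⟨h6, hab⟩
            · exact ⟨hs, hst.2⟩
        rw [this, Finset.sum_insert (by simp)]
      · have h7 : c a = 0 := crossingSign_eq_zero fun hdet =>
          h6 ((hCmem a).2 ⟨left_mem_Icc.2 hab.le, hdet⟩)
        rw [h7, zero_add]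
        congr 1
        ext s
        simp only [Finset.mem_filter]
        refine and_congr_right fun hs => ⟨fun h8 => ⟨?_, h8⟩, fun h8 => h8.2⟩
        refine lt_of_le_of_ne ((hCmem s).1 hs).1.1 ?_
        rintro rfl; exact h6 hs
    simp only [crossingSum, hfin, f, h1, h2]
    push_cast
    simp only [c]
    ring

end SympPath

/-! ### Smooth steps and the Cayley contraction -/

namespace MaslovChart

open Filter Topology MatrixSignature

lemma exists_hasDerivAt_expNegInvGlue {x : ℝ} (hx : 0 < x) :
    ∃ d, 0 < d ∧ HasDerivAt expNegInvGlue d x := by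
  refine ⟨Real.exp (-x⁻¹) * (x ^ 2)⁻¹, by positivity, ?_⟩
  have h1 : HasDerivAt (fun y : ℝ => Real.exp (-y⁻¹)) (Real.exp (-x⁻¹) * (x ^ 2)⁻¹) x := by
    have := ((hasDerivAt_inv hx.ne').neg).exp
    simpa using this
  refine h1.congr_of_eventuallyEq ?_
  filter_upwards [lt_mem_nhds hx] with y hy
  simp [expNegInvGlue, hy.not_ge]

/-- Between its two constant parts, the smooth transition function has positive derivative. -/
lemma exists_hasDerivAt_smoothTransition {x : ℝ} (hx : 0 < x) (hx1 : x < 1) :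
    ∃ d, 0 < d ∧ HasDerivAt Real.smoothTransition d x := by
  obtain ⟨d, hd, h⟩ := exists_hasDerivAt_expNegInvGlue hx
  obtain ⟨d', hd', h'⟩ := exists_hasDerivAt_expNegInvGlue (sub_pos.2 hx1)
  have h2 : HasDerivAt (fun y => expNegInvGlue (1 - y)) (-d') x := by
    have := h'.comp x ((hasDerivAt_id x).const_sub 1)
    simpa [Function.comp_def] using this
  have h3 := h.div (h.add h2) (Real.smoothTransition.pos_denom x).ne'
  refine ⟨_, ?_, h3⟩
  have e1 := expNegInvGlue.pos_of_pos hx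
  have e2 := expNegInvGlue.pos_of_pos (sub_pos.2 hx1)
  refine div_pos ?_ (by simp only [Pi.add_apply]; positivity)
  simp only [Pi.add_apply]
  nlinarith [mul_pos hd e2, mul_pos e1 hd']

lemma smoothTransition_half : Real.smoothTransition (1 / 2) = 1 / 2 := by
  have e1 := expNegInvGlue.pos_of_pos (show (0 : ℝ) < 1 / 2 by norm_num)
  rw [Real.smoothTransition, show (1 : ℝ) - 1 / 2 = 1 / 2 by norm_num]
  field_simp
  norm_num

variable {n : Type*} [Fintype n] [DecidableEq n] {Ω : Matrix n n ℝ}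

section Smooth

variable {A B : ℝ → Matrix n n ℝ} {t₀ : ℝ}

lemma contDiffAt_det (hA : ∀ i j, ContDiffAt ℝ ∞ (fun t => A t i j) t₀) :
    ContDiffAt ℝ ∞ (fun t => (A t).det) t₀ := by
  simp only [Matrix.det_apply']
  exact ContDiffAt.sum fun σ _ => contDiffAt_const.mul (contDiffAt_prod fun i _ => hA _ _)

lemma contDiffAt_inv_apply (hA : ∀ i j, ContDiffAt ℝ ∞ (fun t => A t i j) t₀)
    (hdet : (A t₀).det ≠ 0) (i j : n) : ContDiffAt ℝ ∞ (fun t => (A t)⁻¹ i j) t₀ := by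
  have h1 : ∀ t, (A t)⁻¹ i j = ((A t).det)⁻¹ * ((A t).updateRow j (Pi.single i 1)).det := by
    intro t
    rw [Matrix.inv_def, Matrix.smul_apply, Matrix.adjugate_apply, Ring.inverse_eq_inv, smul_eq_mul]
  simp only [h1]
  refine ((contDiffAt_det hA).inv hdet).mul (contDiffAt_det fun k l => ?_)
  by_cases hk : k = j
  · subst hk
    simp only [Matrix.updateRow_self]
    exact contDiffAt_const
  · simp only [Matrix.updateRow_ne hk]
    exact hA k l

lemma contDiffAt_mul_apply (hA : ∀ i j, ContDiffAt ℝ ∞ (fun t => A t i j) t₀)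
    (hB : ∀ i j, ContDiffAt ℝ ∞ (fun t => B t i j) t₀) (i j : n) :
    ContDiffAt ℝ ∞ (fun t => (A t * B t) i j) t₀ := by
  simp only [Matrix.mul_apply]
  exact ContDiffAt.sum fun k _ => (hA i k).mul (hB k j)

end Smooth

/-- The matrices `Z` such that the segment from `1` to `Z` consists of invertible matrices. -/
def invSegment (n : Type*) [Fintype n] [DecidableEq n] : Set (Matrix n n ℝ) :=
  {Z | ∀ s ∈ Icc (0 : ℝ) 1, (s • Z + (1 - s) • (1 : Matrix n n ℝ)).det ≠ 0}

/-- The segment from `0` to the Cayley transform `(Z - 1) (Z + 1)⁻¹`, transformed back. It is a path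
of symplectic matrices from `1` to `Z`. -/
def cayley (s : ℝ) (Z : Matrix n n ℝ) : Matrix n n ℝ :=
  ((1 + s) • Z + (1 - s) • (1 : Matrix n n ℝ)) * ((1 - s) • Z + (1 + s) • (1 : Matrix n n ℝ))⁻¹

lemma det_cayley_denom {Z : Matrix n n ℝ} (hZ : Z ∈ invSegment n) {s : ℝ} (hs : s ∈ Icc (0 : ℝ) 1) :
    ((1 - s) • Z + (1 + s) • (1 : Matrix n n ℝ)).det ≠ 0 := by
  have h1 := hZ ((1 - s) / 2) ⟨by linarith [hs.2], by linarith [hs.1]⟩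
  have h2 : (1 - s) • Z + (1 + s) • (1 : Matrix n n ℝ) =
      (2 : ℝ) • (((1 - s) / 2) • Z + (1 - (1 - s) / 2) • (1 : Matrix n n ℝ)) := by module
  rw [h2, Matrix.det_smul]
  exact mul_ne_zero (by positivity) h1

lemma cayley_zero {Z : Matrix n n ℝ} (hZ : Z ∈ invSegment n) : cayley 0 Z = 1 := by
  have h := det_cayley_denom hZ (s := 0) (by simp)
  simp only [cayley, sub_zero, add_zero] at *
  exact Matrix.mul_nonsing_inv _ (isUnit_iff_ne_zero.2 h)

lemma cayley_one (Z : Matrix n n ℝ) : cayley 1 Z = Z := by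
  have h1 : ((2 : ℝ) • (1 : Matrix n n ℝ))⁻¹ = (2 : ℝ)⁻¹ • 1 :=
    Matrix.inv_eq_left_inv (by rw [smul_mul_smul_comm]; norm_num)
  simp only [cayley, sub_self, zero_smul, add_zero, zero_add]
  rw [show (1 : ℝ) + 1 = 2 by norm_num, h1, smul_mul_smul_comm, mul_one]
  norm_num

lemma cayley_self (s : ℝ) : cayley s (1 : Matrix n n ℝ) = 1 := by
  have h1 : ((2 : ℝ) • (1 : Matrix n n ℝ))⁻¹ = (2 : ℝ)⁻¹ • 1 :=
    Matrix.inv_eq_left_inv (by rw [smul_mul_smul_comm]; norm_num)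
  have h2 : (1 + s) • (1 : Matrix n n ℝ) + (1 - s) • (1 : Matrix n n ℝ) = (2 : ℝ) • 1 := by module
  have h3 : (1 - s) • (1 : Matrix n n ℝ) + (1 + s) • (1 : Matrix n n ℝ) = (2 : ℝ) • 1 := by module
  rw [cayley, h2, h3, h1, smul_mul_smul_comm]
  norm_num

lemma isSymp_cayley {Z : Matrix n n ℝ} (hZ : IsSymp Ω Z) (hU : Z ∈ invSegment n) {s : ℝ}
    (hs : s ∈ Icc (0 : ℝ) 1) : IsSymp Ω (cayley s Z) := by
  have hu := isUnit_iff_ne_zero.2 (det_cayley_denom hU hs)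
  set M := (1 + s) • Z + (1 - s) • (1 : Matrix n n ℝ) with hM
  set N := (1 - s) • Z + (1 + s) • (1 : Matrix n n ℝ) with hN
  have h1 : ∀ p q : ℝ, (p • Z + q • (1 : Matrix n n ℝ))ᵀ * Ω * (p • Z + q • (1 : Matrix n n ℝ)) =
      (p ^ 2 + q ^ 2) • Ω + (p * q) • (Zᵀ * Ω + Ω * Z) := by
    intro p q
    have hZ' : Zᵀ * (Ω * Z) = Ω := by rw [← mul_assoc]; exact hZ
    simp only [Matrix.transpose_add, Matrix.transpose_smul, Matrix.transpose_one, add_mul, mul_add,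
      smul_mul_assoc, mul_smul_comm, one_mul, mul_one, mul_assoc, hZ']
    module
  have h2 : Mᵀ * Ω * M = Nᵀ * Ω * N := by
    rw [hM, hN, h1, h1]
    congr 2 <;> ring
  have h3 : N * N⁻¹ = 1 := Matrix.mul_nonsing_inv _ hu
  have h4 : (N⁻¹)ᵀ * Nᵀ = 1 := by rw [← Matrix.transpose_mul, h3, Matrix.transpose_one]
  have h5 : cayley s Z = M * N⁻¹ := rfl
  unfold IsSymp
  rw [h5, Matrix.transpose_mul]
  calc (N⁻¹)ᵀ * Mᵀ * Ω * (M * N⁻¹) = (N⁻¹)ᵀ * (Mᵀ * Ω * M) * N⁻¹ := by simp only [mul_assoc]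
    _ = ((N⁻¹)ᵀ * Nᵀ) * Ω * (N * N⁻¹) := by rw [h2]; simp only [mul_assoc]
    _ = Ω := by rw [h3, h4, one_mul, mul_one]

lemma tendsto_cayley {ι : Type*} {l : Filter ι} {σ : ι → ℝ} {A : ι → Matrix n n ℝ} {s : ℝ}
    {Z : Matrix n n ℝ} (hσ : Tendsto σ l (𝓝 s)) (hA : Tendsto A l (𝓝 Z))
    (hdet : ((1 - s) • Z + (1 + s) • (1 : Matrix n n ℝ)).det ≠ 0) :
    Tendsto (fun i => cayley (σ i) (A i)) l (𝓝 (cayley s Z)) := by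
  have h1 := hσ.const_add 1
  have h2 := hσ.const_sub 1
  exact ((h1.smul hA).add (h2.smul_const 1)).mul
    (tendsto_matrix_inv ((h2.smul hA).add (h1.smul_const 1)) hdet)

lemma contDiffAt_cayley_apply {Z : Matrix n n ℝ} (hU : Z ∈ invSegment n) {σ : ℝ → ℝ} {t₀ : ℝ}
    (hσ : ContDiffAt ℝ ∞ σ t₀) (hs : σ t₀ ∈ Icc (0 : ℝ) 1) (i j : n) :
    ContDiffAt ℝ ∞ (fun t => cayley (σ t) Z i j) t₀ := by
  have h1 : ∀ p q : ℝ → ℝ, ContDiffAt ℝ ∞ p t₀ → ContDiffAt ℝ ∞ q t₀ → ∀ i j,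
      ContDiffAt ℝ ∞ (fun t => (p t • Z + q t • (1 : Matrix n n ℝ)) i j) t₀ := by
    intro p q hp hq i j
    simp only [Matrix.add_apply, Matrix.smul_apply, smul_eq_mul]
    exact (hp.mul contDiffAt_const).add (hq.mul contDiffAt_const)
  have h2 := contDiffAt_const (c := (1 : ℝ)).add hσ
  have h3 := contDiffAt_const (c := (1 : ℝ)).sub hσ
  exact contDiffAt_mul_apply (h1 _ _ h2 h3)
    (contDiffAt_inv_apply (h1 _ _ h3 h2) (det_cayley_denom hU hs)) i j

/-- Near each point, a path in the symplectic group can be approximated by Cayley paths between its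
values, and one small rotation moves all of them away from the matrices with eigenvalue `1`. -/
lemma exists_rot_nhds (hΩ : IsCompatible Ω) {Ψ : ℝ → Matrix n n ℝ} (hc : Continuous Ψ)
    (hΨ : ∀ t, IsSymp Ω (Ψ t)) (x₀ : ℝ) :
    ∃ ε : ℝ, ∃ V : Set ℝ, IsOpen V ∧ x₀ ∈ V ∧ ∀ x ∈ V, ∀ y ∈ V, ∀ t ∈ V, ∀ s ∈ Icc (0 : ℝ) 1,
      (rot Ω ε * (Ψ x * cayley s ((Ψ x)⁻¹ * Ψ y)) - 1).det ≠ 0 ∧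
        (Ψ t)⁻¹ * (Ψ x * cayley s ((Ψ x)⁻¹ * Ψ y)) ∈ invSegment n := by
  obtain ⟨ε, hε⟩ := (eventually_det_rot_mul_sub_one_ne_zero hΩ (hΨ x₀)).exists
  have hinv : ∀ x, (Ψ x)⁻¹ * Ψ x = 1 := fun x => Matrix.nonsing_inv_mul _ ((hΨ x).isUnit hΩ)
  let W : (ℝ × ℝ × ℝ) × ℝ × ℝ → Matrix n n ℝ := fun p =>
    Ψ p.1.1 * cayley p.2.1 ((Ψ p.1.1)⁻¹ * Ψ p.1.2.1)
  have hW : ∀ s σ : ℝ, Tendsto W (𝓝 ((x₀, x₀, x₀), s, σ)) (𝓝 (Ψ x₀)) := by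
    intro s σ
    have e1 : Tendsto (fun p : (ℝ × ℝ × ℝ) × ℝ × ℝ => Ψ p.1.1) (𝓝 ((x₀, x₀, x₀), s, σ))
        (𝓝 (Ψ x₀)) := (hc.comp (by fun_prop)).tendsto ((x₀, x₀, x₀), s, σ)
    have e2 : Tendsto (fun p : (ℝ × ℝ × ℝ) × ℝ × ℝ => Ψ p.1.2.1) (𝓝 ((x₀, x₀, x₀), s, σ))
        (𝓝 (Ψ x₀)) := (hc.comp (by fun_prop)).tendsto ((x₀, x₀, x₀), s, σ)
    have e3 : Tendsto (fun p : (ℝ × ℝ × ℝ) × ℝ × ℝ => p.2.1) (𝓝 ((x₀, x₀, x₀), s, σ)) (𝓝 s) :=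
      (Continuous.tendsto (by fun_prop) ((x₀, x₀, x₀), s, σ))
    have e4 := (tendsto_matrix_inv e1 ((hΨ x₀).isUnit hΩ).ne_zero).mul e2
    rw [hinv] at e4
    have e5 := e1.mul (tendsto_cayley e3 e4 (by
      rw [← add_smul, show 1 - s + (1 + s) = 2 by ring, Matrix.det_smul, Matrix.det_one]
      positivity))
    rwa [cayley_self, mul_one] at e5
  have key : ∀ᶠ q in 𝓝 (x₀, x₀, x₀), ∀ r ∈ Icc (0 : ℝ) 1 ×ˢ Icc (0 : ℝ) 1,
      (rot Ω ε * W (q, r) - 1).det ≠ 0 ∧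
        (r.2 • ((Ψ q.2.2)⁻¹ * W (q, r)) + (1 - r.2) • (1 : Matrix n n ℝ)).det ≠ 0 := by
    apply (isCompact_Icc.prod isCompact_Icc).eventually_forall_of_forall_eventually
    rintro ⟨s, σ⟩ -
    refine Eventually.and ?_ ?_
    · exact eventually_det_sub_ne_zero (tendsto_const_nhds.mul (hW s σ)) hε
    · have e1 : Tendsto (fun p : (ℝ × ℝ × ℝ) × ℝ × ℝ => Ψ p.1.2.2) (𝓝 ((x₀, x₀, x₀), s, σ))
        (𝓝 (Ψ x₀)) := (hc.comp (by fun_prop)).tendsto ((x₀, x₀, x₀), s, σ)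
      have e3 : Tendsto (fun p : (ℝ × ℝ × ℝ) × ℝ × ℝ => p.2.2) (𝓝 ((x₀, x₀, x₀), s, σ)) (𝓝 σ) :=
        (Continuous.tendsto (by fun_prop) ((x₀, x₀, x₀), s, σ))
      have e4 := (tendsto_matrix_inv e1 ((hΨ x₀).isUnit hΩ).ne_zero).mul (hW s σ)
      rw [hinv] at e4
      have e5 := (e3.smul e4).add ((e3.const_sub 1).smul_const (1 : Matrix n n ℝ))
      rw [← add_smul, add_sub_cancel, one_smul] at e5
      have e6 := (continuous_id.matrix_det.tendsto (1 : Matrix n n ℝ)).comp e5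
      exact e6.eventually (isOpen_ne.mem_nhds (by simp))
  rw [nhds_prod_eq, nhds_prod_eq] at key
  obtain ⟨V₁, h1, V₂, h2, h3⟩ := Filter.eventually_prod_iff.1 key
  obtain ⟨V₃, h4, V₄, h5, h6⟩ := Filter.eventually_prod_iff.1 h2
  obtain ⟨V, hV, hVo, hxV⟩ := _root_.eventually_nhds_iff.1 (h1.and (h4.and h5))
  refine ⟨ε, V, hVo, hxV, fun x hx y hy t ht s hs => ⟨?_, fun σ hσ => ?_⟩⟩
  · exact (h3 (hV x hx).1 (h6 (hV y hy).2.1 (hV t ht).2.2) (s, 0) ⟨hs, by simp⟩).1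
  · exact (h3 (hV x hx).1 (h6 (hV y hy).2.1 (hV t ht).2.2) (s, σ) ⟨hs, hσ⟩).2

end MaslovChart

/-! ### Regular representatives of homotopy classes of paths -/

namespace MaslovChart

open Filter Topology MatrixSignature

variable {n : Type*} [Fintype n] [DecidableEq n] {Ω : Matrix n n ℝ}

/-- The path `rot (h t) * Y t` is a regular approximation of `Ψ` on `[a, x]`, and it is constant from
`x` on. Crossings occur only while `Y` rests and `h` moves with nonzero speed. -/
structure IsStaircase (Ω : Matrix n n ℝ) (Ψ : ℝ → Matrix n n ℝ) (a x : ℝ) (h : ℝ → ℝ)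
    (Y : ℝ → Matrix n n ℝ) : Prop where
  smooth_h : ContDiff ℝ ∞ h
  smooth_Y : ∀ i j, ContDiff ℝ ∞ fun t => Y t i j
  symp : ∀ t, IsSymp Ω (Y t)
  h_left : h a = 0
  Y_left : Y a = Ψ a
  const : ∀ t, x ≤ t → h t = h x ∧ Y t = Ψ x
  noncrossing : (rot Ω (h x) * Ψ x - 1).det ≠ 0
  regular : ∀ t ∈ Icc a x, (rot Ω (h t) * Y t - 1).det = 0 →
    ∃ d, d ≠ 0 ∧ HasDerivAt h d t ∧ ∀ i j, HasDerivAt (fun t => Y t i j) 0 t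
  close : ∀ t ∈ Icc a x, (Ψ t)⁻¹ * Y t ∈ invSegment n

lemma one_mem_invSegment : (1 : Matrix n n ℝ) ∈ invSegment n := by
  intro s _
  rw [← add_smul, add_sub_cancel, one_smul, Matrix.det_one]
  exact one_ne_zero

/-- The smooth step from `0` at `x` to `1` at `x + δ`. -/
def step (x δ t : ℝ) : ℝ := Real.smoothTransition ((t - x) / δ)

section Step

variable {x δ t : ℝ}

lemma contDiff_step : ContDiff ℝ ∞ (step x δ) :=
  Real.smoothTransition.contDiff.comp ((contDiff_id.sub contDiff_const).div_const δ)

lemma step_mem : step x δ t ∈ Icc (0 : ℝ) 1 :=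
  ⟨Real.smoothTransition.nonneg _, Real.smoothTransition.le_one _⟩

lemma step_eq_zero (hδ : 0 < δ) (ht : t ≤ x) : step x δ t = 0 :=
  Real.smoothTransition.zero_of_nonpos (div_nonpos_of_nonpos_of_nonneg (by linarith) hδ.le)

lemma step_eq_one (hδ : 0 < δ) (ht : x + δ ≤ t) : step x δ t = 1 :=
  Real.smoothTransition.one_of_one_le ((one_le_div hδ).2 (by linarith))

lemma exists_hasDerivAt_step (hδ : 0 < δ) (h1 : x < t) (h2 : t < x + δ) :
    ∃ d, 0 < d ∧ HasDerivAt (step x δ) d t := by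
  obtain ⟨d, hd, h⟩ := exists_hasDerivAt_smoothTransition (x := (t - x) / δ)
    (div_pos (by linarith) hδ) ((div_lt_one hδ).2 (by linarith))
  refine ⟨d * (1 / δ), by positivity, ?_⟩
  exact h.comp t (((hasDerivAt_id t).sub_const x).div_const δ)

end Step

/-- A staircase with a single vertical step, in case `Ψ` is constant on `[a, x]`. The step begins
in the middle of a smooth transition, so that `h` has positive derivative at `a`. -/
lemma exists_isStaircase_left (hΩ : IsCompatible Ω) {Ψ : ℝ → Matrix n n ℝ}
    (hΨ : ∀ t, IsSymp Ω (Ψ t)) {a x : ℝ} (hax : a < x) (hconst : ∀ t ∈ Icc a x, Ψ t = Ψ a) :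
    ∃ h Y, IsStaircase Ω Ψ a x h Y := by
  obtain ⟨ε, hε, hε0⟩ := ((eventually_det_rot_mul_sub_one_ne_zero hΩ (hΨ a)).and
    self_mem_nhdsWithin).exists
  have hε0 : 0 < ε := hε0
  set δ := x - a with hδdef
  have hδ : 0 < δ := by rw [hδdef]; linarith
  have hx : Ψ x = Ψ a := hconst x (right_mem_Icc.2 hax.le)
  have h1 : ∀ t, x ≤ t → step (a - δ) (2 * δ) t = 1 := fun t ht =>
    step_eq_one (by positivity) (by rw [hδdef]; linarith)
  refine ⟨fun t => ε * (2 * step (a - δ) (2 * δ) t - 1), fun _ => Ψ a, ?_⟩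
  constructor
  · exact contDiff_const.mul ((contDiff_const.mul contDiff_step).sub contDiff_const)
  · exact fun i j => contDiff_const
  · exact fun _ => hΨ a
  · have : (a - (a - δ)) / (2 * δ) = 1 / 2 := by field_simp; ring
    simp only [step, this, smoothTransition_half]
    ring
  · rfl
  · intro t ht
    rw [h1 t ht, h1 x le_rfl]
    exact ⟨rfl, hx.symm⟩
  · rw [h1 x le_rfl, hx]
    norm_num
    exact hε
  · intro t ht hdet
    have htx : t < x := by
      by_contra hle
      rw [h1 t (not_lt.1 hle)] at hdet
      norm_num at hdet
      exact hε hdet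
    obtain ⟨d, hd, hderiv⟩ := exists_hasDerivAt_step (x := a - δ) (δ := 2 * δ) (t := t)
      (by positivity) (by linarith [ht.1]) (by rw [hδdef]; linarith)
    refine ⟨ε * (2 * d), by positivity, ?_, fun i j => hasDerivAt_const _ _⟩
    exact ((hderiv.const_mul 2).sub_const 1).const_mul ε
  · intro t ht
    rw [hconst t ht, Matrix.nonsing_inv_mul _ ((hΨ a).isUnit hΩ)]
    exact one_mem_invSegment

/-- A staircase is prolonged by a vertical step to a level `ε` that is safe for the Cayley path from
`Ψ x` to `Ψ y`, followed by this Cayley path. -/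
lemma IsStaircase.exists_prolong (hΩ : IsCompatible Ω) {Ψ : ℝ → Matrix n n ℝ}
    (hΨ : ∀ t, IsSymp Ω (Ψ t)) {a x y ε : ℝ} {h : ℝ → ℝ} {Y : ℝ → Matrix n n ℝ}
    (H : IsStaircase Ω Ψ a x h Y) (hax : a ≤ x) (hxy : x < y)
    (hs : ∀ t ∈ Icc x y, ∀ s ∈ Icc (0 : ℝ) 1,
      (rot Ω ε * (Ψ x * cayley s ((Ψ x)⁻¹ * Ψ y)) - 1).det ≠ 0 ∧
        (Ψ t)⁻¹ * (Ψ x * cayley s ((Ψ x)⁻¹ * Ψ y)) ∈ invSegment n) :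
    ∃ h Y, IsStaircase Ω Ψ a y h Y := by
  set Z := (Ψ x)⁻¹ * Ψ y with hZdef
  set δ := (y - x) / 2 with hδdef
  have hδ : 0 < δ := by rw [hδdef]; linarith
  have hux := (hΨ x).isUnit hΩ
  have hxI : x ∈ Icc x y := left_mem_Icc.2 hxy.le
  have h01 : (0 : ℝ) ∈ Icc (0 : ℝ) 1 := ⟨le_rfl, zero_le_one⟩
  have h11 : (1 : ℝ) ∈ Icc (0 : ℝ) 1 := ⟨zero_le_one, le_rfl⟩
  have hZ : Z ∈ invSegment n := by
    have := (hs x hxI 1 h11).2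
    rwa [cayley_one, ← mul_assoc, Matrix.nonsing_inv_mul _ hux, one_mul] at this
  have hZs : IsSymp Ω Z := ((hΨ x).inv hΩ).mul (hΨ y)
  have hZy : Ψ x * Z = Ψ y := by
    rw [hZdef, ← mul_assoc, Matrix.mul_nonsing_inv _ hux, one_mul]
  let σ₁ := step x δ
  let σ₂ := step (x + δ) δ
  let h' : ℝ → ℝ := fun t => h t + (ε - h x) * σ₁ t
  let Y' : ℝ → Matrix n n ℝ := fun t => Y t * cayley (σ₂ t) Z
  have hσ₁0 : ∀ t, t ≤ x → σ₁ t = 0 := fun t ht => step_eq_zero hδ ht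
  have hσ₁1 : ∀ t, x + δ ≤ t → σ₁ t = 1 := fun t ht => step_eq_one hδ ht
  have hσ₂0 : ∀ t, t ≤ x + δ → σ₂ t = 0 := fun t ht => step_eq_zero hδ ht
  have hσ₂1 : ∀ t, y ≤ t → σ₂ t = 1 := fun t ht => step_eq_one hδ (by rw [hδdef]; linarith)
  have hh_old : ∀ t, t ≤ x → h' t = h t := fun t ht => by simp [h', hσ₁0 t ht]
  have hY_old : ∀ t, t ≤ x + δ → Y' t = Y t := fun t ht => by
    simp [Y', hσ₂0 t ht, cayley_zero hZ]
  have hh_late : ∀ t, x + δ ≤ t → h' t = ε := fun t ht => by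
    simp [h', hσ₁1 t ht, (H.const t (by linarith)).1]
  have hY_late : ∀ t, x ≤ t → Y' t = Ψ x * cayley (σ₂ t) Z := fun t ht => by
    simp [Y', (H.const t ht).2]
  refine ⟨h', Y', ?_⟩
  constructor
  · exact H.smooth_h.add (contDiff_const.mul contDiff_step)
  · intro i j
    rw [contDiff_iff_contDiffAt]
    intro t
    exact contDiffAt_mul_apply (fun i j => (H.smooth_Y i j).contDiffAt)
      (fun i j => contDiffAt_cayley_apply hZ contDiff_step.contDiffAt step_mem i j) i j
  · exact fun t => (H.symp t).mul (isSymp_cayley hZs hZ step_mem)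
  · rw [hh_old a hax, H.h_left]
  · rw [hY_old a (by linarith), H.Y_left]
  · intro t ht
    have hxd : x + δ ≤ y := by rw [hδdef]; linarith
    rw [hh_late t (by linarith), hh_late y hxd, hY_late t (by linarith), hσ₂1 t ht, cayley_one]
    exact ⟨rfl, hZy⟩
  · rw [hh_late y (by rw [hδdef]; linarith)]
    have := (hs x hxI 1 h11).1
    rwa [cayley_one, hZy] at this
  · intro t ht hdet
    rcases lt_or_ge t x with htx | htx
    · rw [hh_old t htx.le, hY_old t (by linarith)] at hdet
      obtain ⟨d, hd, h1, h2⟩ := H.regular t ⟨ht.1, htx.le⟩ hdet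
      refine ⟨d, hd, h1.congr_of_eventuallyEq ?_, fun i j => (h2 i j).congr_of_eventuallyEq ?_⟩
      · filter_upwards [gt_mem_nhds htx] with r hr using hh_old r hr.le
      · filter_upwards [gt_mem_nhds htx] with r hr
        rw [hY_old r (by linarith)]
    rcases lt_or_ge t (x + δ) with htd | htd
    · rw [hY_old t htd.le, (H.const t htx).2] at hdet
      have hne : ε - h x ≠ 0 := by
        intro h0
        have : h' t = h x := by simp [h', h0, (H.const t htx).1]
        rw [this] at hdet
        exact H.noncrossing hdet
      have htx' : x < t := by
        refine lt_of_le_of_ne htx ?_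
        rintro rfl
        rw [hh_old x le_rfl] at hdet
        exact H.noncrossing hdet
      obtain ⟨d, hd, hder⟩ := exists_hasDerivAt_step hδ htx' htd
      refine ⟨(ε - h x) * d, mul_ne_zero hne hd.ne', ?_, fun i j => ?_⟩
      · have h1 : HasDerivAt (fun r => h x + (ε - h x) * σ₁ r) ((ε - h x) * d) t :=
          (hder.const_mul _).const_add _
        refine h1.congr_of_eventuallyEq ?_
        filter_upwards [lt_mem_nhds htx'] with r hr
        simp only [h', (H.const r hr.le).1]
      · refine (hasDerivAt_const t (Ψ x i j)).congr_of_eventuallyEq ?_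
        filter_upwards [lt_mem_nhds htx', gt_mem_nhds htd] with r hr hr'
        rw [hY_old r hr'.le, (H.const r hr.le).2]
    · rw [hh_late t htd, hY_late t htx] at hdet
      exact absurd hdet (hs x hxI _ step_mem).1
  · intro t ht
    rcases lt_or_ge t x with htx | htx
    · rw [hY_old t (by linarith)]
      exact H.close t ⟨ht.1, htx.le⟩
    · rw [hY_late t htx]
      exact (hs t ⟨htx, ht.2⟩ _ step_mem).2

lemma exists_isStaircase (hΩ : IsCompatible Ω) {Ψ : ℝ → Matrix n n ℝ} (hc : Continuous Ψ)
    (hΨ : ∀ t, IsSymp Ω (Ψ t)) {a x b : ℝ} (hax : a < x) (hxb : x ≤ b)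
    (hconst : ∀ t ∈ Icc a x, Ψ t = Ψ a) : ∃ h Y, IsStaircase Ω Ψ a b h Y := by
  choose ε V hVo hxV hV using exists_rot_nhds hΩ hc hΨ
  obtain ⟨t, ht0, htm, ⟨m, hm⟩, htV⟩ := exists_monotone_Icc_subset_open_cover_Icc hxb
    (c := fun z : ℝ => Subtype.val ⁻¹' V z) (fun z => (hVo z).preimage continuous_subtype_val)
    (fun z _ => mem_iUnion.2 ⟨z, hxV z⟩)
  have key : ∀ k, ∃ h Y, IsStaircase Ω Ψ a (t k) h Y := by
    intro k
    induction k with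
    | zero => rw [ht0]; exact exists_isStaircase_left hΩ hΨ hax hconst
    | succ k ih =>
      obtain ⟨h, Y, H⟩ := ih
      obtain ⟨z, hz⟩ := htV k
      have hle : t k ≤ t (k + 1) := htm k.le_succ
      rcases hle.eq_or_lt with heq | hlt
      · rw [← heq]; exact ⟨h, Y, H⟩
      · have hmem : ∀ r ∈ Icc (t k : ℝ) (t (k + 1)), r ∈ V z := by
          intro r hr
          have hrI : r ∈ Icc x b := ⟨(t k).2.1.trans hr.1, hr.2.trans (t (k + 1)).2.2⟩
          exact hz (show (⟨r, hrI⟩ : Icc x b) ∈ Icc (t k) (t (k + 1)) from ⟨hr.1, hr.2⟩)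
        have hlt' : (t k : ℝ) < t (k + 1) := hlt
        exact H.exists_prolong hΩ hΨ (hax.le.trans (t k).2.1) hlt' fun r hr =>
          hV z _ (hmem _ (left_mem_Icc.2 hlt'.le)) _ (hmem _ (right_mem_Icc.2 hlt'.le)) r (hmem r hr)
  have := key m
  rwa [hm m le_rfl] at this

/-- If `Ψ` is constant near both ends of `[a, b]`, a staircase can be closed up at the right end. -/
lemma exists_regular_approx (hΩ : IsCompatible Ω) {Ψ : ℝ → Matrix n n ℝ} (hc : Continuous Ψ)
    (hΨ : ∀ t, IsSymp Ω (Ψ t)) {a x y b : ℝ} (hax : a < x) (hxy : x ≤ y) (hyb : y < b)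
    (hleft : ∀ t ∈ Icc a x, Ψ t = Ψ a) (hright : ∀ t ∈ Icc y b, Ψ t = Ψ b) :
    ∃ (h : ℝ → ℝ) (Y : ℝ → Matrix n n ℝ), ContDiff ℝ ∞ h ∧ (∀ i j, ContDiff ℝ ∞ fun t => Y t i j) ∧
      (∀ t, IsSymp Ω (Y t)) ∧ h a = 0 ∧ h b = 0 ∧ Y a = Ψ a ∧ Y b = Ψ b ∧
      (∀ t ∈ Icc a b, (Ψ t)⁻¹ * Y t ∈ invSegment n) ∧
      ∀ t ∈ Icc a b, (rot Ω (h t) * Y t - 1).det = 0 →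
        ∃ d, d ≠ 0 ∧ HasDerivAt h d t ∧ ∀ i j, HasDerivAt (fun t => Y t i j) 0 t := by
  obtain ⟨h, Y, H⟩ := exists_isStaircase hΩ hc hΨ hax hxy hleft
  set δ := b - y with hδdef
  have hδ : 0 < δ := by rw [hδdef]; linarith
  have hyΨ : Ψ y = Ψ b := hright y (left_mem_Icc.2 hyb.le)
  let κ : ℝ → ℝ := fun t => 2 * step y (2 * δ) t
  have hκ0 : ∀ t, t ≤ y → κ t = 0 := fun t ht => by
    have h1 := step_eq_zero (x := y) (δ := 2 * δ) (by positivity) ht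
    simp [κ, h1]
  have hκb : κ b = 1 := by
    have : (b - y) / (2 * δ) = 1 / 2 := by rw [← hδdef]; field_simp
    simp only [κ, step, this, smoothTransition_half]
    ring
  have hold : ∀ t, t ≤ y → h t - h y * κ t = h t := fun t ht => by simp [hκ0 t ht]
  refine ⟨fun t => h t - h y * κ t, Y, ?_, H.smooth_Y, H.symp, ?_, ?_, H.Y_left, ?_, ?_, ?_⟩
  · exact H.smooth_h.sub (contDiff_const.mul (contDiff_const.mul contDiff_step))
  · simp only; rw [hold a (by linarith), H.h_left]
  · simp [hκb, (H.const b hyb.le).1]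
  · rw [(H.const b hyb.le).2, hyΨ]
  · intro t ht
    rcases le_total t y with hty | hty
    · exact H.close t ⟨ht.1, hty⟩
    · rw [(H.const t hty).2, hright t ⟨hty, ht.2⟩, hyΨ,
        Matrix.nonsing_inv_mul _ ((hΨ b).isUnit hΩ)]
      exact one_mem_invSegment
  · intro t ht hdet
    rcases lt_or_ge t y with hty | hty
    · simp only [hold t hty.le] at hdet
      obtain ⟨d, hd, h1, h2⟩ := H.regular t ⟨ht.1, hty.le⟩ hdet
      refine ⟨d, hd, h1.congr_of_eventuallyEq ?_, h2⟩
      filter_upwards [gt_mem_nhds hty] with r hr using hold r hr.le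
    · simp only [(H.const t hty).1, (H.const t hty).2] at hdet
      have hne : h y ≠ 0 := by
        intro h0
        rw [h0, zero_mul, sub_zero] at hdet
        have := H.noncrossing
        rw [h0] at this
        exact this hdet
      have hty' : y < t := by
        refine lt_of_le_of_ne hty ?_
        rintro rfl
        rw [hκ0 y le_rfl, mul_zero, sub_zero] at hdet
        exact H.noncrossing hdet
      obtain ⟨d, hd, hder⟩ := exists_hasDerivAt_step (x := y) (δ := 2 * δ) (t := t) (by positivity)
        hty' (by have := ht.2; rw [hδdef]; linarith)
      refine ⟨-(h y * (2 * d)), neg_ne_zero.2 (mul_ne_zero hne (by positivity)), ?_, fun i j => ?_⟩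
      · have h1 : HasDerivAt (fun r => h y - h y * κ r) (-(h y * (2 * d))) t :=
          ((hder.const_mul 2).const_mul (h y)).const_sub (h y)
        refine h1.congr_of_eventuallyEq ?_
        filter_upwards [lt_mem_nhds hty'] with r hr
        simp only [(H.const r hr.le).1]
      · refine (hasDerivAt_const t (Ψ y i j)).congr_of_eventuallyEq ?_
        filter_upwards [lt_mem_nhds hty'] with r hr
        rw [(H.const r hr.le).2]

end MaslovChart

namespace SympPath

open Filter Topology MatrixSignature MaslovChart

variable {ι : Type*} [Fintype ι] [DecidableEq ι]

/-- Crossings at which `Y` rests and `h` moves are nondegenerate and isolated. -/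
lemma isRegular_rot_mul {h : ℝ → ℝ} {Y : ℝ → Matrix (ι ⊕ ι) (ι ⊕ ι) ℝ} {a b : ℝ} (hab : a < b)
    (hh : ContDiff ℝ ∞ h) (hY : ∀ i j, ContDiff ℝ ∞ fun t => Y t i j)
    (hsymp : ∀ t, IsSymp (J₀ ι) (Y t))
    (hreg : ∀ t ∈ Icc a b, (rot (J₀ ι) (h t) * Y t - 1).det = 0 →
      ∃ d, d ≠ 0 ∧ HasDerivAt h d t ∧ ∀ i j, HasDerivAt (fun t => Y t i j) 0 t) :
    IsRegular (fun t => rot (J₀ ι) (h t) * Y t) a b := by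
  set Φ : ℝ → Matrix (ι ⊕ ι) (ι ⊕ ι) ℝ := fun t => rot (J₀ ι) (h t) * Y t with hΦdef
  have hΦs : ∀ t, IsSymp (J₀ ι) (Φ t) := fun t => (isSymp_rot isCompatible_J₀ _).mul (hsymp t)
  have hsm : ∀ i j, ContDiff ℝ ∞ fun t => Φ t i j := fun i j =>
    contDiff_iff_contDiffAt.2 fun t => contDiffAt_mul_apply
      (fun i j => ((contDiff_rot_apply (J₀ ι) i j).comp hh).contDiffAt)
      (fun i j => (hY i j).contDiffAt) i j
  have hder : ∀ t ∈ Icc a b, IsCrossing Φ t → ∃ d : ℝ, d ≠ 0 ∧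
      ∀ i j, HasDerivAt (fun t => Φ t i j) ((d • (-J₀ ι * Φ t)) i j) t := by
    intro t ht hcr
    obtain ⟨d, hd, h1, h2⟩ := hreg t ht hcr
    refine ⟨d, hd, fun i j => ?_⟩
    have h3 : ∀ k, HasDerivAt (fun t => rot (J₀ ι) (h t) i k * Y t k j)
        ((-J₀ ι * rot (J₀ ι) (h t)) i k * d * Y t k j + rot (J₀ ι) (h t) i k * 0) t := fun k =>
      ((hasDerivAt_rot_apply isCompatible_J₀ (h t) i k).comp t h1).mul (h2 k j)
    have h4 := HasDerivAt.fun_sum (u := Finset.univ) fun k _ => h3 k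
    have h5 : (d • (-J₀ ι * Φ t)) i j = ∑ k,
        ((-J₀ ι * rot (J₀ ι) (h t)) i k * d * Y t k j + rot (J₀ ι) (h t) i k * 0) := by
      rw [hΦdef]
      simp only
      rw [← mul_assoc, Matrix.smul_apply, Matrix.mul_apply, smul_eq_mul, Finset.mul_sum]
      refine Finset.sum_congr rfl fun k _ => ?_
      ring
    rw [h5]
    exact h4
  have hform : ∀ t ∈ Icc a b, IsCrossing Φ t → ∃ d : ℝ, d ≠ 0 ∧ velocity Φ a b t = d • (-J₀ ι * Φ t) ∧
      ∀ x y : fixedSpace Φ t, crossingForm Φ a b t x y = d * ((x : ι ⊕ ι → ℝ) ⬝ᵥ y) := by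
    intro t ht hcr
    obtain ⟨d, hd, h1⟩ := hder t ht hcr
    have hv : velocity Φ a b t = d • (-J₀ ι * Φ t) := by
      ext i j
      exact (h1 i j).hasDerivWithinAt.derivWithin (uniqueDiffOn_Icc hab t ht)
    refine ⟨d, hd, hv, fun x y => ?_⟩
    have hy : Φ t *ᵥ (y : ι ⊕ ι → ℝ) = y := by
      have := mem_fixedSpace.1 y.2
      rwa [Matrix.sub_mulVec, Matrix.one_mulVec, sub_eq_zero] at this
    rw [crossingForm_apply (hΦs t), hv, mul_smul_comm, neg_mul, mul_neg, ← mul_assoc,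
      isCompatible_J₀.sq, neg_mul, neg_neg, one_mul, Matrix.smul_mulVec, hy, dotProduct_smul,
      smul_eq_mul]
  have hdet : ∀ t, IsCrossing Φ t ↔ (Φ t - 1).det = 0 := fun t => Iff.rfl
  have hpos : ∀ {t} (x : fixedSpace Φ t), x ≠ 0 → 0 < (x : ι ⊕ ι → ℝ) ⬝ᵥ x := fun x hx => by
    have hx' : (x : ι ⊕ ι → ℝ) ≠ 0 := by simpa using hx
    exact lt_of_le_of_ne (Finset.sum_nonneg fun i _ => mul_self_nonneg _)
      (Ne.symm (dotProduct_self_eq_zero.not.2 hx'))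
  refine ⟨fun t _ => mem_symplecticGroup_iff.2 (hΦs t), fun i j => (hsm i j).contDiffOn, ?_, ?_⟩
  · by_contra hinf
    obtain ⟨t₀, ht₀, hacc⟩ := Set.Infinite.exists_accPt_of_subset_isCompact hinf isCompact_Icc
      (fun t ht => ht.1)
    rw [accPt_iff_frequently] at hacc
    have hcont : Continuous Φ := continuous_pi fun i => continuous_pi fun j => (hsm i j).continuous
    by_cases hcr : IsCrossing Φ t₀
    · obtain ⟨d, hd, hv, hf⟩ := hform t₀ ht₀ hcr
      obtain ⟨R, hR, hdR⟩ := exists_isCenter isCompatible_J₀ (hΦs t₀)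
      have hA : ∀ i j, HasDerivWithinAt (fun t => Φ t i j) (velocity Φ a b t₀ i j) (Icc a b) t₀ :=
        fun i j => ((hsm i j).differentiable (by simp)
          t₀).differentiableWithinAt.hasDerivWithinAt
      have hg : ∀ x, (crossingForm Φ a b t₀).toQuadraticMap x =
          (x : ι ⊕ ι → ℝ) ⬝ᵥ (J₀ ι * velocity Φ a b t₀) *ᵥ (x : ι ⊕ ι → ℝ) := fun x => by
        rw [LinearMap.BilinMap.toQuadraticMap_apply, crossingForm_apply (hΦs t₀)]
      have hnd : sigPos (crossingForm Φ a b t₀).toQuadraticMap +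
          sigNeg (crossingForm Φ a b t₀).toQuadraticMap = nullity (Φ t₀ - 1) := by
        rcases lt_or_gt_of_ne hd with hneg | hpos'
        · obtain ⟨h1, h2⟩ := sig_of_pos (-(crossingForm Φ a b t₀).toQuadraticMap) fun x hx => by
            rw [neg_apply, LinearMap.BilinMap.toQuadraticMap_apply, hf]
            nlinarith [hpos x hx]
          rw [sigPos_neg] at h1
          rw [sigNeg_neg] at h2
          rw [h1, h2, zero_add]; rfl
        · obtain ⟨h1, h2⟩ := sig_of_pos (crossingForm Φ a b t₀).toQuadraticMap fun x hx => by
            rw [LinearMap.BilinMap.toQuadraticMap_apply, hf]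
            exact mul_pos hpos' (hpos x hx)
          rw [h1, h2, add_zero]; rfl
      have hr := eventually_jump_right isCompatible_J₀ hR ht₀ (fun t _ => hΦs t) hdR hA
        (crossingForm Φ a b t₀).toQuadraticMap hg hnd
      have hl := eventually_jump_left isCompatible_J₀ hR ht₀ (fun t _ => hΦs t) hdR hA
        (crossingForm Φ a b t₀).toQuadraticMap hg hnd
      rw [eventually_nhdsWithin_iff] at hr hl
      refine hacc ?_
      filter_upwards [hr, hl] with t h1 h2
      rintro ⟨h3, h4, h5⟩
      rcases lt_or_gt_of_ne h3 with h6 | h6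
      · exact (h2 ⟨h4, h6⟩).2 h5
      · exact (h1 ⟨h4, h6⟩).2 h5
    · have h1 : ∀ᶠ t in 𝓝 t₀, (Φ t - 1).det ≠ 0 :=
        eventually_det_sub_ne_zero (hcont.tendsto t₀) hcr
      refine hacc ?_
      filter_upwards [h1] with t h1
      rintro ⟨-, -, h2⟩
      exact h1 h2
  · intro t ht hcr
    obtain ⟨d, hd, hv, hf⟩ := hform t ht hcr
    have hself : ∀ x : fixedSpace Φ t, crossingForm Φ a b t x x = 0 → x = 0 := by
      intro x hx
      by_contra hne
      rw [hf] at hx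
      exact (mul_ne_zero hd (hpos x hne).ne') hx
    exact ⟨fun x hx => hself x (hx x), fun x hx => hself x (hx x)⟩

/-- Every continuous path of symplectic matrices is homotopic to a regular one. -/
theorem exists_isRegular_homotopic {Ψ : ℝ → Matrix (ι ⊕ ι) (ι ⊕ ι) ℝ} {a b : ℝ} (hab : a < b)
    (hc : ContinuousOn Ψ (Icc a b)) (hΨ : ∀ t ∈ Icc a b, IsSymp (J₀ ι) (Ψ t)) :
    ∃ Φ, IsRegular Φ a b ∧ HomotopicRelEnds Ψ Φ a b := by
  set δ := (b - a) / 3 with hδdef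
  have hδ : 0 < δ := by rw [hδdef]; linarith
  -- a reparametrization of `[a, b]` that is constant near both ends
  let ρ : ℝ → ℝ := fun t => projIcc a b hab.le (a + 3 * (t - a - δ))
  have hρc : Continuous ρ := continuous_subtype_val.comp (continuous_projIcc.comp (by fun_prop))
  have hρm : ∀ t, ρ t ∈ Icc a b := fun t => (projIcc a b hab.le _).2
  have hρa : ∀ t ∈ Icc a (a + δ), ρ t = a := fun t ht => by
    simp only [ρ]
    rw [projIcc_of_le_left]
    linarith [ht.2]
  have hρb : ∀ t ∈ Icc (b - δ) b, ρ t = b := fun t ht => by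
    simp only [ρ]
    rw [projIcc_of_right_le]
    have h1 := ht.1
    rw [hδdef] at h1 ⊢
    linarith
  have haI : a ∈ Icc a b := left_mem_Icc.2 hab.le
  have hbI : b ∈ Icc a b := right_mem_Icc.2 hab.le
  have hρa' : ρ a = a := hρa a ⟨le_rfl, by linarith⟩
  have hρb' : ρ b = b := hρb b ⟨by linarith, le_rfl⟩
  obtain ⟨h, Y, hh, hY, hYs, ha0, hb0, hYa, hYb, hclose, hreg⟩ := exists_regular_approx
    (Ω := J₀ ι) (Ψ := fun t => Ψ (ρ t)) (a := a) (x := a + δ) (y := b - δ) (b := b)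
    isCompatible_J₀ (hc.comp_continuous hρc hρm) (fun t => hΨ _ (hρm t)) (by linarith)
    (by rw [hδdef]; linarith) (by linarith)
    (fun t ht => by simp only [hρa t ht, hρa']) (fun t ht => by simp only [hρb t ht, hρb'])
  refine ⟨_, isRegular_rot_mul hab hh hY hYs hreg, ?_⟩
  have hmix : ∀ s ∈ Icc (0 : ℝ) 1, ∀ t ∈ Icc a b, (1 - s) * t + s * ρ t ∈ Icc a b := by
    intro s hs t ht
    have := (convex_Icc a b) ht (hρm t) (sub_nonneg.2 hs.2) hs.1 (by ring)
    simpa using this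
  have hYc : Continuous Y := continuous_pi fun i => continuous_pi fun j => (hY i j).continuous
  have hZs : ∀ t, IsSymp (J₀ ι) ((Ψ (ρ t))⁻¹ * Y t) := fun t =>
    ((hΨ _ (hρm t)).inv isCompatible_J₀).mul (hYs t)
  have hinv : ∀ t ∈ Icc a b, (Ψ t)⁻¹ * Ψ t = 1 := fun t ht =>
    Matrix.nonsing_inv_mul _ ((hΨ t ht).isUnit isCompatible_J₀)
  have hinv' : ∀ t ∈ Icc a b, Ψ t * (Ψ t)⁻¹ = 1 := fun t ht =>
    Matrix.mul_nonsing_inv _ ((hΨ t ht).isUnit isCompatible_J₀)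
  refine ⟨fun p => rot (J₀ ι) (p.1 * h p.2) * (Ψ ((1 - p.1) * p.2 + p.1 * ρ p.2) *
    cayley p.1 ((Ψ (ρ p.2))⁻¹ * Y p.2)), ?_, ?_, ?_, ?_⟩
  · have h1 : Continuous fun p : ℝ × ℝ => rot (J₀ ι) (p.1 * h p.2) :=
      (continuous_rot (J₀ ι)).comp (continuous_fst.mul (hh.continuous.comp continuous_snd))
    have h2 : ContinuousOn (fun p : ℝ × ℝ => Ψ ((1 - p.1) * p.2 + p.1 * ρ p.2))
        (Icc 0 1 ×ˢ Icc a b) := by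
      refine hc.comp (Continuous.continuousOn ?_) fun p hp => hmix p.1 hp.1 p.2 hp.2
      exact ((continuous_const.sub continuous_fst).mul continuous_snd).add
        (continuous_fst.mul (hρc.comp continuous_snd))
    refine h1.continuousOn.mul (h2.mul fun p hp => ?_)
    have h3 : Continuous fun p : ℝ × ℝ => Ψ (ρ p.2) :=
      hc.comp_continuous (hρc.comp continuous_snd) fun p => hρm p.2
    refine tendsto_cayley (continuous_fst.continuousAt.continuousWithinAt (s := Icc 0 1 ×ˢ Icc a b))
      ?_ (det_cayley_denom (hclose p.2 hp.2) hp.1)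
    exact (tendsto_matrix_inv (h3.continuousAt.continuousWithinAt (s := Icc 0 1 ×ˢ Icc a b))
      ((hΨ _ (hρm p.2)).isUnit isCompatible_J₀).ne_zero).mul
      (hYc.comp continuous_snd).continuousAt.continuousWithinAt
  · intro s hs t ht
    rw [mem_symplecticGroup_iff]
    exact (isSymp_rot isCompatible_J₀ _).mul ((hΨ _ (hmix s hs t ht)).mul
      (isSymp_cayley (hZs t) (hclose t ht) hs))
  · intro t ht
    constructor
    · simp [rot_zero, cayley_zero (hclose t ht)]
    · simp only [one_mul, sub_self, zero_mul, zero_add, cayley_one]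
      rw [← mul_assoc (Ψ (ρ t)), hinv' _ (hρm t), one_mul]
  · intro s hs
    constructor
    · simp only [ha0, hρa', hYa, hinv a haI, cayley_self, mul_zero, rot_zero, one_mul, mul_one]
      congr 1; ring
    · simp only [hb0, hρb', hYb, hinv b hbI, cayley_self, mul_zero, rot_zero, one_mul, mul_one]
      congr 1; ring

/-- The Conley-Zehnder index of a continuous path of symplectic matrices exists and is unique: it is
half the increment of any lift of the path. -/
theorem hasIndex_iff {Ψ : ℝ → Matrix (ι ⊕ ι) (ι ⊕ ι) ℝ} {a b : ℝ} (hab : a < b)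
    (hc : ContinuousOn Ψ (Icc a b)) (hΨ : ∀ t ∈ Icc a b, IsSymp (J₀ ι) (Ψ t)) {f : ℝ → ℤ}
    (hf : IsLift (J₀ ι) Ψ (Icc a b) f) (r : ℝ) :
    HasIndex Ψ a b r ↔ r = ((f b - f a : ℤ) : ℝ) / 2 := by
  have key : ∀ Φ, IsRegular Φ a b → HomotopicRelEnds Ψ Φ a b →
      crossingSum Φ a b = ((f b - f a : ℤ) : ℝ) / 2 := by
    rintro Φ hΦ ⟨H, hHc, hHs, hH01, hHab⟩
    obtain ⟨g, hg, hsum⟩ := hΦ.exists_isLift hab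
    rw [hsum]
    have h01 : (0 : ℝ) ∈ Icc (0 : ℝ) 1 := ⟨le_rfl, zero_le_one⟩
    rw [lift_increment_eq isCompatible_J₀ hab.le hHc
      (fun s hs t ht => mem_symplecticGroup_iff.1 (hHs s hs t ht))
      (fun s hs => by rw [(hHab s hs).1, (hHab 0 h01).1])
      (fun s hs => by rw [(hHab s hs).2, (hHab 0 h01).2])
      (hf.congr fun t ht => (hH01 t ht).1) (hg.congr fun t ht => (hH01 t ht).2)]
  constructor
  · rintro ⟨Φ, h1, h2, h3⟩
    rw [← h3, key Φ h1 h2]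
  · intro hr
    obtain ⟨Φ, h1, h2⟩ := exists_isRegular_homotopic hab hc hΨ
    exact ⟨Φ, h1, h2, by rw [key Φ h1 h2, hr]⟩

end SympPath

/-! ### The boundary of an ellipsoid and its Reeb flow -/

namespace Ellipsoid

open Filter Topology

variable {m : ℕ}

/-- The standard symplectic form `∑ dx_k ∧ dy_k` on `ℂ^m`. -/
def omega (m : ℕ) : (Fin m → ℂ) →ₗ[ℝ] (Fin m → ℂ) →ₗ[ℝ] ℝ :=
  LinearMap.mk₂ ℝ (fun v w => ∑ k, ((v k).re * (w k).im - (v k).im * (w k).re))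
    (fun v v' w => by rw [← Finset.sum_add_distrib]; congr 1; ext k; simp; ring)
    (fun c v w => by rw [smul_eq_mul, Finset.mul_sum]; congr 1; ext k; simp; ring)
    (fun v w w' => by rw [← Finset.sum_add_distrib]; congr 1; ext k; simp; ring)
    (fun c v w => by rw [smul_eq_mul, Finset.mul_sum]; congr 1; ext k; simp; ring)

lemma omega_apply (v w : Fin m → ℂ) :
    omega m v w = ∑ k, ((v k).re * (w k).im - (v k).im * (w k).re) := rfl

lemma omega_swap (v w : Fin m → ℂ) : omega m v w = -omega m w v := by
  rw [omega_apply, omega_apply, ← Finset.sum_neg_distrib]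
  congr 1; ext k; ring

lemma omega_self (v : Fin m → ℂ) : omega m v v = 0 := by
  have := omega_swap v v
  linarith

lemma continuousOn_omega {X : Type*} [TopologicalSpace X] {S : Set X} {f g : X → Fin m → ℂ}
    (hf : ContinuousOn f S) (hg : ContinuousOn g S) :
    ContinuousOn (fun x => omega m (f x) (g x)) S := by
  simp only [omega_apply]
  have hf' := continuousOn_pi.1 hf
  have hg' := continuousOn_pi.1 hg
  exact continuousOn_finsetSum _ fun k _ =>
    ((Complex.continuous_re.comp_continuousOn (hf' k)).mul
      (Complex.continuous_im.comp_continuousOn (hg' k))).sub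
    ((Complex.continuous_im.comp_continuousOn (hf' k)).mul
      (Complex.continuous_re.comp_continuousOn (hg' k)))

lemma omega_single (v : Fin m → ℂ) (k : Fin m) (c : ℂ) :
    omega m v (Pi.single k c) = (v k).re * c.im - (v k).im * c.re := by
  rw [omega_apply, Finset.sum_eq_single k]
  · simp
  · intro l _ hl; simp [hl]
  · simp

lemma eq_of_omega_eq {v w : Fin m → ℂ} (h : ∀ x, omega m v x = omega m w x) : v = w := by
  ext k
  have h1 := h (Pi.single k 1)
  have h2 := h (Pi.single k Complex.I)
  rw [omega_single, omega_single] at h1 h2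
  apply Complex.ext
  · simpa using h2
  · simpa using h1

lemma liouvilleForm_apply (p v : Fin m → ℂ) :
    liouvilleForm m p ![v] = omega m p v / 2 := by
  rw [omega_apply, Finset.sum_div]
  simp only [liouvilleForm, ContinuousAlternatingMap.ofSubsingleton_apply_apply, dx, dy]
  simp only [sum_apply]
  refine Finset.sum_congr rfl fun k _ => ?_
  simp
  ring

lemma extDeriv_liouvilleForm (p v w : Fin m → ℂ) :
    extDeriv (liouvilleForm m) p ![v, w] = omega m v w := by
  let L : (Fin m → ℂ) →ₗ[ℝ] (Fin m → ℂ) [⋀^Fin 1]→L[ℝ] ℝ :=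
    { toFun := liouvilleForm m
      map_add' := fun x y => by
        ext z
        have hz : z = ![z 0] := by ext i; fin_cases i; rfl
        rw [ContinuousAlternatingMap.add_apply, hz, liouvilleForm_apply, liouvilleForm_apply,
          liouvilleForm_apply, map_add, LinearMap.add_apply]
        ring
      map_smul' := fun c x => by
        ext z
        have hz : z = ![z 0] := by ext i; fin_cases i; rfl
        rw [ContinuousAlternatingMap.smul_apply, hz, liouvilleForm_apply, liouvilleForm_apply,
          map_smul, LinearMap.smul_apply]
        simp
        ring }
  have hL : HasFDerivAt (liouvilleForm m) (LinearMap.toContinuousLinearMap L) p :=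
    (LinearMap.toContinuousLinearMap L).hasFDerivAt
  rw [extDeriv, hL.fderiv, ContinuousAlternatingMap.alternatizeUncurryFin_apply,
    Fin.sum_univ_two]
  have h0 : Fin.removeNth 0 ![v, w] = ![w] := by ext i; fin_cases i; rfl
  have h1 : Fin.removeNth 1 ![v, w] = ![v] := by ext i; fin_cases i; rfl
  rw [h0, h1]
  have e : ∀ x y, (LinearMap.toContinuousLinearMap L) x ![y] = omega m x y / 2 :=
    liouvilleForm_apply
  simp only [Matrix.cons_val_zero, Matrix.cons_val_one, e]
  rw [omega_swap w v]
  simp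
  ring

/-- The function `∑ ‖z_k‖² / a_k`, of which the ellipsoid is a sublevel set. -/
def gauge (a : Fin m → ℝ) (z : Fin m → ℂ) : ℝ := ∑ k, ‖z k‖ ^ 2 / a k

/-- The vector field `(2 i z_k / a_k)_k` on `ℂ^m`, the Hamiltonian vector field of `gauge a`. It
restricts to the Reeb vector field. -/
def reebField (a : Fin m → ℝ) (z : Fin m → ℂ) : Fin m → ℂ := fun k =>
  2 * Complex.I * (((a k)⁻¹ : ℝ) : ℂ) * z k

lemma continuous_reebField (a : Fin m → ℝ) : Continuous (reebField a) :=
  continuous_pi fun k => continuous_const.mul (continuous_apply k)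

lemma gauge_eq (a : Fin m → ℝ) (z : Fin m → ℂ) :
    gauge a z = ∑ k, ((z k).re * (z k).re + (z k).im * (z k).im) / a k := by
  simp only [gauge, ← Complex.normSq_eq_norm_sq, Complex.normSq_apply]

lemma continuous_gauge (a : Fin m → ℝ) : Continuous (gauge a) :=
  continuous_finsetSum _ fun k _ =>
    ((continuous_norm.comp (continuous_apply k)).pow 2).div_const _

lemma reebField_re (a : Fin m → ℝ) (z : Fin m → ℂ) (k : Fin m) :
    (reebField a z k).re = -(2 / a k * (z k).im) := by
  simp only [reebField, div_eq_mul_inv, Complex.mul_re, Complex.mul_im, Complex.re_ofNat,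
    Complex.im_ofNat, Complex.I_re, Complex.I_im, Complex.ofReal_re, Complex.ofReal_im]
  ring

lemma reebField_im (a : Fin m → ℝ) (z : Fin m → ℂ) (k : Fin m) :
    (reebField a z k).im = 2 / a k * (z k).re := by
  simp only [reebField, div_eq_mul_inv, Complex.mul_re, Complex.mul_im, Complex.re_ofNat,
    Complex.im_ofNat, Complex.I_re, Complex.I_im, Complex.ofReal_re, Complex.ofReal_im]
  ring

lemma omega_reebField (a : Fin m → ℝ) (z v : Fin m → ℂ) :
    omega m (reebField a z) v = -∑ k, 2 / a k * ((z k).re * (v k).re + (z k).im * (v k).im) := by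
  rw [omega_apply, ← Finset.sum_neg_distrib]
  refine Finset.sum_congr rfl fun k _ => ?_
  rw [reebField_re, reebField_im]
  ring

lemma omega_self_reebField (a : Fin m → ℝ) (z : Fin m → ℂ) :
    omega m z (reebField a z) = 2 * gauge a z := by
  rw [omega_swap, omega_reebField, neg_neg, gauge_eq, Finset.mul_sum]
  refine Finset.sum_congr rfl fun k _ => ?_
  ring

lemma gauge_smul (a : Fin m → ℝ) (c : ℝ) (z : Fin m → ℂ) : gauge a (c • z) = c ^ 2 * gauge a z := by
  simp only [gauge, Pi.smul_apply, norm_smul, mul_pow, Real.norm_eq_abs, sq_abs, Finset.mul_sum]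
  refine Finset.sum_congr rfl fun k _ => ?_
  ring

/-- The differential of `gauge a` at `z`. -/
def gaugeDeriv (a : Fin m → ℝ) (z : Fin m → ℂ) : (Fin m → ℂ) →L[ℝ] ℝ :=
  -LinearMap.toContinuousLinearMap (omega m (reebField a z))

lemma gaugeDeriv_apply (a : Fin m → ℝ) (z v : Fin m → ℂ) :
    gaugeDeriv a z v = -omega m (reebField a z) v := rfl

lemma hasFDerivAt_gauge (a : Fin m → ℝ) (z : Fin m → ℂ) :
    HasFDerivAt (gauge a) (gaugeDeriv a z) z := by
  have h1 : ∀ k : Fin m, HasFDerivAt (fun z : Fin m → ℂ => (z k).re) (dx k) z := fun k =>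
    (dx k).hasFDerivAt
  have h2 : ∀ k : Fin m, HasFDerivAt (fun z : Fin m → ℂ => (z k).im) (dy k) z := fun k =>
    (dy k).hasFDerivAt
  have h3 := HasFDerivAt.fun_sum (u := Finset.univ) fun k _ =>
    (((h1 k).mul (h1 k)).add ((h2 k).mul (h2 k))).mul_const (1 / a k)
  have h4 : gauge a = fun z => ∑ k, ((z k).re * (z k).re + (z k).im * (z k).im) * (1 / a k) := by
    ext z
    simp only [gauge_eq, div_eq_mul_inv, one_mul]
  rw [h4]
  refine h3.congr_fderiv ?_
  ext v
  rw [gaugeDeriv_apply, omega_reebField, neg_neg, sum_apply]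
  refine Finset.sum_congr rfl fun k _ => ?_
  simp [dx, dy]
  ring

variable {a : Fin m → ℝ}

lemma frontier_ellipsoid (a : Fin m → ℝ) : frontier (ellipsoid a) = {z | gauge a z = 1} := by
  have hE : ellipsoid a = {z | gauge a z ≤ 1} := rfl
  refine Subset.antisymm ?_ fun z hz => ?_
  · rw [hE]
    exact frontier_le_subset_eq (continuous_gauge a) continuous_const
  · have hz' : gauge a z = 1 := hz
    refine ⟨subset_closure (show gauge a z ≤ 1 from hz'.le), fun hint => ?_⟩
    have hcont : Tendsto (fun s : ℝ => s • z) (𝓝[>] 1) (𝓝 z) := by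
      have : ContinuousAt (fun s : ℝ => s • z) 1 := by fun_prop
      have h := this.tendsto
      rw [one_smul] at h
      exact h.mono_left nhdsWithin_le_nhds
    obtain ⟨s, hs, hs1⟩ := ((hcont.eventually (mem_interior_iff_mem_nhds.1 hint)).and
      self_mem_nhdsWithin).exists
    have hs2 : gauge a (s • z) ≤ 1 := hs
    rw [gauge_smul, hz'] at hs2
    have : (1 : ℝ) < s := hs1
    nlinarith

/-- The tangent space of the hypersurface is the kernel of the differential of `gauge a`. -/
lemma tangentConeAt_frontier {z : Fin m → ℂ} (hz : z ∈ frontier (ellipsoid a)) :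
    tangentConeAt ℝ (frontier (ellipsoid a)) z = {v | omega m (reebField a z) v = 0} := by
  have hz1 : gauge a z = 1 := by rwa [frontier_ellipsoid] at hz
  refine Subset.antisymm (fun v hv => ?_) fun v hv => ?_
  · have h1 : HasFDerivWithinAt (gauge a) (gaugeDeriv a z) (frontier (ellipsoid a)) z :=
      (hasFDerivAt_gauge a z).hasFDerivWithinAt
    have h2 : HasFDerivWithinAt (gauge a) (0 : (Fin m → ℂ) →L[ℝ] ℝ)
        (frontier (ellipsoid a)) z := by
      refine (hasFDerivWithinAt_const (1 : ℝ) z _).congr (fun y hy => ?_) hz1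
      rwa [frontier_ellipsoid] at hy
    have h3 := h1.unique_on h2 hv
    rw [gaugeDeriv_apply] at h3
    simpa using h3
  · -- The line `z + t v` is projected radially to the hypersurface.
    have hv0 : omega m (reebField a z) v = 0 := hv
    set c : ℝ → Fin m → ℂ := fun t => z + t • v with hcdef
    have hc0 : c 0 = z := by simp [hcdef]
    have hc : HasDerivAt c v 0 :=
      (((hasDerivAt_id (0 : ℝ)).smul_const v).const_add z).congr_deriv (one_smul ℝ v)
    have hg : HasDerivAt (fun t => gauge a (c t)) 0 0 := by
      have h := (hc0 ▸ hasFDerivAt_gauge a z : HasFDerivAt (gauge a) (gaugeDeriv a z) (c 0))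
      have := h.comp_hasDerivAt (0 : ℝ) hc
      rwa [gaugeDeriv_apply, hv0, neg_zero] at this
    have hg0 : gauge a (c 0) = 1 := by rw [hc0, hz1]
    have hs : HasDerivAt (fun t => (Real.sqrt (gauge a (c t)))⁻¹) 0 0 := by
      have h1 := hg.sqrt (by rw [hg0]; norm_num)
      exact (h1.fun_inv (by rw [hg0]; norm_num)).congr_deriv (by simp)
    have hd : HasDerivAt (fun t => (Real.sqrt (gauge a (c t)))⁻¹ • c t) v 0 := by
      exact (hs.fun_smul hc).congr_deriv (by simp [hg0])
    have hnhds : {t : ℝ | 0 < gauge a (c t)} ∈ 𝓝 (0 : ℝ) := by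
      have : ContinuousAt (fun t => gauge a (c t)) 0 := hg.continuousAt
      exact this.eventually (lt_mem_nhds (show 0 < gauge a (c 0) by rw [hg0]; norm_num))
    have h1 := (hd.hasFDerivAt.hasFDerivWithinAt
      (s := {t : ℝ | 0 < gauge a (c t)})).mapsTo_tangent_cone
    rw [tangentConeAt_of_mem_nhds hnhds] at h1
    have h2 := h1 (mem_univ 1)
    simp only [ContinuousLinearMap.toSpanSingleton_apply, one_smul] at h2
    have h3 : (Real.sqrt (gauge a (c 0)))⁻¹ • c 0 = z := by rw [hg0, hc0]; simp
    rw [h3] at h2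
    refine tangentConeAt_mono ?_ h2
    rintro _ ⟨t, ht, rfl⟩
    have ht' : 0 < gauge a (c t) := ht
    rw [frontier_ellipsoid, mem_ofPred_eq, gauge_smul, inv_pow, Real.sq_sqrt ht'.le,
      inv_mul_cancel₀ ht'.ne']

lemma isReebVector_iff {z v : Fin m → ℂ} (hz : z ∈ frontier (ellipsoid a)) :
    Contact.IsReebVector (frontier (ellipsoid a)) (liouvilleForm m) z v ↔ v = reebField a z := by
  have hz1 : gauge a z = 1 := by rwa [frontier_ellipsoid] at hz
  unfold Contact.IsReebVector
  simp only [tangentConeAt_frontier hz, liouvilleForm_apply, extDeriv_liouvilleForm, mem_ofPred_eq]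
  constructor
  · rintro ⟨-, h2, h3⟩
    refine eq_of_omega_eq fun x => ?_
    -- `z` is transverse to the hypersurface, so `x` can be made tangent by adding a multiple of it.
    have h4 := h3 (x + (omega m (reebField a z) x / 2) • z) (by
      rw [map_add, map_smul, omega_swap _ z, omega_self_reebField, hz1, smul_eq_mul]
      ring)
    rw [map_add, map_smul, omega_swap _ z, smul_eq_mul] at h4
    have h5 : omega m z v = 2 := by linarith
    rw [h5] at h4
    linarith
  · rintro rfl
    refine ⟨omega_self _, ?_, fun w hw => hw⟩
    rw [omega_self_reebField, hz1]
    norm_num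

lemma mem_distribution {z v : Fin m → ℂ} (hz : z ∈ frontier (ellipsoid a)) :
    v ∈ Contact.distribution (frontier (ellipsoid a)) (liouvilleForm m) z ↔
      omega m (reebField a z) v = 0 ∧ omega m z v = 0 := by
  unfold Contact.distribution
  rw [tangentConeAt_frontier hz, mem_sep_iff, liouvilleForm_apply, mem_ofPred_eq]
  simp

/-- The Reeb flow, extended linearly to `ℂ^m`. -/
def flow (a : Fin m → ℝ) (t : ℝ) : (Fin m → ℂ) →L[ℝ] (Fin m → ℂ) :=
  ContinuousLinearMap.pi fun k =>
    Complex.exp (2 * Complex.I * (t / a k : ℝ)) • ContinuousLinearMap.proj k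

lemma flow_apply (a : Fin m → ℝ) (t : ℝ) (z : Fin m → ℂ) (k : Fin m) :
    flow a t z k = Complex.exp (2 * Complex.I * (t / a k : ℝ)) * z k := rfl

lemma norm_flow_factor (x : ℝ) : ‖Complex.exp (2 * Complex.I * (x : ℂ))‖ = 1 := by
  rw [Complex.norm_exp]
  simp

lemma flow_zero (a : Fin m → ℝ) (z : Fin m → ℂ) : flow a 0 z = z := by
  ext k; simp [flow_apply]

lemma gauge_flow (a : Fin m → ℝ) (t : ℝ) (z : Fin m → ℂ) : gauge a (flow a t z) = gauge a z := by
  simp only [gauge, flow_apply, norm_mul, norm_flow_factor, one_mul]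

lemma reebField_flow (a : Fin m → ℝ) (t : ℝ) (z : Fin m → ℂ) :
    reebField a (flow a t z) = flow a t (reebField a z) := by
  ext k; simp only [reebField, flow_apply]; ring

lemma omega_flow (a : Fin m → ℝ) (t : ℝ) (v w : Fin m → ℂ) :
    omega m (flow a t v) (flow a t w) = omega m v w := by
  rw [omega_apply, omega_apply]
  refine Finset.sum_congr rfl fun k _ => ?_
  have key : ∀ c x y : ℂ, (c * x).re * (c * y).im - (c * x).im * (c * y).re =
      Complex.normSq c * (x.re * y.im - x.im * y.re) := fun c x y => by
    simp [Complex.normSq_apply]; ring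
  rw [flow_apply, flow_apply, key, Complex.normSq_eq_norm_sq, norm_flow_factor]
  ring

lemma hasDerivAt_flow (a : Fin m → ℝ) (z : Fin m → ℂ) (t : ℝ) :
    HasDerivAt (fun t => flow a t z) (reebField a (flow a t z)) t := by
  rw [hasDerivAt_pi]
  intro k
  simp only [flow_apply, reebField]
  have h1 : HasDerivAt (fun t : ℝ => ((t / a k : ℝ) : ℂ)) (((a k)⁻¹ : ℝ) : ℂ) t :=
    (((hasDerivAt_id t).div_const (a k)).congr_deriv (one_div _)).ofReal_comp
  have h2 := ((h1.const_mul (2 * Complex.I)).cexp).mul_const (z k)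
  refine h2.congr_deriv ?_
  ring

lemma continuous_flow (a : Fin m → ℝ) (z : Fin m → ℂ) : Continuous fun t => flow a t z :=
  continuous_iff_continuousAt.2 fun t => (hasDerivAt_flow a z t).continuousAt

lemma flow_mem_frontier {z : Fin m → ℂ} (hz : z ∈ frontier (ellipsoid a)) (t : ℝ) :
    flow a t z ∈ frontier (ellipsoid a) := by
  rw [frontier_ellipsoid, mem_ofPred_eq, gauge_flow]
  rwa [frontier_ellipsoid] at hz

lemma isReebTrajectory_flow {z : Fin m → ℂ} (hz : z ∈ frontier (ellipsoid a)) :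
    Contact.IsReebTrajectory (frontier (ellipsoid a)) (liouvilleForm m) fun t => flow a t z :=
  fun t => ⟨flow_mem_frontier hz t, _, (isReebVector_iff (flow_mem_frontier hz t)).2 rfl,
    hasDerivAt_flow a z t⟩

lemma isReebFlow_flow (a : Fin m → ℝ) :
    Contact.IsReebFlow (frontier (ellipsoid a)) (liouvilleForm m) fun t => flow a t :=
  fun z hz => ⟨flow_zero a z, isReebTrajectory_flow hz⟩

/-- Reeb trajectories are determined by their initial values. -/
lemma eq_flow_of_isReebTrajectory {γ : ℝ → Fin m → ℂ}
    (hγ : Contact.IsReebTrajectory (frontier (ellipsoid a)) (liouvilleForm m) γ) (t : ℝ) :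
    γ t = flow a t (γ 0) := by
  have hd : ∀ t, HasDerivAt γ (reebField a (γ t)) t := fun t => by
    obtain ⟨h1, v, h2, h3⟩ := hγ t
    rwa [(isReebVector_iff h1).1 h2] at h3
  ext k
  have h1 : ∀ t : ℝ, HasDerivAt
      (fun t : ℝ => Complex.exp (2 * Complex.I * ((-t / a k : ℝ) : ℂ)) * γ t k) 0 t := by
    intro t
    have h2 : HasDerivAt (fun t : ℝ => ((-t / a k : ℝ) : ℂ)) ((-1 / a k : ℝ) : ℂ) t :=
      ((hasDerivAt_id t).neg.div_const (a k)).ofReal_comp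
    have h3 := ((h2.const_mul (2 * Complex.I)).cexp).mul (hasDerivAt_pi.1 (hd t) k)
    refine h3.congr_deriv ?_
    simp only [reebField, neg_div]
    push_cast
    ring
  have h4 := is_const_of_deriv_eq_zero (fun t => (h1 t).differentiableAt) (fun t => (h1 t).deriv)
    t 0
  rw [flow_apply]
  simp only [neg_zero, zero_div, Complex.ofReal_zero, mul_zero, Complex.exp_zero, one_mul] at h4
  rw [← h4, ← mul_assoc, ← Complex.exp_add]
  have : 2 * Complex.I * ((t / a k : ℝ) : ℂ) + 2 * Complex.I * ((-t / a k : ℝ) : ℂ) = 0 := by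
    push_cast; ring
  rw [this, Complex.exp_zero, one_mul]

/-- The differential of a Reeb flow is the linear map `flow a t`. -/
lemma fderivWithin_reebFlow {σ : ℝ → (Fin m → ℂ) → Fin m → ℂ}
    (hσ : Contact.IsReebFlow (frontier (ellipsoid a)) (liouvilleForm m) σ) {z v : Fin m → ℂ}
    (hz : z ∈ frontier (ellipsoid a)) (hv : omega m (reebField a z) v = 0) (t : ℝ) :
    fderivWithin ℝ (σ t) (frontier (ellipsoid a)) z v = flow a t v := by
  have hσt : ∀ p ∈ frontier (ellipsoid a), σ t p = flow a t p := fun p hp => by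
    have := eq_flow_of_isReebTrajectory (hσ p hp).2 t
    simpa only [(hσ p hp).1] using this
  have h1 : HasFDerivWithinAt (σ t) (flow a t) (frontier (ellipsoid a)) z :=
    (flow a t).hasFDerivWithinAt.congr hσt (hσt z hz)
  refine h1.differentiableWithinAt.hasFDerivWithinAt.unique_on h1 ?_
  rwa [tangentConeAt_frontier hz]

lemma orbit_zero_apply (a : Fin m → ℝ) (j k : Fin m) :
    orbit a j 0 k = if k = j then (Real.sqrt (a j) : ℂ) else 0 := by
  simp [orbit, Pi.single_apply]

lemma orbit_eq_flow (a : Fin m → ℝ) (j : Fin m) (t : ℝ) : orbit a j t = flow a t (orbit a j 0) := by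
  ext k
  rw [flow_apply, orbit_zero_apply, orbit, Pi.single_apply]
  split_ifs with h
  · rw [h, mul_comm]
  · simp

lemma orbit_zero_mem_frontier (ha : ∀ k, 0 < a k) (j : Fin m) :
    orbit a j 0 ∈ frontier (ellipsoid a) := by
  rw [frontier_ellipsoid, mem_ofPred_eq, gauge, Finset.sum_eq_single j]
  · rw [orbit_zero_apply, if_pos rfl, Complex.norm_real, Real.norm_eq_abs, sq_abs,
      Real.sq_sqrt (ha j).le, div_self (ha j).ne']
  · intro k _ hk
    simp [orbit_zero_apply, hk]
  · simp

lemma flow_factor_period (t : ℝ) {b : ℝ} (hb : 0 < b) (n : ℕ) :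
    Complex.exp (2 * Complex.I * ((t + n * (Real.pi * b)) / b : ℝ)) =
      Complex.exp (2 * Complex.I * (t / b : ℝ)) := by
  have : (2 * Complex.I * ((t + n * (Real.pi * b)) / b : ℝ) : ℂ) =
      2 * Complex.I * (t / b : ℝ) + n * (2 * Real.pi * Complex.I) := by
    rw [add_div, mul_div_assoc, mul_div_assoc, div_self hb.ne']
    push_cast
    ring
  rw [this, Complex.exp_add, Complex.exp_nat_mul_two_pi_mul_I, mul_one]

lemma isPeriodicReebOrbit_orbit (ha : ∀ k, 0 < a k) (j : Fin m) {n : ℕ} (hn : 1 ≤ n) :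
    Contact.IsPeriodicReebOrbit (frontier (ellipsoid a)) (liouvilleForm m) (orbit a j)
      (n * (Real.pi * a j)) := by
  have hn' : (0 : ℝ) < n := by exact_mod_cast hn
  refine ⟨mul_pos hn' (mul_pos Real.pi_pos (ha j)), ?_, fun t => ?_⟩
  · have : orbit a j = fun t => flow a t (orbit a j 0) := funext (orbit_eq_flow a j)
    rw [this]
    exact isReebTrajectory_flow (orbit_zero_mem_frontier ha j)
  · simp only [orbit, flow_factor_period t (ha j) n]

lemma isSimpleReebOrbit_orbit (ha : ∀ k, 0 < a k) (j : Fin m) :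
    Contact.IsSimpleReebOrbit (frontier (ellipsoid a)) (liouvilleForm m) (orbit a j)
      (Real.pi * a j) := by
  refine ⟨by simpa using isPeriodicReebOrbit_orbit ha j le_rfl, fun t ht s hs hts => ?_⟩
  have h1 := congrFun hts j
  simp only [orbit, Pi.single_eq_same] at h1
  have h2 : (Real.sqrt (a j) : ℂ) ≠ 0 := by
    exact_mod_cast (Real.sqrt_pos.2 (ha j)).ne'
  obtain ⟨n, hn⟩ := Complex.exp_eq_exp_iff_exists_int.1 (mul_left_cancel₀ h2 h1)
  have h3 : t / a j = s / a j + n * Real.pi := by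
    have h4 := congrArg Complex.im hn
    simp at h4
    linarith
  have h4 : t = s + n * (Real.pi * a j) := by
    have := (ha j).ne'
    field_simp at h3
    linarith
  have hpos := mul_pos Real.pi_pos (ha j)
  have hn1 : n < 1 := by
    by_contra! h
    have : (1 : ℝ) ≤ n := by exact_mod_cast h
    nlinarith [ht.1, ht.2, hs.1, hs.2]
  have hn2 : -1 < n := by
    by_contra! h
    have : (n : ℝ) ≤ -1 := by exact_mod_cast h
    nlinarith [ht.1, ht.2, hs.1, hs.2]
  have : n = 0 := by lia
  rw [h4, this]
  simp

end Ellipsoid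

/-! ### Stabilization of lifts -/

namespace MaslovChart

open Filter Topology MatrixSignature

variable {n k : Type*} [Fintype n] [DecidableEq n] [Fintype k] [DecidableEq k] {Ω : Matrix n n ℝ}
  {Ω' : Matrix k k ℝ}

lemma IsCompatible.fromBlocks (hΩ : IsCompatible Ω) (hΩ' : IsCompatible Ω') :
    IsCompatible (Matrix.fromBlocks Ω 0 0 Ω') where
  transpose := by
    rw [Matrix.fromBlocks_transpose, hΩ.transpose, hΩ'.transpose, Matrix.fromBlocks_neg]
    simp
  sq := by
    rw [Matrix.fromBlocks_multiply, ← Matrix.fromBlocks_one, Matrix.fromBlocks_neg]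
    simp [hΩ.sq, hΩ'.sq]

lemma sgn_fromBlocks_zero (A : Matrix n n ℝ) :
    sgn (Matrix.fromBlocks A 0 0 (0 : Matrix k k ℝ)) = sgn A := by
  have key : ∀ B : Matrix n n ℝ,
      sigPos (quadForm (Matrix.fromBlocks B 0 0 (0 : Matrix k k ℝ))) = sigPos (quadForm B) := by
    intro B
    have h : ∀ x : n ⊕ k → ℝ, quadForm (Matrix.fromBlocks B 0 0 (0 : Matrix k k ℝ)) x =
        quadForm B (x ∘ Sum.inl) := fun x => by
      rw [quadForm_apply, quadForm_apply, Matrix.fromBlocks_mulVec]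
      simp [dotProduct, Fintype.sum_sum_type]
    refine le_antisymm (sigPos_le_of_comp (LinearMap.funLeft ℝ ℝ Sum.inl) fun x => (h x).symm)
      (sigPos_le_of_comp { toFun := fun x => Sum.elim x 0
                           map_add' := fun x y => by ext (i | i) <;> simp
                           map_smul' := fun c x => by ext (i | i) <;> simp } fun x => ?_)
    rw [h]
    rfl
  unfold sgn
  rw [key, ← sigPos_neg, ← sigPos_neg, ← quadForm_neg, ← quadForm_neg, ← key (-A),
    Matrix.fromBlocks_neg]
  simp

lemma fromBlocks_sub_fromBlocks (A A' : Matrix n n ℝ) (B B' : Matrix k k ℝ) :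
    Matrix.fromBlocks A 0 0 B - Matrix.fromBlocks A' 0 0 B' =
      Matrix.fromBlocks (A - A') 0 0 (B - B') := by
  rw [sub_eq_add_neg, Matrix.fromBlocks_neg, Matrix.fromBlocks_add]
  simp [sub_eq_add_neg]

lemma chartForm_fromBlocks {R Φ : Matrix n n ℝ} (hdet : (Φ - R).det ≠ 0) :
    chartForm (Matrix.fromBlocks Ω 0 0 Ω') (Matrix.fromBlocks R 0 0 (-1))
      (Matrix.fromBlocks Φ 0 0 1) = Matrix.fromBlocks (chartForm Ω R Φ) 0 0 0 := by
  have h1 : Matrix.fromBlocks Φ 0 0 1 - Matrix.fromBlocks R 0 0 (-1 : Matrix k k ℝ) =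
      Matrix.fromBlocks (Φ - R) 0 0 ((2 : ℝ) • 1) := by
    rw [fromBlocks_sub_fromBlocks, sub_neg_eq_add, two_smul]
  have h2 : (Matrix.fromBlocks (Φ - R) 0 0 ((2 : ℝ) • (1 : Matrix k k ℝ)))⁻¹ =
      Matrix.fromBlocks (Φ - R)⁻¹ 0 0 ((2⁻¹ : ℝ) • 1) := by
    refine Matrix.inv_eq_right_inv ?_
    rw [Matrix.fromBlocks_multiply, ← Matrix.fromBlocks_one,
      Matrix.mul_nonsing_inv _ (isUnit_iff_ne_zero.2 hdet)]
    simp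
  rw [chartForm, h1, h2, chartForm, ← Matrix.fromBlocks_one, fromBlocks_sub_fromBlocks,
    fromBlocks_sub_fromBlocks, Matrix.fromBlocks_multiply, Matrix.fromBlocks_multiply,
    Matrix.fromBlocks_multiply]
  simp

/-- A lift of a path is also a lift of its sum with a constant identity path. -/
lemma IsLift.fromBlocks {X : Type*} [TopologicalSpace X] {Ψ : X → Matrix n n ℝ} {S : Set X}
    {f : X → ℤ} (hΩ : IsCompatible Ω) (hΩ' : IsCompatible Ω') (hc : ContinuousOn Ψ S)
    (hΨ : ∀ x ∈ S, IsSymp Ω (Ψ x)) (hf : IsLift Ω Ψ S f) :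
    IsLift (Matrix.fromBlocks Ω 0 0 Ω') (fun x => Matrix.fromBlocks (Ψ x) 0 0 1) S f := by
  have hsymp : ∀ {A : Matrix n n ℝ} {B : Matrix k k ℝ}, IsSymp Ω A → IsSymp Ω' B →
      IsSymp (Matrix.fromBlocks Ω 0 0 Ω') (Matrix.fromBlocks A 0 0 B) := fun {A B} hA hB => by
    unfold IsSymp at *
    rw [Matrix.fromBlocks_transpose, Matrix.fromBlocks_multiply, Matrix.fromBlocks_multiply]
    simp [hA, hB]
  have hcont : ContinuousOn (fun x => Matrix.fromBlocks (Ψ x) 0 0 (1 : Matrix k k ℝ)) S := by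
    have : Continuous fun A : Matrix n n ℝ => Matrix.fromBlocks A 0 0 (1 : Matrix k k ℝ) :=
      continuous_id.matrix_fromBlocks continuous_const continuous_const continuous_const
    exact this.comp_continuousOn hc
  have hdet2 : ((-1 : Matrix k k ℝ) - 1).det ≠ 0 := by
    have : (-1 : Matrix k k ℝ) - 1 = (-2 : ℝ) • 1 := by rw [neg_smul, two_smul]; abel
    rw [this, Matrix.det_smul, Matrix.det_one, mul_one]
    exact pow_ne_zero _ (by norm_num)
  refine isLift_of_exists (hΩ.fromBlocks hΩ') hcont (fun x hx => hsymp (hΨ x hx) isSymp_one)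
    fun x hx => ?_
  obtain ⟨R, hR, hd⟩ := exists_isCenter hΩ (hΨ x hx)
  refine ⟨Matrix.fromBlocks R 0 0 (-1), ⟨hsymp hR.symp (by simp [IsSymp]), ?_⟩, ?_, ?_⟩
  · rw [← Matrix.fromBlocks_one, fromBlocks_sub_fromBlocks,
      Matrix.det_fromBlocks_zero₂₁]
    exact mul_ne_zero hR.det_ne_zero hdet2
  · rw [fromBlocks_sub_fromBlocks, Matrix.det_fromBlocks_zero₂₁]
    refine mul_ne_zero hd ?_
    rw [← neg_sub, Matrix.det_neg]
    exact mul_ne_zero (pow_ne_zero _ (by norm_num)) hdet2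
  · filter_upwards [hf x hx R hR hd, eventually_det_sub_ne_zero (hc x hx) hd] with y hy hy'
    rwa [chartForm_fromBlocks hy', chartForm_fromBlocks hd, sgn_fromBlocks_zero,
      sgn_fromBlocks_zero]

lemma exists_isLift_Icc {a b : ℝ} (hab : a ≤ b) {Ψ : ℝ → Matrix n n ℝ} (hΩ : IsCompatible Ω)
    (hc : ContinuousOn Ψ (Icc a b)) (hΨ : ∀ t ∈ Icc a b, IsSymp Ω (Ψ t)) :
    ∃ f, IsLift Ω Ψ (Icc a b) f := by
  obtain ⟨f, hf⟩ := exists_isLift_univ (Ψ := fun t => Ψ (projIcc a b hab t)) hΩ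
    (hc.comp_continuous (continuous_subtype_val.comp continuous_projIcc) fun t => Subtype.coe_prop _)
    fun t => hΨ _ (Subtype.coe_prop _)
  refine ⟨f, (hf.comp (φ := id) continuousOn_id (mapsTo_univ _ (Icc a b))).congr fun t ht => ?_⟩
  simp [projIcc_of_mem hab ht]

end MaslovChart

/-! ### Symplectic frames and the matrices of linear maps between them -/

namespace Ellipsoid

open Filter Topology MatrixSignature MaslovChart SympPath

variable {m : ℕ} {n : Type*} [Fintype n] [DecidableEq n] {Ω : Matrix n n ℝ}

/-- `F` pulls the symplectic form of `ℂ^m` back to the form with matrix `Ω`. -/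
def IsSympFrame (Ω : Matrix n n ℝ) (F : (n → ℝ) →ₗ[ℝ] (Fin m → ℂ)) : Prop :=
  ∀ x y, omega m (F x) (F y) = x ⬝ᵥ Ω *ᵥ y

/-- The matrix `Ω⁻¹ [ω(F e_i, L e_j)]`. It represents `F⁻¹ ∘ L` if `F` is a symplectic frame. -/
def frameMatrix (Ω : Matrix n n ℝ) (F L : (n → ℝ) →ₗ[ℝ] (Fin m → ℂ)) : Matrix n n ℝ :=
  -(Ω * Matrix.of fun i j => omega m (F (Pi.single i 1)) (L (Pi.single j 1)))

variable {F L : (n → ℝ) →ₗ[ℝ] (Fin m → ℂ)}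

lemma eq_sum_smul_single (x : n → ℝ) : x = ∑ j, x j • (Pi.single j 1 : n → ℝ) := by
  simpa using ((Pi.basisFun ℝ n).sum_repr x).symm

lemma omega_frame_mulVec (x : n → ℝ) (G L : (n → ℝ) →ₗ[ℝ] (Fin m → ℂ)) :
    (Matrix.of fun i j => omega m (G (Pi.single i 1)) (L (Pi.single j 1))) *ᵥ x =
      fun i => omega m (G (Pi.single i 1)) (L x) := by
  ext i
  conv_rhs => rw [eq_sum_smul_single x]
  simp only [Matrix.mulVec, dotProduct, Matrix.of_apply, map_sum, map_smul, smul_eq_mul]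
  exact Finset.sum_congr rfl fun j _ => mul_comm _ _

lemma frameMatrix_mulVec (hΩ : IsCompatible Ω) (hF : IsSympFrame Ω F) {x y : n → ℝ}
    (h : L x = F y) : frameMatrix Ω F L *ᵥ x = y := by
  have h1 : (fun i => omega m (F (Pi.single i 1)) (L x)) = Ω *ᵥ y := by
    ext i
    rw [h, hF, single_one_dotProduct]
  rw [frameMatrix, Matrix.neg_mulVec, ← Matrix.mulVec_mulVec, omega_frame_mulVec, h1,
    hΩ.mulVec_mulVec, neg_neg]

lemma frame_frameMatrix_mulVec (hΩ : IsCompatible Ω) (hF : IsSympFrame Ω F) {x : n → ℝ}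
    (h : ∃ y, L x = F y) : F (frameMatrix Ω F L *ᵥ x) = L x := by
  obtain ⟨y, hy⟩ := h
  rw [frameMatrix_mulVec hΩ hF hy, hy]

lemma isSymp_frameMatrix (hΩ : IsCompatible Ω) (hF : IsSympFrame Ω F) (hL : IsSympFrame Ω L)
    (h : ∀ x, ∃ y, L x = F y) : IsSymp Ω (frameMatrix Ω F L) := by
  have key : ∀ x y, x ⬝ᵥ ((frameMatrix Ω F L)ᵀ * Ω * frameMatrix Ω F L) *ᵥ y = x ⬝ᵥ Ω *ᵥ y := by
    intro x y
    rw [mul_assoc, ← Matrix.mulVec_mulVec, Matrix.dotProduct_mulVec, Matrix.vecMul_transpose,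
      ← Matrix.mulVec_mulVec, ← hF, frame_frameMatrix_mulVec hΩ hF (h x),
      frame_frameMatrix_mulVec hΩ hF (h y), hL]
  ext i j
  simpa using key (Pi.single i 1) (Pi.single j 1)

lemma continuousOn_frameMatrix {X : Type*} [TopologicalSpace X] {S : Set X}
    {F L : X → (n → ℝ) →ₗ[ℝ] (Fin m → ℂ)} (hF : ∀ x, ContinuousOn (fun p => F p x) S)
    (hL : ∀ x, ContinuousOn (fun p => L p x) S) :
    ContinuousOn (fun p => frameMatrix Ω (F p) (L p)) S := by
  have h1 : ContinuousOn (fun p => Matrix.of fun i j =>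
      omega m (F p (Pi.single i 1)) (L p (Pi.single j 1))) S :=
    continuousOn_pi.2 fun i => continuousOn_pi.2 fun j =>
      continuousOn_omega (hF (Pi.single i 1)) (hL (Pi.single j 1))
  exact (continuousOn_const.mul h1).neg

lemma IsSympFrame.injective (hΩ : IsCompatible Ω) (hF : IsSympFrame Ω F) :
    Function.Injective F := by
  rw [injective_iff_map_eq_zero]
  intro x hx
  have h := frameMatrix_mulVec (L := F) hΩ hF (x := x) (y := x) rfl
  rw [← frameMatrix_mulVec (L := F) hΩ hF (x := x) (y := 0) (by rw [hx, map_zero]), h]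

/-! ### Frames of the contact distribution -/

/-- `F` is a symplectic frame of the contact distribution at `z`. -/
structure IsContactFrame {ι : Type*} [Fintype ι] [DecidableEq ι] (a : Fin m → ℝ) (z : Fin m → ℂ)
    (F : (ι ⊕ ι → ℝ) →ₗ[ℝ] (Fin m → ℂ)) : Prop where
  symp : IsSympFrame (J₀ ι) F
  reebField : ∀ x, omega m (reebField a z) (F x) = 0
  self : ∀ x, omega m z (F x) = 0

/-- The standard form on the sum of two symplectic vector spaces. -/
def sumForm (ι κ : Type*) [Fintype ι] [DecidableEq ι] [Fintype κ] [DecidableEq κ] :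
    Matrix ((ι ⊕ ι) ⊕ (κ ⊕ κ)) ((ι ⊕ ι) ⊕ (κ ⊕ κ)) ℝ :=
  Matrix.fromBlocks (J₀ ι) 0 0 (J₀ κ)

lemma isCompatible_sumForm (ι κ : Type*) [Fintype ι] [DecidableEq ι] [Fintype κ] [DecidableEq κ] :
    IsCompatible (sumForm ι κ) := isCompatible_J₀.fromBlocks isCompatible_J₀

variable {ι : Type*} [Fintype ι] [DecidableEq ι]

/-- A frame of the contact distribution at `z` is completed to a frame of `ℂ^m` by the symplectic
plane that is spanned by the radial vector `z / 2` and the Reeb vector. -/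
def extendFrame (F : (ι ⊕ ι → ℝ) →ₗ[ℝ] (Fin m → ℂ)) (a : Fin m → ℝ) (z : Fin m → ℂ) :
    ((ι ⊕ ι) ⊕ (Unit ⊕ Unit) → ℝ) →ₗ[ℝ] (Fin m → ℂ) :=
  F ∘ₗ LinearMap.funLeft ℝ ℝ Sum.inl +
    (LinearMap.proj (Sum.inr (Sum.inl ()))).smulRight ((2⁻¹ : ℝ) • z) +
    (LinearMap.proj (Sum.inr (Sum.inr ()))).smulRight (reebField a z)

lemma extendFrame_apply (F : (ι ⊕ ι → ℝ) →ₗ[ℝ] (Fin m → ℂ)) (a : Fin m → ℝ) (z : Fin m → ℂ)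
    (x : (ι ⊕ ι) ⊕ (Unit ⊕ Unit) → ℝ) :
    extendFrame F a z x = F (x ∘ Sum.inl) + x (Sum.inr (Sum.inl ())) • (2⁻¹ : ℝ) • z +
      x (Sum.inr (Sum.inr ())) • reebField a z := rfl

variable {a : Fin m → ℝ} {z : Fin m → ℂ} {G : (ι ⊕ ι → ℝ) →ₗ[ℝ] (Fin m → ℂ)}

lemma dotProduct_J₀ (x y : ι ⊕ ι → ℝ) : x ⬝ᵥ J₀ ι *ᵥ y =
    ∑ i, (x (Sum.inl i) * y (Sum.inr i) - x (Sum.inr i) * y (Sum.inl i)) := by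
  rw [J₀, Matrix.fromBlocks_mulVec]
  simp [dotProduct, Fintype.sum_sum_type, Finset.sum_add_distrib, Matrix.neg_mulVec,
    sub_eq_add_neg]

lemma IsContactFrame.extendFrame (hz : gauge a z = 1) (h : IsContactFrame a z G) :
    IsSympFrame (sumForm ι Unit) (extendFrame G a z) := by
  intro x y
  have h1 : x ⬝ᵥ sumForm ι Unit *ᵥ y = (x ∘ Sum.inl) ⬝ᵥ J₀ ι *ᵥ (y ∘ Sum.inl) +
      (x ∘ Sum.inr) ⬝ᵥ J₀ Unit *ᵥ (y ∘ Sum.inr) := by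
    rw [sumForm, Matrix.fromBlocks_mulVec]
    simp [dotProduct, Fintype.sum_sum_type]
  rw [h1, ← h.symp, dotProduct_J₀ (ι := Unit), extendFrame_apply, extendFrame_apply]
  simp only [map_add, map_smul, LinearMap.add_apply, LinearMap.smul_apply, omega_swap (G _) z,
    omega_swap (G _) (Ellipsoid.reebField a z), h.reebField, h.self, omega_self,
    omega_swap (Ellipsoid.reebField a z) z, omega_self_reebField, hz, smul_eq_mul, Finset.univ_unique,
    Finset.sum_singleton, Function.comp_apply]
  simp only [PUnit.default_eq_unit]
  ring

variable {d : ℕ} {G : (Fin d ⊕ Fin d → ℝ) →ₗ[ℝ] (Fin m → ℂ)}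

lemma IsContactFrame.extendFrame_surjective (hd : m = d + 1) (hz : gauge a z = 1)
    (h : IsContactFrame a z G) : Function.Surjective (Ellipsoid.extendFrame G a z) := by
  refine (LinearMap.injective_iff_surjective_of_finrank_eq_finrank ?_).1
    ((h.extendFrame hz).injective (isCompatible_sumForm _ _))
  rw [Module.finrank_pi, Module.finrank_pi_fintype]
  simp [Complex.finrank_real_complex, hd]
  ring

/-- By dimension, a contact frame is onto. -/
lemma IsContactFrame.exists_eq (hd : m = d + 1) (hz : gauge a z = 1)
    (h : IsContactFrame a z G) {v : Fin m → ℂ} (h1 : omega m (Ellipsoid.reebField a z) v = 0)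
    (h2 : omega m z v = 0) : ∃ x, v = G x := by
  obtain ⟨x, rfl⟩ := h.extendFrame_surjective hd hz v
  rw [extendFrame_apply] at h1 h2 ⊢
  simp only [map_add, map_smul, h.reebField, h.self, omega_self, omega_self_reebField, hz,
    omega_swap (Ellipsoid.reebField a z) z, smul_eq_mul] at h1 h2
  have h3 : x (Sum.inr (Sum.inl ())) = 0 := by linarith
  have h4 : x (Sum.inr (Sum.inr ())) = 0 := by linarith
  exact ⟨x ∘ Sum.inl, by rw [h3, h4]; simp⟩

lemma isContactFrame_of_isDiskTrivialization {u : ℂ → Fin m → ℂ}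
    {T : ℂ → (ι ⊕ ι → ℝ) →L[ℝ] (Fin m → ℂ)} {γ : ℝ → Fin m → ℂ} {c : ℝ}
    (hu : Contact.IsCappingDisk (frontier (ellipsoid a)) γ c u)
    (hT : Contact.IsDiskTrivialization (frontier (ellipsoid a)) (liouvilleForm m) u T) {w : ℂ}
    (hw : w ∈ Metric.closedBall (0 : ℂ) 1) : IsContactFrame a (u w) (T w).toLinearMap := by
  obtain ⟨h1, h2⟩ := hT.2 w hw
  have h3 : ∀ x, _ := fun x => (mem_distribution (hu.2.1 hw)).1 (h1 ▸ mem_range_self x)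
  exact ⟨fun x y => by rw [← extDeriv_liouvilleForm (u w)]; exact h2 x y, fun x => (h3 x).1,
    fun x => (h3 x).2⟩

lemma isDiskTrivialization_of_isContactFrame (hd : m = d + 1) {u : ℂ → Fin m → ℂ}
    {T : ℂ → (Fin d ⊕ Fin d → ℝ) →L[ℝ] (Fin m → ℂ)}
    (hu : MapsTo u (Metric.closedBall 0 1) (frontier (ellipsoid a)))
    (hT : ∀ x, ContinuousOn (fun w => T w x) (Metric.closedBall 0 1))
    (h : ∀ w ∈ Metric.closedBall (0 : ℂ) 1, IsContactFrame a (u w) (T w).toLinearMap) :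
    Contact.IsDiskTrivialization (frontier (ellipsoid a)) (liouvilleForm m) u T := by
  refine ⟨continuousOn_clm_apply.2 hT, fun w hw => ⟨?_, fun x y => ?_⟩⟩
  · have hz : gauge a (u w) = 1 := by
      have := hu hw
      rwa [frontier_ellipsoid] at this
    ext v
    rw [mem_distribution (hu hw)]
    constructor
    · rintro ⟨x, rfl⟩
      exact ⟨(h w hw).reebField x, (h w hw).self x⟩
    · rintro ⟨h1, h2⟩
      obtain ⟨x, hx⟩ := (h w hw).exists_eq hd hz h1 h2
      exact ⟨x, hx.symm⟩
  · rw [extDeriv_liouvilleForm]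
    exact (h w hw).symp x y

/-! ### A capping disk and a capping trivialization -/

lemma exists_equiv_option (j : Fin m) : ∃ e : Fin m ≃ Option (Fin (m - 1)), e j = none := by
  obtain ⟨d, rfl⟩ : ∃ d, m = d + 1 := ⟨m - 1, by have := j.2; lia⟩
  exact ⟨finSuccEquiv' j, finSuccEquiv'_at j⟩

/-- The `l`-th of the complex coordinates `x_i + i y_i` of a vector of `ℝ^{2d}`, for an enumeration
`e` of the index set `Option (Fin d)`; the coordinate with index `none` is zero. -/
def complexCoord (e : Fin m ≃ Option (Fin d)) (x : Fin d ⊕ Fin d → ℝ) (l : Fin m) : ℂ :=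
  (e l).elim 0 fun i => ⟨x (Sum.inl i), x (Sum.inr i)⟩

/-- The length of the vector `(z_j, z_k)`. -/
def planeNorm (j k : Fin m) (z : Fin m → ℂ) : ℝ := Real.sqrt (‖z j‖ ^ 2 + ‖z k‖ ^ 2)

/-- If `z` is in the plane of the coordinates `j` and `k`, then the vector
`(-conj z_k, conj z_j) / |z|` of this plane and the remaining coordinate vectors are a unitary basis
of the orthogonal complement of `z`. -/
def planeFrame (e : Fin m ≃ Option (Fin d)) (j k : Fin m) (z : Fin m → ℂ) :
    (Fin d ⊕ Fin d → ℝ) →ₗ[ℝ] (Fin m → ℂ) where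
  toFun x l := if l = j then -(starRingEnd ℂ (z k) / planeNorm j k z) * complexCoord e x k
    else if l = k then starRingEnd ℂ (z j) / planeNorm j k z * complexCoord e x k
    else complexCoord e x l
  map_add' x y := by
    have h : ∀ l, complexCoord e (x + y) l = complexCoord e x l + complexCoord e y l := fun l => by
      unfold complexCoord
      cases e l <;> simp [Complex.ext_iff]
    ext l
    simp only [h, Pi.add_apply]
    split_ifs <;> ring
  map_smul' c x := by
    have h : ∀ l, complexCoord e (c • x) l = c * complexCoord e x l := fun l => by
      unfold complexCoord
      cases e l <;> simp [Complex.ext_iff]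
    ext l
    simp only [h, Pi.smul_apply, RingHom.id_apply, Complex.real_smul]
    split_ifs <;> ring

lemma planeFrame_apply (e : Fin m ≃ Option (Fin d)) (j k : Fin m) (z : Fin m → ℂ)
    (x : Fin d ⊕ Fin d → ℝ) (l : Fin m) : planeFrame e j k z x l =
    if l = j then -(starRingEnd ℂ (z k) / planeNorm j k z) * complexCoord e x k
    else if l = k then starRingEnd ℂ (z j) / planeNorm j k z * complexCoord e x k
    else complexCoord e x l := rfl

lemma omega_planeFrame {e : Fin m ≃ Option (Fin d)} {j k : Fin m} (hej : e j = none) (hjk : k ≠ j)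
    {z : Fin m → ℂ} (hN : planeNorm j k z ≠ 0) : IsSympFrame (J₀ (Fin d)) (planeFrame e j k z) := by
  intro x y
  set t : Fin m → ℝ := fun l => (complexCoord e x l).re * (complexCoord e y l).im -
    (complexCoord e x l).im * (complexCoord e y l).re with ht
  have htj : t j = 0 := by simp [ht, complexCoord, hej]
  have hunit : ‖z j‖ ^ 2 / planeNorm j k z ^ 2 + ‖z k‖ ^ 2 / planeNorm j k z ^ 2 = 1 := by
    rw [← add_div, planeNorm, Real.sq_sqrt (by positivity), div_self]
    intro h0
    rw [planeNorm, h0, Real.sqrt_zero] at hN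
    exact hN rfl
  have key : ∀ c v w : ℂ, (c * v).re * (c * w).im - (c * v).im * (c * w).re =
      Complex.normSq c * (v.re * w.im - v.im * w.re) := fun c v w => by
    simp [Complex.normSq_apply]; ring
  have hn : ∀ v : ℂ, Complex.normSq (starRingEnd ℂ v / planeNorm j k z) =
      ‖v‖ ^ 2 / planeNorm j k z ^ 2 := fun v => by
    rw [Complex.normSq_div, Complex.normSq_conj, Complex.normSq_ofReal,
      Complex.normSq_eq_norm_sq, sq (planeNorm j k z)]
  have h1 : ∀ l, (planeFrame e j k z x l).re * (planeFrame e j k z y l).im -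
      (planeFrame e j k z x l).im * (planeFrame e j k z y l).re =
      t l + (if l = j then ‖z k‖ ^ 2 / planeNorm j k z ^ 2 * t k else 0) +
        (if l = k then (‖z j‖ ^ 2 / planeNorm j k z ^ 2 - 1) * t k else 0) := by
    intro l
    simp only [planeFrame_apply]
    by_cases hl : l = j
    · subst hl
      rw [if_pos rfl, if_pos rfl, if_pos rfl, if_neg hjk.symm, key, Complex.normSq_neg, hn, htj]
      simp only [ht]
      ring
    · by_cases hl' : l = k
      · subst hl'
        rw [if_neg hl, if_neg hl, if_neg hl, if_pos rfl, if_pos rfl, if_pos rfl, key, hn]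
        simp only [ht]
        ring
      · simp [hl, hl', ht]
  have h2 : ∑ l, t l = x ⬝ᵥ J₀ (Fin d) *ᵥ y := by
    rw [dotProduct_J₀, ← Equiv.sum_comp e.symm, Fintype.sum_option]
    have : e.symm none = j := by rw [← hej, e.symm_apply_apply]
    rw [this, htj, zero_add]
    refine Finset.sum_congr rfl fun i _ => ?_
    simp [ht, complexCoord]
  rw [omega_apply, Finset.sum_congr rfl fun l _ => h1 l, Finset.sum_add_distrib,
    Finset.sum_add_distrib, h2, Finset.sum_ite_eq' Finset.univ j, Finset.sum_ite_eq' Finset.univ k]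
  simp only [Finset.mem_univ, if_true]
  linear_combination t k * hunit

lemma omega_self_planeFrame {e : Fin m ≃ Option (Fin d)} {j k : Fin m} (hjk : k ≠ j)
    {z : Fin m → ℂ} (hz : ∀ l, l ≠ j → l ≠ k → z l = 0) (x : Fin d ⊕ Fin d → ℝ) :
    omega m z (planeFrame e j k z x) = 0 := by
  set s : ℂ := starRingEnd ℂ (z j) * starRingEnd ℂ (z k) / planeNorm j k z * complexCoord e x k
  have key : ∀ v w : ℂ, v.re * w.im - v.im * w.re = (starRingEnd ℂ v * w).im := fun v w => by
    simp [Complex.mul_im]; ring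
  have h1 : ∀ l, (z l).re * (planeFrame e j k z x l).im - (z l).im * (planeFrame e j k z x l).re =
      (if l = j then -s.im else 0) + (if l = k then s.im else 0) := by
    intro l
    rw [key, planeFrame_apply]
    by_cases hl : l = j
    · subst hl
      rw [if_pos rfl, if_pos rfl, if_neg hjk.symm, add_zero, ← Complex.neg_im]
      congr 1
      simp only [s]
      ring
    · by_cases hl' : l = k
      · subst hl'
        rw [if_neg hl, if_neg hl, if_pos rfl, if_pos rfl, zero_add]
        congr 1
        simp only [s]
        ring
      · simp [hl, hl', hz l hl hl']
  rw [omega_apply, Finset.sum_congr rfl fun l _ => h1 l, Finset.sum_add_distrib,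
    Finset.sum_ite_eq' Finset.univ j, Finset.sum_ite_eq' Finset.univ k]
  simp

/-- The projection of `planeFrame` along `z` to the contact distribution. -/
def planeContactFrame (a : Fin m → ℝ) (e : Fin m ≃ Option (Fin d)) (j k : Fin m) (z : Fin m → ℂ) :
    (Fin d ⊕ Fin d → ℝ) →ₗ[ℝ] (Fin m → ℂ) :=
  planeFrame e j k z +
    ((2⁻¹ : ℝ) • omega m (reebField a z) ∘ₗ planeFrame e j k z).smulRight z

lemma planeContactFrame_apply (e : Fin m ≃ Option (Fin d)) (j k : Fin m) (z : Fin m → ℂ)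
    (x : Fin d ⊕ Fin d → ℝ) : planeContactFrame a e j k z x = planeFrame e j k z x +
      (2⁻¹ * omega m (reebField a z) (planeFrame e j k z x)) • z := rfl

lemma isContactFrame_planeContactFrame {e : Fin m ≃ Option (Fin d)} {j k : Fin m} (hej : e j = none)
    (hjk : k ≠ j) (hz1 : gauge a z = 1) (hN : planeNorm j k z ≠ 0)
    (hz : ∀ l, l ≠ j → l ≠ k → z l = 0) :
    IsContactFrame a z (planeContactFrame a e j k z) where
  symp x y := by
    rw [planeContactFrame_apply, planeContactFrame_apply, ← omega_planeFrame hej hjk hN]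
    simp only [map_add, map_smul, LinearMap.add_apply, LinearMap.smul_apply, omega_self,
      omega_self_planeFrame hjk hz, omega_swap (planeFrame e j k z _) z]
    simp
  reebField x := by
    rw [planeContactFrame_apply, map_add, map_smul, omega_swap _ z, omega_self_reebField, hz1,
      smul_eq_mul]
    ring
  self x := by
    rw [planeContactFrame_apply, map_add, map_smul, omega_self, omega_self_planeFrame hjk hz]
    simp

lemma continuousOn_planeContactFrame {e : Fin m ≃ Option (Fin d)} {j k : Fin m} {u : ℂ → Fin m → ℂ}
    (hu : Continuous u) {S : Set ℂ} (hN : ∀ w ∈ S, planeNorm j k (u w) ≠ 0)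
    (x : Fin d ⊕ Fin d → ℝ) : ContinuousOn (fun w => planeContactFrame a e j k (u w) x) S := by
  have hl : ∀ l, Continuous fun w => u w l := fun l => (continuous_apply l).comp hu
  have h0 : Continuous fun w => (planeNorm j k (u w) : ℂ) :=
    Complex.continuous_ofReal.comp
      (Real.continuous_sqrt.comp (((hl j).norm.pow 2).add ((hl k).norm.pow 2)))
  have h1 : ∀ l, ContinuousOn (fun w => starRingEnd ℂ (u w l) / planeNorm j k (u w)) S := fun l =>
    (Complex.continuous_conj.comp (hl l)).continuousOn.div h0.continuousOn fun w hw => by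
      exact_mod_cast hN w hw
  have h2 : ContinuousOn (fun w => planeFrame e j k (u w) x) S := by
    refine continuousOn_pi.2 fun l => ?_
    simp only [planeFrame_apply]
    split_ifs
    · exact (h1 k).neg.mul continuousOn_const
    · exact (h1 j).mul continuousOn_const
    · exact continuousOn_const
  simp only [planeContactFrame_apply]
  have h3 : ContinuousOn (fun w => omega m (reebField a (u w)) (planeFrame e j k (u w) x)) S :=
    continuousOn_omega ((continuous_reebField a).comp hu).continuousOn h2
  have h4 : ContinuousOn (fun w => 2⁻¹ * omega m (reebField a (u w)) (planeFrame e j k (u w) x)) S :=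
    continuousOn_const.mul h3
  exact h2.add (ContinuousOn.fun_smul h4 hu.continuousOn)

/-- The disk in the plane of the coordinates `j` and `k` that is bounded by the `n`-th iterate of
the `j`-th orbit. -/
def planeDisk (a : Fin m → ℝ) (j k : Fin m) (n : ℕ) (w : ℂ) : Fin m → ℂ :=
  Pi.single j ((Real.sqrt (a j) : ℂ) * w ^ n) +
    Pi.single k ((Real.sqrt (a k) * Real.sqrt (1 - ‖w‖ ^ (2 * n)) : ℝ) : ℂ)

lemma planeDisk_apply (j k : Fin m) (hjk : k ≠ j) (n : ℕ) (w : ℂ) (l : Fin m) :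
    planeDisk a j k n w l = if l = j then (Real.sqrt (a j) : ℂ) * w ^ n else
      if l = k then ((Real.sqrt (a k) * Real.sqrt (1 - ‖w‖ ^ (2 * n)) : ℝ) : ℂ) else 0 := by
  rw [planeDisk, Pi.add_apply, Pi.single_apply, Pi.single_apply]
  by_cases hl : l = j
  · subst hl; simp [hjk.symm]
  · simp [hl]

lemma continuous_planeDisk (j k : Fin m) (n : ℕ) : Continuous (planeDisk a j k n) := by
  unfold planeDisk
  refine ((continuous_single j).comp ?_).add ((continuous_single k).comp ?_)
  · fun_prop
  · exact Complex.continuous_ofReal.comp (continuous_const.mul (Real.continuous_sqrt.comp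
      (continuous_const.sub (continuous_norm.pow _))))

lemma norm_sq_planeDisk (ha : ∀ k, 0 < a k) {j k : Fin m} (hjk : k ≠ j) (n : ℕ) {w : ℂ}
    (hw : w ∈ Metric.closedBall (0 : ℂ) 1) : ‖planeDisk a j k n w j‖ ^ 2 = a j * ‖w‖ ^ (2 * n) ∧
      ‖planeDisk a j k n w k‖ ^ 2 = a k * (1 - ‖w‖ ^ (2 * n)) := by
  have hw1 : ‖w‖ ^ (2 * n) ≤ 1 := pow_le_one₀ (norm_nonneg w) (by simpa using hw)
  rw [planeDisk_apply j k hjk, planeDisk_apply j k hjk, if_pos rfl, if_neg hjk, if_pos rfl]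
  constructor
  · rw [norm_mul, Complex.norm_real, Real.norm_eq_abs, mul_pow, sq_abs, Real.sq_sqrt (ha j).le,
      norm_pow, ← pow_mul, mul_comm n]
  · rw [Complex.norm_real, Real.norm_eq_abs, sq_abs, mul_pow, Real.sq_sqrt (ha k).le,
      Real.sq_sqrt (by linarith)]

lemma gauge_planeDisk (ha : ∀ k, 0 < a k) {j k : Fin m} (hjk : k ≠ j) (n : ℕ) {w : ℂ}
    (hw : w ∈ Metric.closedBall (0 : ℂ) 1) : gauge a (planeDisk a j k n w) = 1 := by
  obtain ⟨h1, h2⟩ := norm_sq_planeDisk ha hjk n hw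
  rw [gauge, Fintype.sum_eq_add j k hjk.symm, h1, h2]
  · rw [mul_div_cancel_left₀ _ (ha j).ne', mul_div_cancel_left₀ _ (ha k).ne']
    ring
  · rintro l ⟨hl, hl'⟩
    rw [planeDisk_apply j k hjk, if_neg hl, if_neg hl']
    simp

lemma norm_boundaryPoint (c t : ℝ) : ‖Contact.boundaryPoint c t‖ = 1 := by
  rw [Contact.boundaryPoint, Complex.norm_exp]
  simp

lemma isCappingDisk_planeDisk (ha : ∀ k, 0 < a k) {j k : Fin m} (hjk : k ≠ j) {n : ℕ} (hn : 1 ≤ n) :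
    Contact.IsCappingDisk (frontier (ellipsoid a)) (orbit a j) (n * (Real.pi * a j))
      (planeDisk a j k n) := by
  refine ⟨(continuous_planeDisk j k n).continuousOn, fun w hw => ?_, fun t => ?_⟩
  · rw [frontier_ellipsoid]
    exact gauge_planeDisk ha hjk n hw
  · have hexp : Contact.boundaryPoint (n * (Real.pi * a j)) t ^ n =
        Complex.exp (2 * Complex.I * (t / a j : ℝ)) := by
      rw [Contact.boundaryPoint, ← Complex.exp_nat_mul]
      congr 1
      have h1 : (n : ℂ) ≠ 0 := by exact_mod_cast (show n ≠ 0 by lia)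
      have h2 : (Real.pi : ℂ) ≠ 0 := by exact_mod_cast Real.pi_ne_zero
      have h3 : (a j : ℂ) ≠ 0 := by exact_mod_cast (ha j).ne'
      push_cast
      field_simp
    rw [planeDisk, hexp, norm_boundaryPoint]
    simp [orbit]

/-- The disk is `planeDisk a j k n` for some `k ≠ j`; along it, `planeFrame` is a unitary frame of the
complement of the position vector because the remaining coordinates vanish. -/
theorem exists_capping (hm : 2 ≤ m) (ha : ∀ k, 0 < a k) (j : Fin m) {n : ℕ} (hn : 1 ≤ n) :
    ∃ (u : ℂ → Fin m → ℂ) (T : ℂ → (Fin (m - 1) ⊕ Fin (m - 1) → ℝ) →L[ℝ] (Fin m → ℂ)),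
      Contact.IsCappingDisk (frontier (ellipsoid a)) (orbit a j) (n * (Real.pi * a j)) u ∧
      Contact.IsDiskTrivialization (frontier (ellipsoid a)) (liouvilleForm m) u T := by
  have : Nontrivial (Fin m) := Fin.nontrivial_iff_two_le.2 hm
  obtain ⟨k, hjk⟩ := exists_ne j
  obtain ⟨e, hej⟩ := exists_equiv_option j
  have hN : ∀ w ∈ Metric.closedBall (0 : ℂ) 1, planeNorm j k (planeDisk a j k n w) ≠ 0 := by
    intro w hw
    obtain ⟨h1, h2⟩ := norm_sq_planeDisk ha hjk n hw
    have hw1 : ‖w‖ ^ (2 * n) ≤ 1 := pow_le_one₀ (norm_nonneg w) (by simpa using hw)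
    have hw0 : 0 ≤ ‖w‖ ^ (2 * n) := by positivity
    rw [planeNorm, h1, h2]
    refine (Real.sqrt_pos.2 ?_).ne'
    rcases hw0.eq_or_lt with h | h
    · rw [← h]; simpa using ha k
    · exact add_pos_of_pos_of_nonneg (mul_pos (ha j) h)
        (mul_nonneg (ha k).le (by linarith))
  have hcap := isCappingDisk_planeDisk ha hjk hn
  refine ⟨planeDisk a j k n, fun w =>
    LinearMap.toContinuousLinearMap (planeContactFrame a e j k (planeDisk a j k n w)), hcap,
    isDiskTrivialization_of_isContactFrame (by lia) hcap.2.1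
      (continuousOn_planeContactFrame (continuous_planeDisk j k n) hN) fun w hw => ?_⟩
  refine isContactFrame_planeContactFrame hej hjk (gauge_planeDisk ha hjk n hw) (hN w hw)
    fun l hl hl' => ?_
  rw [planeDisk_apply j k hjk, if_neg hl, if_neg hl']

end Ellipsoid

/-! ### The increment of a lift along the Reeb flow -/

namespace Ellipsoid

open Filter Topology MatrixSignature MaslovChart SympPath

variable {m : ℕ} {n : Type*} [Fintype n] [DecidableEq n] {Ω : Matrix n n ℝ} {a : Fin m → ℝ}
  {F : (n → ℝ) →ₗ[ℝ] (Fin m → ℂ)}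

/-- In a frame, the fixed space of a symplectic map keeps its dimension. -/
lemma nullity_frameMatrix_sub_one (hΩ : IsCompatible Ω) (hF : IsSympFrame Ω F)
    (hs : Function.Surjective F) (L : (Fin m → ℂ) →ₗ[ℝ] (Fin m → ℂ)) :
    nullity (frameMatrix Ω F (L ∘ₗ F) - 1) = Module.finrank ℝ (LinearMap.ker (L - 1)) := by
  let e : (n → ℝ) ≃ₗ[ℝ] (Fin m → ℂ) := LinearEquiv.ofBijective F ⟨hF.injective hΩ, hs⟩
  have h1 : (LinearMap.ker (Matrix.toLin' (frameMatrix Ω F (L ∘ₗ F) - 1))).map e.toLinearMap =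
      LinearMap.ker (L - 1) := by
    ext v
    obtain ⟨x, rfl⟩ := hs v
    have h2 : F x ∈ (LinearMap.ker (Matrix.toLin' (frameMatrix Ω F (L ∘ₗ F) - 1))).map
        e.toLinearMap ↔ x ∈ LinearMap.ker (Matrix.toLin' (frameMatrix Ω F (L ∘ₗ F) - 1)) :=
      (Submodule.mem_map_equiv (e := e) _).trans (by
        rw [show e.symm (F x) = x from e.symm_apply_apply x])
    rw [h2, LinearMap.mem_ker, LinearMap.mem_ker, Matrix.toLin'_apply, Matrix.sub_mulVec,
      Matrix.one_mulVec, LinearMap.sub_apply, Module.End.one_apply, sub_eq_zero, sub_eq_zero,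
      ← (hF.injective hΩ).eq_iff, frame_frameMatrix_mulVec hΩ hF ((hs _).imp fun _ h => h.symm)]
    rfl
  rw [nullity, ← h1]
  exact (LinearEquiv.finrank_map_eq e _).symm

lemma flow_factor_eq_one_iff {b : ℝ} (hb : 0 < b) (t : ℝ) :
    Complex.exp (2 * Complex.I * (t / b : ℝ)) = 1 ↔ ∃ z : ℤ, t / (Real.pi * b) = z := by
  rw [Complex.exp_eq_one_iff]
  refine exists_congr fun z => ?_
  have h1 : (2 * Complex.I : ℂ) ≠ 0 := by simp
  have h2 : (z * (2 * Real.pi * Complex.I) : ℂ) = 2 * Complex.I * ((z * Real.pi : ℝ) : ℂ) := by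
    push_cast; ring
  rw [h2, mul_right_inj' h1, Complex.ofReal_inj]
  have := Real.pi_pos
  constructor <;> intro h <;> field_simp at h ⊢ <;> linarith

open Classical in
lemma finrank_ker_flow_sub_one (ha : ∀ k, 0 < a k) (t : ℝ) :
    Module.finrank ℝ (LinearMap.ker ((flow a t : (Fin m → ℂ) →ₗ[ℝ] (Fin m → ℂ)) - 1)) =
      ∑ k, if ∃ z : ℤ, t / (Real.pi * a k) = z then 2 else 0 := by
  set I : Set (Fin m) := {k | ∃ z : ℤ, t / (Real.pi * a k) = z} with hI
  have h1 : LinearMap.ker ((flow a t : (Fin m → ℂ) →ₗ[ℝ] (Fin m → ℂ)) - 1) =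
      ⨅ k ∈ Iᶜ, LinearMap.ker (LinearMap.proj k : (Fin m → ℂ) →ₗ[ℝ] ℂ) := by
    ext v
    simp only [LinearMap.mem_ker, Submodule.mem_iInf, LinearMap.sub_apply, Module.End.one_apply,
      sub_eq_zero, LinearMap.proj_apply]
    constructor
    · intro h k hk
      have h2 : Complex.exp (2 * Complex.I * (t / a k : ℝ)) * v k = v k := congrFun h k
      by_contra hv
      exact hk ((flow_factor_eq_one_iff (ha k) t).1 (mul_right_cancel₀ hv (h2.trans (one_mul _).symm)))
    · intro h
      ext k
      change Complex.exp (2 * Complex.I * (t / a k : ℝ)) * v k = v k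
      by_cases hk : k ∈ I
      · rw [(flow_factor_eq_one_iff (ha k) t).2 hk, one_mul]
      · rw [h k hk, mul_zero]
  rw [h1, (LinearMap.iInfKerProjEquiv ℝ (fun _ : Fin m => ℂ) (I := I) (J := Iᶜ)
    disjoint_compl_right (by simp)).finrank_eq, Module.finrank_pi_fintype]
  simp only [Complex.finrank_real_complex, Finset.sum_const, Finset.card_univ, smul_eq_mul]
  rw [← Finset.sum_filter, Finset.sum_const, smul_eq_mul, Fintype.card_subtype]
  rfl

/-- The Reeb vector field as a linear map. -/
def reebMap (a : Fin m → ℝ) : (Fin m → ℂ) →ₗ[ℝ] (Fin m → ℂ) where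
  toFun := reebField a
  map_add' x y := by ext k; simp only [reebField, Pi.add_apply]; ring
  map_smul' c x := by
    ext k; simp only [reebField, Pi.smul_apply, Complex.real_smul, RingHom.id_apply]; ring

/-- The Reeb flow in a frame of `ℂ^m`. -/
def flowMatrix (Ω : Matrix n n ℝ) (F : (n → ℝ) →ₗ[ℝ] (Fin m → ℂ)) (a : Fin m → ℝ) (t : ℝ) :
    Matrix n n ℝ :=
  frameMatrix Ω F ((flow a t : (Fin m → ℂ) →ₗ[ℝ] (Fin m → ℂ)) ∘ₗ F)

lemma isSymp_flowMatrix (hΩ : IsCompatible Ω) (hF : IsSympFrame Ω F) (hs : Function.Surjective F)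
    (t : ℝ) : IsSymp Ω (flowMatrix Ω F a t) :=
  isSymp_frameMatrix hΩ hF (fun x y => (omega_flow a t _ _).trans (hF x y))
    fun _ => (hs _).imp fun _ h => h.symm

lemma hasDerivAt_flowMatrix (t : ℝ) (i j : n) :
    HasDerivAt (fun t => flowMatrix Ω F a t i j)
      (frameMatrix Ω F (reebMap a ∘ₗ (flow a t : (Fin m → ℂ) →ₗ[ℝ] (Fin m → ℂ)) ∘ₗ F) i j) t := by
  simp only [flowMatrix, frameMatrix, Matrix.neg_apply, Matrix.mul_apply, Matrix.of_apply]
  refine (HasDerivAt.fun_sum fun k _ => HasDerivAt.const_mul (Ω i k) ?_).neg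
  exact (LinearMap.toContinuousLinearMap (omega m (F (Pi.single k 1)))).hasFDerivAt.comp_hasDerivAt t
    (hasDerivAt_flow a (F (Pi.single j 1)) t)

lemma gauge_pos (ha : ∀ k, 0 < a k) {v : Fin m → ℂ} (hv : v ≠ 0) : 0 < gauge a v := by
  obtain ⟨k, hk⟩ := Function.ne_iff.1 hv
  exact Finset.sum_pos' (fun l _ => div_nonneg (sq_nonneg _) (ha l).le)
    ⟨k, Finset.mem_univ k, div_pos (pow_pos (norm_pos_iff.2 hk) 2) (ha k)⟩

/-- The function `2 ∑_k (⌊t / (π a_k)⌋ + ⌈t / (π a_k)⌉)`. It jumps by the dimension of the fixed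
space of the Reeb flow before and after each crossing. -/
def crossingCount (a : Fin m → ℝ) (t : ℝ) : ℤ :=
  ∑ k, 2 * (⌊t / (Real.pi * a k)⌋ + ⌈t / (Real.pi * a k)⌉)

lemma floor_add_ceil_of_gt {x y : ℝ} [Decidable (∃ z : ℤ, x = z)] (h1 : x < y) (h2 : y < ⌊x⌋ + 1) :
    ⌊y⌋ + ⌈y⌉ = ⌊x⌋ + ⌈x⌉ + if ∃ z : ℤ, x = z then 1 else 0 := by
  have hy : ⌊y⌋ = ⌊x⌋ := Int.floor_eq_iff.2 ⟨(Int.floor_le x).trans h1.le, h2⟩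
  have hy' : ⌈y⌉ = ⌊x⌋ + 1 := Int.ceil_eq_iff.2
    ⟨by push_cast; linarith [Int.floor_le x], by push_cast; exact h2.le⟩
  rw [hy, hy']
  split_ifs with h
  · obtain ⟨z, rfl⟩ := h
    simp only [Int.floor_intCast, Int.ceil_intCast]
    ring
  · have : ⌈x⌉ = ⌊x⌋ + 1 := Int.ceil_eq_iff.2
      ⟨by push_cast; linarith [(Int.floor_le x).lt_of_ne fun h' => h ⟨_, h'.symm⟩],
        by push_cast; exact (Int.lt_floor_add_one x).le⟩
    rw [this, add_zero]

lemma floor_add_ceil_of_lt {x y : ℝ} [Decidable (∃ z : ℤ, x = z)] (h1 : y < x) (h2 : ⌈x⌉ - 1 < y) :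
    ⌊y⌋ + ⌈y⌉ = ⌊x⌋ + ⌈x⌉ - if ∃ z : ℤ, x = z then 1 else 0 := by
  have : Decidable (∃ z : ℤ, -x = z) := Classical.dec _
  have h := floor_add_ceil_of_gt (x := -x) (y := -y) (neg_lt_neg h1)
    (by rw [Int.floor_neg]; push_cast; linarith)
  have h3 : (∃ z : ℤ, -x = z) ↔ ∃ z : ℤ, x = z :=
    ⟨fun ⟨z, hz⟩ => ⟨-z, by push_cast; linarith⟩, fun ⟨z, hz⟩ => ⟨-z, by push_cast; linarith⟩⟩
  simp only [h3, Int.floor_neg, Int.ceil_neg] at h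
  linarith

open Classical in
lemma eventually_crossingCount_right (ha : ∀ k, 0 < a k) (t₀ : ℝ) :
    ∀ᶠ t in 𝓝[>] t₀, crossingCount a t = crossingCount a t₀ +
      ∑ k, if ∃ z : ℤ, t₀ / (Real.pi * a k) = z then 2 else 0 := by
  have h : ∀ k, ∀ᶠ t in 𝓝[>] t₀, t / (Real.pi * a k) < ⌊t₀ / (Real.pi * a k)⌋ + 1 := fun k =>
    ((continuous_id.div_const _).continuousAt.eventually
      (gt_mem_nhds (Int.lt_floor_add_one _))).filter_mono nhdsWithin_le_nhds
  filter_upwards [eventually_all.2 h, self_mem_nhdsWithin] with t ht ht'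
  rw [crossingCount, crossingCount, ← Finset.sum_add_distrib]
  refine Finset.sum_congr rfl fun k _ => ?_
  rw [floor_add_ceil_of_gt (div_lt_div_of_pos_right ht' (mul_pos Real.pi_pos (ha k))) (ht k), mul_add]
  split_ifs <;> simp

open Classical in
lemma eventually_crossingCount_left (ha : ∀ k, 0 < a k) (t₀ : ℝ) :
    ∀ᶠ t in 𝓝[<] t₀, crossingCount a t = crossingCount a t₀ -
      ∑ k, if ∃ z : ℤ, t₀ / (Real.pi * a k) = z then 2 else 0 := by
  have h : ∀ k, ∀ᶠ t in 𝓝[<] t₀, ⌈t₀ / (Real.pi * a k)⌉ - 1 < t / (Real.pi * a k) := fun k =>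
    ((continuous_id.div_const _).continuousAt.eventually
      (lt_mem_nhds (show _ < t₀ / (Real.pi * a k) by
        linarith [Int.ceil_lt_add_one (t₀ / (Real.pi * a k))]))).filter_mono nhdsWithin_le_nhds
  filter_upwards [eventually_all.2 h, self_mem_nhdsWithin] with t ht ht'
  rw [crossingCount, crossingCount, ← Finset.sum_sub_distrib]
  refine Finset.sum_congr rfl fun k _ => ?_
  rw [floor_add_ceil_of_lt (div_lt_div_of_pos_right ht' (mul_pos Real.pi_pos (ha k))) (ht k), mul_sub]
  split_ifs <;> simp

/-- All crossing forms of the Reeb flow of an ellipsoid are positive definite, so that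
`crossingCount` is a lift. -/
theorem isLift_flowMatrix (ha : ∀ k, 0 < a k) (hΩ : IsCompatible Ω) (hF : IsSympFrame Ω F)
    (hs : Function.Surjective F) (S : Set ℝ) :
    IsLift Ω (flowMatrix Ω F a) S (crossingCount a) := by
  classical
  have hsymp : ∀ t, IsSymp Ω (flowMatrix Ω F a t) := isSymp_flowMatrix hΩ hF hs
  intro t₀ ht₀ R hR hdet
  set D := frameMatrix Ω F (reebMap a ∘ₗ (flow a t₀ : (Fin m → ℂ) →ₗ[ℝ] (Fin m → ℂ)) ∘ₗ F) with hD
  set K := LinearMap.ker (Matrix.toLin' (flowMatrix Ω F a t₀ - 1)) with hK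
  have hder : ∀ i j, HasDerivWithinAt (fun t => flowMatrix Ω F a t i j) (D i j) S t₀ := fun i j =>
    (hasDerivAt_flowMatrix t₀ i j).hasDerivWithinAt
  let g : QuadraticForm ℝ K := (quadForm (Ω * D)).comp K.subtype
  have hg : ∀ x, g x = (x : n → ℝ) ⬝ᵥ (Ω * D) *ᵥ x := fun x => quadForm_apply _ _
  have hpos : ∀ x, x ≠ 0 → 0 < g x := by
    intro x hx
    have hfix : flow a t₀ (F x) = F x := by
      have h1 : (flowMatrix Ω F a t₀ - 1) *ᵥ (x : n → ℝ) = 0 := x.2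
      rw [Matrix.sub_mulVec, Matrix.one_mulVec, sub_eq_zero] at h1
      have h2 := frame_frameMatrix_mulVec (x := x) hΩ hF
        ((hs (((flow a t₀ : (Fin m → ℂ) →ₗ[ℝ] (Fin m → ℂ)) ∘ₗ F) x)).imp fun _ h => h.symm)
      rw [← flowMatrix, h1] at h2
      exact h2.symm
    obtain ⟨y, hy⟩ := hs (reebField a (F x))
    have h3 : D *ᵥ (x : n → ℝ) = y := frameMatrix_mulVec hΩ hF (by
      rw [hy]
      exact congrArg (reebField a) hfix)
    rw [hg, ← Matrix.mulVec_mulVec, h3, ← hF, hy, omega_self_reebField]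
    refine mul_pos two_pos (gauge_pos ha fun h0 => hx ?_)
    exact Subtype.ext (hF.injective hΩ (h0.trans (map_zero F).symm))
  obtain ⟨h1, h2⟩ := sig_of_pos g hpos
  have hnd : sigPos g + sigNeg g = nullity (flowMatrix Ω F a t₀ - 1) := by rw [h1, h2]; rfl
  have hdim : (sigPos g : ℤ) - (sigNeg g : ℤ) =
      ∑ k, if ∃ z : ℤ, t₀ / (Real.pi * a k) = z then 2 else 0 := by
    have h3 : sigPos g = nullity (flowMatrix Ω F a t₀ - 1) := h1
    rw [h2, h3, flowMatrix, nullity_frameMatrix_sub_one hΩ hF hs, finrank_ker_flow_sub_one ha]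
    push_cast
    simp
  have hright := eventually_jump_right hΩ hR ht₀ (fun t _ => hsymp t) hdet hder g hg hnd
  have hleft := eventually_jump_left hΩ hR ht₀ (fun t _ => hsymp t) hdet hder g hg hnd
  rw [hdim] at hright hleft
  refine eventually_nhdsWithin_of_sides rfl ?_ ?_
  · filter_upwards [hright, (eventually_crossingCount_right ha t₀).filter_mono
      (nhdsWithin_mono _ inter_subset_right)] with t h3 h4
    rw [h3.1, h4]
    ring
  · filter_upwards [hleft, (eventually_crossingCount_left ha t₀).filter_mono
      (nhdsWithin_mono _ inter_subset_right)] with t h3 h4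
    rw [h3.1, h4]
    ring

end Ellipsoid

/-! ### The index of the iterated orbits -/

namespace Ellipsoid

open Filter Topology MatrixSignature MaslovChart SympPath Contact

variable {m d : ℕ} {a : Fin m → ℝ}

lemma boundaryPoint_zero (c : ℝ) : boundaryPoint c 0 = 1 := by simp [boundaryPoint]

lemma boundaryPoint_self {c : ℝ} (hc : c ≠ 0) : boundaryPoint c c = 1 := by
  simp [boundaryPoint, div_self hc]

lemma continuous_boundaryPoint (c : ℝ) : Continuous (boundaryPoint c) := by
  unfold boundaryPoint
  fun_prop

lemma mul_boundaryPoint_mem {s : ℝ} (hs : s ∈ Icc (0 : ℝ) 1) (c t : ℝ) :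
    (s : ℂ) * boundaryPoint c t ∈ Metric.closedBall (0 : ℂ) 1 := by
  rw [mem_closedBall_zero_iff, norm_mul, norm_boundaryPoint, mul_one, Complex.norm_real,
    Real.norm_eq_abs, abs_of_nonneg hs.1]
  exact hs.2

lemma boundaryPoint_mem (c t : ℝ) : boundaryPoint c t ∈ Metric.closedBall (0 : ℂ) 1 := by
  simp [norm_boundaryPoint]

lemma continuousOn_flow_apply {X : Type*} [TopologicalSpace X] {S : Set X} {f : X → ℝ}
    {g : X → Fin m → ℂ} (hf : ContinuousOn f S) (hg : ContinuousOn g S) :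
    ContinuousOn (fun x => flow a (f x) (g x)) S := by
  refine continuousOn_pi.2 fun k => ?_
  simp only [flow_apply]
  refine ContinuousOn.mul ?_ (continuousOn_pi.1 hg k)
  exact (Complex.continuous_exp.comp (continuous_const.mul
    (Complex.continuous_ofReal.comp (continuous_id.div_const (a k))))).comp_continuousOn hf

lemma continuousOn_extendFrame {X : Type*} [TopologicalSpace X] {S : Set X} {κ : Type*} [Fintype κ]
    [DecidableEq κ] {F : X → (κ ⊕ κ → ℝ) →ₗ[ℝ] (Fin m → ℂ)} {z : X → Fin m → ℂ}
    (hF : ∀ x, ContinuousOn (fun p => F p x) S) (hz : ContinuousOn z S)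
    (x : (κ ⊕ κ) ⊕ (Unit ⊕ Unit) → ℝ) :
    ContinuousOn (fun p => extendFrame (F p) a (z p) x) S := by
  simp only [extendFrame_apply]
  exact ((hF _).add ((hz.const_smul (2⁻¹ : ℝ)).const_smul (x (Sum.inr (Sum.inl ()))))).add
    (((continuous_reebField a).comp_continuousOn hz).const_smul (x (Sum.inr (Sum.inr ()))))

lemma crossingCount_increment (ha : ∀ k, 0 < a k) (hirr : ∀ j k, j ≠ k → Irrational (a j / a k))
    (j : Fin m) (n : ℕ) (hn : 1 ≤ n) :
    ((crossingCount a (n * (Real.pi * a j)) - crossingCount a 0 : ℤ) : ℝ) / 2 =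
      (m : ℝ) - 1 + 2 * ∑ k, (⌊(n : ℝ) * (a j / a k)⌋ : ℝ) := by
  have h0 : crossingCount a 0 = 0 := by simp [crossingCount]
  have hx : ∀ k, n * (Real.pi * a j) / (Real.pi * a k) = n * (a j / a k) := fun k => by
    rw [mul_div_assoc, mul_div_mul_left _ _ Real.pi_ne_zero]
  have hceil : ∀ k, (⌈(n : ℝ) * (a j / a k)⌉ : ℝ) =
      ⌊(n : ℝ) * (a j / a k)⌋ + if k = j then 0 else 1 := by
    intro k
    split_ifs with hk
    · rw [hk, div_self (ha j).ne', mul_one, Int.ceil_natCast, Int.floor_natCast, add_zero]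
    · have hirr' : Irrational ((n : ℝ) * (a j / a k)) :=
        (hirr j k (Ne.symm hk)).natCast_mul (by lia)
      have hlt := (Int.floor_le ((n : ℝ) * (a j / a k))).lt_of_ne (hirr'.ne_int _).symm
      have : ⌈(n : ℝ) * (a j / a k)⌉ = ⌊(n : ℝ) * (a j / a k)⌋ + 1 := Int.ceil_eq_iff.2
        ⟨by push_cast; linarith, by push_cast; exact (Int.lt_floor_add_one _).le⟩
      rw [this]
      push_cast
      rfl
  have hcard : ∑ k : Fin m, (if k = j then (0 : ℝ) else 1) = m - 1 := by
    have : ∀ k : Fin m, (if k = j then (0 : ℝ) else 1) = 1 - if k = j then 1 else 0 := fun k => by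
      split_ifs <;> simp
    simp [this, Finset.sum_sub_distrib]
  rw [h0, sub_zero, crossingCount]
  push_cast
  simp only [hx, hceil, ← Finset.mul_sum, Finset.sum_add_distrib, hcard]
  ring

/-- **The index does not depend on the capping.** The matrix path of a trivialization over the disk
`u` is stabilized by the symplectic plane spanned by the radial and the Reeb direction, and then
contracted along the radii of the disk to the matrix path of the flow of `ℂ^m` in the constant frame
over `u 0`. During the contraction the matrices at the two ends of the path are conjugated only. -/
theorem increment_eq_crossingCount (hd : m = d + 1) (ha : ∀ k, 0 < a k) {γ : ℝ → Fin m → ℂ} {c : ℝ}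
    (hc : 0 < c) (hγ : ∀ t, γ t = flow a t (γ 0)) {u : ℂ → Fin m → ℂ}
    {T : ℂ → (Fin d ⊕ Fin d → ℝ) →L[ℝ] (Fin m → ℂ)}
    (hu : IsCappingDisk (frontier (ellipsoid a)) γ c u)
    (hT : IsDiskTrivialization (frontier (ellipsoid a)) (liouvilleForm m) u T)
    {Ψ : ℝ → Matrix (Fin d ⊕ Fin d) (Fin d ⊕ Fin d) ℝ}
    (hΨs : ∀ t ∈ Icc 0 c, IsSymp (J₀ (Fin d)) (Ψ t)) (hΨc : ContinuousOn Ψ (Icc 0 c))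
    (hΨ : ∀ t ∈ Icc 0 c, ∀ x, T (boundaryPoint c t) (Ψ t *ᵥ x) = flow a t (T 1 x))
    {f : ℝ → ℤ} (hf : IsLift (J₀ (Fin d)) Ψ (Icc 0 c) f) :
    f c - f 0 = crossingCount a c - crossingCount a 0 := by
  have hframe : ∀ w ∈ Metric.closedBall (0 : ℂ) 1, IsContactFrame a (u w) (T w).toLinearMap :=
    fun w hw => isContactFrame_of_isDiskTrivialization hu hT hw
  have hgauge : ∀ w ∈ Metric.closedBall (0 : ℂ) 1, gauge a (u w) = 1 := fun w hw => by
    have := hu.2.1 hw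
    rwa [frontier_ellipsoid] at this
  set Ω := sumForm (Fin d) Unit with hΩdef
  have hΩ : IsCompatible Ω := isCompatible_sumForm _ _
  set E : ℂ → ((Fin d ⊕ Fin d) ⊕ (Unit ⊕ Unit) → ℝ) →ₗ[ℝ] (Fin m → ℂ) := fun w =>
    extendFrame (T w).toLinearMap a (u w) with hE
  have hEs : ∀ w ∈ Metric.closedBall (0 : ℂ) 1, IsSympFrame Ω (E w) := fun w hw =>
    (hframe w hw).extendFrame (hgauge w hw)
  have hEsurj : ∀ w ∈ Metric.closedBall (0 : ℂ) 1, Function.Surjective (E w) := fun w hw =>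
    (hframe w hw).extendFrame_surjective hd (hgauge w hw)
  have hEc : ∀ x, ContinuousOn (fun w => E w x) (Metric.closedBall 0 1) :=
    continuousOn_extendFrame (continuousOn_clm_apply.1 hT.1) hu.1
  have hball : ∀ s ∈ Icc (0 : ℝ) 1, (s : ℂ) ∈ Metric.closedBall (0 : ℂ) 1 := fun s hs => by
    have := mul_boundaryPoint_mem hs c 0
    rwa [boundaryPoint_zero, mul_one] at this
  -- `H (s, t)` is the flow for time `t`, from the frame at `s` to the frame at `s exp (2 π i t / c)`.
  let H : ℝ × ℝ → Matrix ((Fin d ⊕ Fin d) ⊕ (Unit ⊕ Unit)) ((Fin d ⊕ Fin d) ⊕ (Unit ⊕ Unit)) ℝ :=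
    fun p => frameMatrix Ω (E (p.1 * boundaryPoint c p.2))
      ((flow a p.2 : (Fin m → ℂ) →ₗ[ℝ] (Fin m → ℂ)) ∘ₗ E p.1)
  have hHc : ContinuousOn H (Icc 0 1 ×ˢ Icc 0 c) := by
    refine continuousOn_frameMatrix (fun x => ?_) fun x => ?_
    · refine (hEc x).comp (Continuous.continuousOn ?_) fun p hp => mul_boundaryPoint_mem hp.1 c p.2
      exact (Complex.continuous_ofReal.comp continuous_fst).mul
        ((continuous_boundaryPoint c).comp continuous_snd)
    · refine continuousOn_flow_apply continuous_snd.continuousOn ?_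
      exact (hEc x).comp (Complex.continuous_ofReal.comp continuous_fst).continuousOn
        fun p hp => hball p.1 hp.1
  have hHs : ∀ s ∈ Icc (0 : ℝ) 1, ∀ t ∈ Icc 0 c, IsSymp Ω (H (s, t)) := fun s hs t _ =>
    isSymp_frameMatrix hΩ (hEs _ (mul_boundaryPoint_mem hs c t))
      (fun x y => (omega_flow a t _ _).trans (hEs _ (hball s hs) x y))
      fun x => (hEsurj _ (mul_boundaryPoint_mem hs c t) _).imp fun _ h => h.symm
  -- At both ends of the path the two frames coincide.
  have hnull : ∀ t, boundaryPoint c t = 1 → ∀ s ∈ Icc (0 : ℝ) 1,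
      nullity (H (s, t) - 1) = nullity (H (0, t) - 1) := by
    intro t ht s hs
    have key : ∀ s ∈ Icc (0 : ℝ) 1, nullity (H (s, t) - 1) = Module.finrank ℝ
        (LinearMap.ker ((flow a t : (Fin m → ℂ) →ₗ[ℝ] (Fin m → ℂ)) - 1)) := by
      intro s hs
      simp only [H, ht, mul_one]
      exact nullity_frameMatrix_sub_one hΩ (hEs _ (hball s hs)) (hEsurj _ (hball s hs)) _
    rw [key s hs, key 0 ⟨le_rfl, zero_le_one⟩]
  have h0 : ∀ t, H (0, t) = flowMatrix Ω (E 0) a t := fun t => by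
    simp [H, flowMatrix]
  have h1 : ∀ t ∈ Icc 0 c, H (1, t) = Matrix.fromBlocks (Ψ t) 0 0 1 := by
    intro t ht
    refine Matrix.ext_iff_mulVec.2 fun x => frameMatrix_mulVec hΩ
      (hEs _ (mul_boundaryPoint_mem ⟨zero_le_one, le_rfl⟩ c t)) ?_
    have hut : u (boundaryPoint c t) = flow a t (u 1) := by
      rw [hu.2.2 t, hγ t, ← boundaryPoint_zero c, hu.2.2 0]
    simp only [Complex.ofReal_one, one_mul, hE, LinearMap.comp_apply]
    rw [extendFrame_apply, extendFrame_apply, Matrix.fromBlocks_mulVec]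
    simp only [Sum.elim_comp_inl, Sum.elim_inr, Matrix.zero_mulVec, add_zero, zero_add,
      Matrix.one_mulVec, Function.comp_apply, ContinuousLinearMap.coe_coe, map_add, map_smul,
      hΨ t ht, hut, reebField_flow]
  have hlift : IsLift Ω (fun t => Matrix.fromBlocks (Ψ t) 0 0 1) (Icc 0 c) f :=
    hf.fromBlocks isCompatible_J₀ isCompatible_J₀ hΨc hΨs
  have h0ball : (0 : ℂ) ∈ Metric.closedBall (0 : ℂ) 1 := by simp
  exact (lift_increment_eq hΩ hc.le hHc hHs (hnull 0 (boundaryPoint_zero c))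
    (hnull c (boundaryPoint_self hc.ne'))
    ((isLift_flowMatrix ha hΩ (hEs 0 h0ball) (hEsurj 0 h0ball) _).congr fun t _ => h0 t)
    (hlift.congr h1)).symm

theorem reebOrbitHasIndex_orbit (hm : 2 ≤ m) (ha : ∀ k, 0 < a k)
    (hirr : ∀ j k, j ≠ k → Irrational (a j / a k)) (j : Fin m) {n : ℕ} (hn : 1 ≤ n) :
    ReebOrbitHasIndex (m - 1) (frontier (ellipsoid a)) (liouvilleForm m) (orbit a j)
      (n * (Real.pi * a j)) ((m : ℝ) - 1 + 2 * ∑ k, (⌊(n : ℝ) * (a j / a k)⌋ : ℝ)) := by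
  have hper := isPeriodicReebOrbit_orbit ha j hn
  refine ⟨hper, ⟨_, isReebFlow_flow a⟩, exists_capping hm ha j hn,
    fun σ u T hσ hu hT => ?_⟩
  set c : ℝ := n * (Real.pi * a j) with hc
  have hd : m = m - 1 + 1 := by lia
  have hbc : ∀ t, boundaryPoint c t ∈ Metric.closedBall (0 : ℂ) 1 := boundaryPoint_mem c
  have hframe : ∀ t, IsContactFrame a (u (boundaryPoint c t))
      (T (boundaryPoint c t)).toLinearMap := fun t =>
    isContactFrame_of_isDiskTrivialization hu hT (hbc t)
  have hmem : ∀ t, u (boundaryPoint c t) ∈ frontier (ellipsoid a) := fun t =>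
    hu.2.1 (hbc t)
  have hut : ∀ t, u (boundaryPoint c t) = flow a t (u (boundaryPoint c 0)) :=
    fun t => by rw [hu.2.2 t, hu.2.2 0, orbit_eq_flow]
  set L : ℝ → (Fin (m - 1) ⊕ Fin (m - 1) → ℝ) →ₗ[ℝ] (Fin m → ℂ) := fun t =>
    (flow a t : (Fin m → ℂ) →ₗ[ℝ] (Fin m → ℂ)) ∘ₗ (T (boundaryPoint c 0)).toLinearMap
    with hL
  -- The linearized flow preserves the contact distribution along the orbit.
  have hrange : ∀ t x, ∃ y, L t x = (T (boundaryPoint c t)).toLinearMap y := by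
    intro t x
    refine (hframe t).exists_eq hd ?_ ?_ ?_
    · have := hmem t
      rwa [frontier_ellipsoid] at this
    · rw [hut t, reebField_flow]
      exact (omega_flow a t _ _).trans ((hframe 0).reebField x)
    · rw [hut t]
      exact (omega_flow a t _ _).trans ((hframe 0).self x)
  set Ψ : ℝ → Matrix (Fin (m - 1) ⊕ Fin (m - 1)) (Fin (m - 1) ⊕ Fin (m - 1)) ℝ := fun t =>
    frameMatrix (J₀ _) (T (boundaryPoint c t)).toLinearMap (L t) with hΨ
  have hΨT : ∀ t x, T (boundaryPoint c t) (Ψ t *ᵥ x) =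
      flow a t (T (boundaryPoint c 0) x) := fun t x =>
    frame_frameMatrix_mulVec isCompatible_J₀ (hframe t).symp (hrange t x)
  have hΨs : ∀ t ∈ Icc 0 c, IsSymp (J₀ _) (Ψ t) := fun t _ =>
    isSymp_frameMatrix isCompatible_J₀ (hframe t).symp
      (fun x y => (omega_flow a t _ _).trans ((hframe 0).symp x y)) (hrange t)
  have hΨc : ContinuousOn Ψ (Icc 0 c) := by
    refine continuousOn_frameMatrix (fun x => ?_) fun x => ?_
    · exact (continuousOn_clm_apply.1 hT.1 x).comp (continuous_boundaryPoint c).continuousOn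
        fun t _ => hbc t
    · exact (continuous_flow a _).continuousOn
  refine ⟨Ψ, fun t _ x => ?_, fun r => ?_⟩
  · rw [hΨT, fderivWithin_reebFlow hσ (orbit_zero_mem_frontier ha j)]
    rw [← hu.2.2 0]
    exact (hframe 0).reebField x
  · obtain ⟨f, hf⟩ := exists_isLift_Icc hper.1.le isCompatible_J₀ hΨc hΨs
    rw [hasIndex_iff hper.1 hΨc hΨs hf,
      increment_eq_crossingCount hd ha hper.1 (orbit_eq_flow a j) hu hT hΨs hΨc
        (fun t _ x => by rw [hΨT, boundaryPoint_zero]) hf,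
      crossingCount_increment ha hirr j n hn]

end Ellipsoid

end

theorem lemma4p1 (m : ℕ) (hm : 2 ≤ m) (a : Fin m → ℝ) (ha : ∀ k, 0 < a k)
    (hirr : ∀ j k, j ≠ k → Irrational (a j / a k)) (j : Fin m) (n : ℕ) (hn : 1 ≤ n) :
    Contact.IsSimpleReebOrbit (frontier (Ellipsoid.ellipsoid a)) (Ellipsoid.liouvilleForm m)
      (Ellipsoid.orbit a j) (Real.pi * a j) ∧
    Contact.ReebOrbitHasIndex (m - 1) (frontier (Ellipsoid.ellipsoid a))
      (Ellipsoid.liouvilleForm m) (Ellipsoid.orbit a j) (n * (Real.pi * a j))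
      ((m : ℝ) - 1 + 2 * ∑ k, (⌊(n : ℝ) * (a j / a k)⌋ : ℝ)) :=
  ⟨Ellipsoid.isSimpleReebOrbit_orbit ha j, Ellipsoid.reebOrbitHasIndex_orbit hm ha hirr j hn⟩
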